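/- Let $k$ be a field, $N$ a finitely generated free abelian group and $\Sigma$ a rational fan in $N\otimes_{\mathbb Z}\mathbb Q$ with rays $\rho_0,\dots,\rho_n$ ($n\ge 0$) whose toric variety $X$ is projective. Let $S=k[x_0,\dots,x_n]$ be its $\mathrm{Cl}(X)$-graded Cox ring, $B=\langle \prod_{\rho_i\not\subseteq\sigma}x_i : \sigma\in\Sigma\rangle$ the irrelevant ideal, $Z=\operatorname{Spec}S\setminus V(B)$, $G=\operatorname{Spec}k[\mathrm{Cl}(X)]$, and $\mathcal X=[Z/G]$ the toric stack, whose coherent sheaves are the $G$-equivariant coherent sheaves on $Z$. Let $E=\Lambda_k(e_0,\dots,e_n)$ with the $\mathrm{Cl}(X)\oplus\mathbb Z$-grading $\deg e_i=(-\deg x_i;-1)$, and let $\omega_E=\underline{\mathrm{Hom}}_k(E,k)$. All $E$-modules are graded right modules; the left action on a right module $D$ is $yd=(-1)^{\mathrm{aux}(y)\mathrm{aux}(d)}dy$, where $\mathrm{aux}$ is the $\mathbb Z$-degree. A differential $E$-module is a $\mathrm{Cl}(X)\oplus\mathbb Z$-graded $E$-module $D$ with an $E$-linear endomorphism $\partial$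 of degree $(0;-1)$ and $\partial^2=0$; it is free if it has a homogeneous $E$-basis, minimal if $\partial(D)\subseteq D\cdot\langle e_0,\dots,e_n\rangle$, and exact if $\ker\partial=\operatorname{im}\partial$. Morphisms are the $E$-linear maps of degree $0$ commuting with the differentials. For a $\mathrm{Cl}(X)$-graded $S$-module $M$, let $\mathbf R(M)=\bigoplus_{a}M_a\otimes_k\omega_E(-a;0)$ with differential $m\otimes f\mapsto\sum_i x_im\otimes e_if$. Let $\mathcal F$ be a coherent sheaf on $\mathcal X$. Let $\check C^\bullet(\mathcal F)$ be the ($\mathrm{Cl}(X)$-graded, ordered) Čech complex of $\mathcal F$ for the cover of $Z$ by the $G$-invariant affine opens $U_\sigma=\operatorname{Spec}S[1/\prod_{\rho_i\not\subseteq\sigma}x_i]$, $\sigma$ a maximal cone; its degree $a$ strand computes $H^j(\mathcal X,\mathcal F(a))$. Let $\Phi(\mathcal F)=R\pi_{2*}(\pi_1^*\mathcal F\otimes\mathcal K)$ be the differential $E$-module $\bigoplus_{p\ge0}\bigoplus_{a}\check C^p(\mathcal F)_a\otimes_k\omega_E(-a;p)$ with differential $c\otimes f\mapsto(-1)^p\sum_i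 x_ic\otimes e_if+d_{\check C}(c)\otimes f$ for $c\in\check C^p(\mathcal F)$. Then there is a differential $E$-module $\mathbf T(\mathcal F)$ with a homotopy equivalence $\mathbf T(\mathcal F)\to\Phi(\mathcal F)$ such that: 1. $\mathbf T(\mathcal F)$ is a minimal, free differential $E$-module. 2. For all $a\in\mathrm{Cl}(X)$ and $j\in\mathbb Z$, the homotopy equivalence induces an isomorphism $\underline{\mathrm{Hom}}_E(k,\mathbf T(\mathcal F))_{(a;-j)}\cong H^j(\mathcal X,\mathcal F(a))$. 3. Let $M$ be a $\mathrm{Cl}(X)$-graded $S$-module with an identification $\widetilde M=\mathcal F$ and with $H^0_B(M)=0$. Then the natural map $M\to\bigoplus_a H^0(\mathcal X,\mathcal F(a))$ is injective and induces an embedding $\mathbf R(M)\hookrightarrow\mathbf T(\mathcal F)$ of differential $E$-modules: on $\underline{\mathrm{Hom}}_E(k,-)_{(a;0)}$ this embedding is the natural map $M_a\to H^0(\mathcal X,\mathcal F(a))$, via the isomorphism of 2. 4. If $I\subseteq\{0,\dots,n\}$ is irrelevant, i.e. $B\subseteq\langle x_i:i\in I\rangle$, then $\mathbf T(\mathcal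 F)\otimes_E E_I$ is exact, where $E_I=E/\langle e_i:i\notin I\rangle$. In particular, $\mathbf T(\mathcal F)$ is exact. -/

import Mathlib

open scoped TensorProduct DirectSum

noncomputable section

namespace ToricTate

/-! ### Gradings of vector spaces -/

section Grading

variable {k : Type*} [Field k] {ι : Type*} {D : Type*} [AddCommGroup D] [Module k D]

/-- `D` is the internal direct sum of the subspaces `𝒟 d`. -/
structure IsGrading (𝒟 : ι → Submodule k D) : Prop where
  indep : iSupIndep 𝒟
  span : ⨆ d, 𝒟 d = ⊤

theorem IsGrading.bijective [DecidableEq ι] {𝒟 : ι → Submodule k D} (h : IsGrading 𝒟) :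
    Function.Bijective (DirectSum.coeLinearMap 𝒟) :=
  DirectSum.isInternal_submodule_of_iSupIndep_of_iSup_eq_top h.indep h.span

theorem IsGrading.of_coaction {𝒟 : ι → Submodule k D} (ρ : D →ₗ[k] (ι →₀ D))
    (hρ : ∀ d, ∀ x ∈ 𝒟 d, ρ x = Finsupp.single d x) (hs : ⨆ d, 𝒟 d = ⊤) : IsGrading 𝒟 := by
  classical
  refine ⟨?_, hs⟩
  rw [iSupIndep_def]
  intro i
  rw [Submodule.disjoint_def]
  intro x hx hx'
  have key : ∀ y ∈ ⨆ j, ⨆ (_ : j ≠ i), 𝒟 j, ρ y i = 0 := by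
    intro y hy
    have : (⨆ j, ⨆ (_ : j ≠ i), 𝒟 j) ≤ LinearMap.ker ((Finsupp.lapply i).comp ρ) := by
      refine iSup_le fun j => iSup_le fun hj z hz => ?_
      simp [hρ j z hz, hj]
    simpa using this hy
  have := key x hx'
  rwa [hρ i x hx, Finsupp.single_eq_same] at this

/-- The map sending an element to the family of its homogeneous components. -/
def IsGrading.coaction {𝒟 : ι → Submodule k D} (h : IsGrading 𝒟) : D →ₗ[k] (ι →₀ D) := by
  classical
  exact (DirectSum.toModule k ι (ι →₀ D) fun d => (Finsupp.lsingle d).comp (𝒟 d).subtype).comp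
    (LinearEquiv.ofBijective (DirectSum.coeLinearMap 𝒟) h.bijective).symm.toLinearMap

theorem IsGrading.coaction_of_mem {𝒟 : ι → Submodule k D} (h : IsGrading 𝒟) {d : ι} {x : D}
    (hx : x ∈ 𝒟 d) : h.coaction x = Finsupp.single d x := by
  classical
  have : (LinearEquiv.ofBijective (DirectSum.coeLinearMap 𝒟) h.bijective).symm x =
      DirectSum.lof k ι (fun d => 𝒟 d) d ⟨x, hx⟩ := by
    rw [LinearEquiv.symm_apply_eq, LinearEquiv.ofBijective_apply, DirectSum.lof_eq_of,
      DirectSum.coeLinearMap_of]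
  simp only [IsGrading.coaction, LinearMap.comp_apply, LinearEquiv.coe_coe]
  rw [this, DirectSum.toModule_lof]
  simp

/-- Two linear maps that agree on homogeneous elements are equal. -/
theorem IsGrading.hom_ext {𝒟 : ι → Submodule k D} (h : IsGrading 𝒟) {D' : Type*}
    [AddCommGroup D'] [Module k D'] {f g : D →ₗ[k] D'} (hfg : ∀ d, ∀ x ∈ 𝒟 d, f x = g x) :
    f = g := by
  rw [← LinearMap.eqLocus_eq_top, eq_top_iff, ← h.span]
  exact iSup_le fun d x hx => hfg d x hx

/-- The linear operator that multiplies the piece of degree `d` by the scalar `c d`. -/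
def IsGrading.scale {𝒟 : ι → Submodule k D} (h : IsGrading 𝒟) (c : ι → k) : D →ₗ[k] D :=
  (Finsupp.lsum k fun d => c d • LinearMap.id).comp h.coaction

theorem IsGrading.scale_of_mem {𝒟 : ι → Submodule k D} (h : IsGrading 𝒟) (c : ι → k)
    {d : ι} {x : D} (hx : x ∈ 𝒟 d) : h.scale c x = c d • x := by
  simp [IsGrading.scale, h.coaction_of_mem hx]

end Grading

section TensorGrading

variable {k : Type*} [Field k] {ι : Type*} [AddCommGroup ι]
  {V W : Type*} [AddCommGroup V] [Module k V] [AddCommGroup W] [Module k W]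

/-- The total grading on a tensor product: the piece of degree `d` is spanned by the `v ⊗ w` with
`v`, `w` homogeneous and `deg v + deg w = d`. -/
def tensorPiece (𝒱 : ι → Submodule k V) (𝒲 : ι → Submodule k W) (d : ι) :
    Submodule k (V ⊗[k] W) :=
  Submodule.span k {t | ∃ b c, b + c = d ∧ ∃ v ∈ 𝒱 b, ∃ w ∈ 𝒲 c, t = v ⊗ₜ[k] w}

theorem tmul_mem_tensorPiece {𝒱 : ι → Submodule k V} {𝒲 : ι → Submodule k W} {b c d : ι}
    (h : b + c = d) {v : V} (hv : v ∈ 𝒱 b) {w : W} (hw : w ∈ 𝒲 c) :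
    v ⊗ₜ[k] w ∈ tensorPiece 𝒱 𝒲 d :=
  Submodule.subset_span ⟨b, c, h, v, hv, w, hw, rfl⟩

theorem IsGrading.tensor {𝒱 : ι → Submodule k V} {𝒲 : ι → Submodule k W}
    (hV : IsGrading 𝒱) (hW : IsGrading 𝒲) : IsGrading (tensorPiece 𝒱 𝒲) := by
  classical
  refine IsGrading.of_coaction
    ((Finsupp.lmapDomain (V ⊗[k] W) k (fun p : ι × ι => p.1 + p.2)).comp
      ((finsuppTensorFinsupp k k V W ι ι).toLinearMap.comp
        (TensorProduct.map hV.coaction hW.coaction))) ?_ ?_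
  · intro d x hx
    induction hx using Submodule.span_induction with
    | mem x hx =>
      obtain ⟨b, c, h, v, hv, w, hw, rfl⟩ := hx
      simp [hV.coaction_of_mem hv, hW.coaction_of_mem hw, h]
    | zero => simp
    | add x y _ _ hx hy => rw [map_add, hx, hy, Finsupp.single_add]
    | smul a x _ hx => rw [map_smul, hx, Finsupp.smul_single]
  · rw [eq_top_iff, ← TensorProduct.span_tmul_eq_top, Submodule.span_le]
    rintro _ ⟨v, w, rfl⟩
    have hv : v ∈ ⨆ d, 𝒱 d := hV.span ▸ Submodule.mem_top
    have hw : w ∈ ⨆ d, 𝒲 d := hW.span ▸ Submodule.mem_top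
    refine Submodule.iSup_induction 𝒱 (motive := fun v => v ⊗ₜ[k] w ∈ _) hv ?_ ?_ ?_
    · intro b v hv
      refine Submodule.iSup_induction 𝒲 (motive := fun w => v ⊗ₜ[k] w ∈ _) hw ?_ ?_ ?_
      · intro c w hw
        exact Submodule.mem_iSup_of_mem (b + c) (tmul_mem_tensorPiece rfl hv hw)
      · simp
      · intro x y hx hy
        rw [TensorProduct.tmul_add]; exact add_mem hx hy
    · simp
    · intro x y hx hy
      rw [TensorProduct.add_tmul]; exact add_mem hx hy

end TensorGrading

/-! ### The polynomial ring, the exterior algebra and its dual -/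

section Exterior

variable (k : Type*) [Field k] {n : ℕ} {A : Type*} [AddCommGroup A] (w : Fin (n + 1) → A)

/-- The polynomial ring `S = k[x_0, …, x_n]`. -/
abbrev Poly (n : ℕ) : Type _ := MvPolynomial (Fin (n + 1)) k

/-- The exterior algebra `E = Λ_k(e_0, …, e_n)`. -/
abbrev ExtAlg (n : ℕ) : Type _ := ExteriorAlgebra k (Fin (n + 1) → k)

variable {k} in
/-- The exterior variable `e_i`. -/
def e (i : Fin (n + 1)) : ExtAlg k n := ExteriorAlgebra.ι k (Pi.single i 1)

/-- The monomial basis `e_J = e_{j_1} ⋯ e_{j_m}` (`J = {j_1 < ⋯ < j_m}`) of `E`. -/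
def extBasis (n : ℕ) : Module.Basis (Finset (Fin (n + 1))) k (ExtAlg k n) :=
  (Pi.basisFun k (Fin (n + 1))).ExteriorAlgebra

variable {k} in
/-- The degree `(-∑_{j ∈ J} deg x_j; -|J|)` of `e_J`. -/
def wt (J : Finset (Fin (n + 1))) : A × ℤ := (-∑ j ∈ J, w j, -(J.card : ℤ))

/-- The `A ⊕ ℤ`-grading of `E` with `deg e_i = (-deg x_i; -1)`. -/
def extPiece (d : A × ℤ) : Submodule k (ExtAlg k n) :=
  Submodule.span k {x | ∃ J, wt w J = d ∧ x = extBasis k n J}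

theorem extBasis_mem (J : Finset (Fin (n + 1))) : extBasis k n J ∈ extPiece k w (wt w J) :=
  Submodule.subset_span ⟨J, rfl, rfl⟩

theorem isGrading_ext : IsGrading (extPiece k w) := by
  refine IsGrading.of_coaction
    ((extBasis k n).constr k fun J => Finsupp.single (wt w J) (extBasis k n J)) ?_ ?_
  · intro d x hx
    induction hx using Submodule.span_induction with
    | mem x hx =>
      obtain ⟨J, rfl, rfl⟩ := hx
      rw [Module.Basis.constr_basis]
    | zero => simp
    | add x y _ _ hx hy => rw [map_add, hx, hy, Finsupp.single_add]
    | smul a x _ hx => rw [map_smul, hx, Finsupp.smul_single]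
  · rw [eq_top_iff, ← (extBasis k n).span_eq, Submodule.span_le]
    rintro _ ⟨J, rfl⟩
    exact Submodule.mem_iSup_of_mem (wt w J) (extBasis_mem k w J)

theorem extBasis_mul (s t : Finset (Fin (n + 1))) :
    extBasis k n s * extBasis k n t ∈ extPiece k w (wt w s + wt w t) := by
  classical
  by_cases h : Disjoint s t
  · let s' : Set.powersetCard (Fin (n + 1)) s.card := Set.powersetCard.ofCard rfl
    let t' : Set.powersetCard (Fin (n + 1)) t.card := Set.powersetCard.ofCard rfl
    have h' : Disjoint s'.val t'.val := h
    have := ExteriorAlgebra.basis_mul_of_disjoint (Pi.basisFun k (Fin (n + 1))) s' t' h'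
    change extBasis k n s * extBasis k n t = _ • extBasis k n _ at this
    rw [this]
    have hw : wt w s + wt w t = wt w (Set.powersetCard.disjUnion h').val := by
      have : (Set.powersetCard.disjUnion h').val = s ∪ t := by
        ext; simp [Set.powersetCard.disjUnion, s', t']
      rw [this]
      ext
      · simp [wt, Finset.sum_union h, add_comm]
      · simp [wt, Finset.card_union_of_disjoint h, add_comm]
    rw [hw]
    generalize (Equiv.Perm.sign (Set.powersetCard.permOfDisjoint h')) = u
    rcases Int.units_eq_one_or u with rfl | rfl
    · rw [one_smul]; exact extBasis_mem k w _
    · rw [Units.neg_smul, one_smul]; exact neg_mem (extBasis_mem k w _)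
  · have := ExteriorAlgebra.basis_mul_of_not_disjoint (Pi.basisFun k (Fin (n + 1)))
      (Set.powersetCard.ofCard (rfl : s.card = s.card))
      (Set.powersetCard.ofCard (rfl : t.card = t.card)) h
    change extBasis k n s * extBasis k n t = 0 at this
    rw [this]; exact zero_mem _

theorem ext_mul_mem {c d : A × ℤ} {x y : ExtAlg k n} (hx : x ∈ extPiece k w c)
    (hy : y ∈ extPiece k w d) : x * y ∈ extPiece k w (c + d) := by
  induction hx using Submodule.span_induction with
  | mem x hx =>
    obtain ⟨s, rfl, rfl⟩ := hx
    induction hy using Submodule.span_induction with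
    | mem y hy =>
      obtain ⟨t, rfl, rfl⟩ := hy
      exact extBasis_mul k w s t
    | zero => simp
    | add x y _ _ hx hy => rw [mul_add]; exact add_mem hx hy
    | smul a x _ hx => rw [mul_smul_comm]; exact Submodule.smul_mem _ _ hx
  | zero => simp
  | add x y _ _ hx hy => rw [add_mul]; exact add_mem hx hy
  | smul a x _ hx => rw [smul_mul_assoc]; exact Submodule.smul_mem _ _ hx

theorem extBasis_empty : extBasis k n ∅ = 1 := by
  rw [extBasis, ExteriorAlgebra.basis_apply_ofCard _ Finset.card_empty]
  exact ExteriorAlgebra.ιMulti_zero_apply _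

theorem extBasis_singleton (i : Fin (n + 1)) : extBasis k n {i} = e i := by
  rw [extBasis, ExteriorAlgebra.basis_apply_ofCard _ (Finset.card_singleton i)]
  simp [ExteriorAlgebra.ιMulti_family, e, ExteriorAlgebra.ιMulti_apply,
    Set.powersetCard.ofFinEmbEquiv]

theorem e_mem (i : Fin (n + 1)) : (e i : ExtAlg k n) ∈ extPiece k w (-w i, -1) := by
  have := extBasis_mem k w {i}
  simpa [extBasis_singleton, wt] using this

theorem one_mem_ext : (1 : ExtAlg k n) ∈ extPiece k w 0 := by
  have := extBasis_mem k w ∅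
  rw [extBasis_empty] at this
  simpa [wt, Prod.zero_eq_mk] using this

theorem extBasis_eq_prod (J : Finset (Fin (n + 1))) :
    ∃ v : Fin J.card → (Fin (n + 1) → k),
      extBasis k n J = ((List.ofFn v).map (ExteriorAlgebra.ι k)).prod := by
  refine ⟨fun j => (Pi.basisFun k (Fin (n + 1)))
    ((Set.powersetCard.ofFinEmbEquiv.symm (Set.powersetCard.prodEquiv.symm J).2) j), ?_⟩
  rw [extBasis, ExteriorAlgebra.basis_apply]
  change ExteriorAlgebra.ιMulti k _ _ = _
  rw [ExteriorAlgebra.ιMulti_apply, List.map_ofFn]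
  rfl

/-- The augmentation `ε : E → k`, as an element of `Hom_k(E, k)`. -/
def augm (n : ℕ) : Module.Dual k (ExtAlg k n) := ExteriorAlgebra.algebraMapInv.toLinearMap

theorem augm_extBasis {J : Finset (Fin (n + 1))} (hJ : J.Nonempty) :
    augm k n (extBasis k n J) = 0 := by
  obtain ⟨v, hv⟩ := extBasis_eq_prod k J
  have : 0 < J.card := hJ.card_pos
  change ExteriorAlgebra.algebraMapInv _ = 0
  rw [hv, map_list_prod]
  refine List.prod_eq_zero ?_
  simp only [List.map_ofFn, List.mem_ofFn]
  exact ⟨⟨0, this⟩, by simp [ExteriorAlgebra.algebraMapInv]⟩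

/-- The right `E`-action `(f · y)(x) = f (y x)` on `ω_E = Hom_k(E, k)`. -/
def omegaAct (n : ℕ) : (ExtAlg k n)ᵐᵒᵖ →ₐ[k] Module.End k (Module.Dual k (ExtAlg k n)) where
  toFun y := LinearMap.lcomp k k (LinearMap.mulLeft k y.unop)
  map_one' := by ext; simp
  map_mul' x y := by ext; simp
  map_zero' := by ext; simp
  map_add' x y := by ext; simp [add_mul]
  commutes' c := by ext; simp [← Algebra.smul_def]

@[simp] theorem omegaAct_apply (y : (ExtAlg k n)ᵐᵒᵖ) (f : Module.Dual k (ExtAlg k n))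
    (x : ExtAlg k n) : omegaAct k n y f x = f (y.unop * x) := rfl

/-- The piece of degree `d` of `ω_E`: the functionals vanishing on all `E_c` with `c ≠ -d`. -/
def omegaPiece (d : A × ℤ) : Submodule k (Module.Dual k (ExtAlg k n)) where
  carrier := {f | ∀ c, c ≠ -d → ∀ x ∈ extPiece k w c, f x = 0}
  add_mem' hf hg c hc x hx := by simp [hf c hc x hx, hg c hc x hx]
  zero_mem' := by intro c _ x _; rfl
  smul_mem' a f hf c hc x hx := by simp [hf c hc x hx]

theorem isGrading_omega : IsGrading (omegaPiece k w) := by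
  classical
  let b := (extBasis k n).dualBasis
  have hb : ∀ J, b J ∈ omegaPiece k w (-wt w J) := by
    intro J c hc x hx
    induction hx using Submodule.span_induction with
    | mem x hx =>
      obtain ⟨I, rfl, rfl⟩ := hx
      have : I ≠ J := by rintro rfl; simp at hc
      simp [b, this]
    | zero => simp
    | add x y _ _ hx hy => rw [map_add, hx, hy, add_zero]
    | smul a x _ hx => rw [map_smul, hx, smul_zero]
  have hsum : ∀ f : Module.Dual k (ExtAlg k n), f = ∑ J, f (extBasis k n J) • b J := by
    intro f
    refine (extBasis k n).ext fun I => ?_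
    simp [b]
  refine IsGrading.of_coaction
    (b.constr k fun J => Finsupp.single (-wt w J) (b J)) ?_ ?_
  · intro d f hf
    conv_lhs => rw [hsum f]
    rw [map_sum]
    conv_rhs => rw [hsum f]
    rw [← Finsupp.singleAddHom_apply, map_sum]
    refine Finset.sum_congr rfl fun J _ => ?_
    rw [map_smul, Module.Basis.constr_basis, Finsupp.smul_single, Finsupp.singleAddHom_apply]
    by_cases h : wt w J = -d
    · rw [h, neg_neg]
    · rw [hf _ h _ (extBasis_mem k w J)]; simp
  · rw [eq_top_iff, ← b.span_eq, Submodule.span_le]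
    rintro _ ⟨J, rfl⟩
    exact Submodule.mem_iSup_of_mem _ (hb J)

theorem augm_mem : augm k n ∈ omegaPiece k w 0 := by
  intro c hc x hx
  induction hx using Submodule.span_induction with
  | mem x hx =>
    obtain ⟨J, rfl, rfl⟩ := hx
    refine augm_extBasis k (Finset.nonempty_iff_ne_empty.mpr ?_)
    rintro rfl
    simp [wt, Prod.zero_eq_mk] at hc
  | zero => simp
  | add x y _ _ hx hy => rw [map_add, hx, hy, add_zero]
  | smul a x _ hx => rw [map_smul, hx, smul_zero]

theorem omegaAct_mem {c d : A × ℤ} {f : Module.Dual k (ExtAlg k n)} {y : ExtAlg k n}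
    (hf : f ∈ omegaPiece k w c) (hy : y ∈ extPiece k w d) :
    omegaAct k n (MulOpposite.op y) f ∈ omegaPiece k w (c + d) := by
  intro b hb x hx
  refine hf (d + b) (fun h => hb ?_) _ (ext_mul_mem k w hy hx)
  rw [neg_add, ← h]; abel

/-- Left multiplication by `e_i` on `ω_E`. The right module `ω_E` is a left module through
`y f = (-1)^{aux(y) aux(f)} f y`; for `y = e_i` this is `(e_i f)(x) = -f (x e_i)`, as
`leftMul_eq` below shows. -/
def leftMul (i : Fin (n + 1)) : Module.End k (Module.Dual k (ExtAlg k n)) :=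
  -LinearMap.lcomp k k (LinearMap.mulRight k (e i))

@[simp] theorem leftMul_apply (i : Fin (n + 1)) (f : Module.Dual k (ExtAlg k n))
    (x : ExtAlg k n) : leftMul k i f x = -f (x * e i) := rfl

theorem leftMul_mem (i : Fin (n + 1)) {c : A × ℤ} {f : Module.Dual k (ExtAlg k n)}
    (hf : f ∈ omegaPiece k w c) : leftMul k i f ∈ omegaPiece k w (c + (-w i, -1)) := by
  intro b hb x hx
  rw [leftMul_apply, neg_eq_zero]
  refine hf (b + (-w i, -1)) (fun h => hb ?_) _ (ext_mul_mem k w hx (e_mem k w i))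
  rw [neg_add, ← h]; abel

theorem e_mul_extBasis (i : Fin (n + 1)) (J : Finset (Fin (n + 1))) :
    (e i : ExtAlg k n) * extBasis k n J = (-1 : k) ^ J.card • (extBasis k n J * e i) := by
  have key : ∀ l : List (Fin (n + 1) → k),
      (e i : ExtAlg k n) * (l.map (ExteriorAlgebra.ι k)).prod =
        (-1 : k) ^ l.length • ((l.map (ExteriorAlgebra.ι k)).prod * e i) := by
    intro l
    induction l with
    | nil => simp
    | cons v l ih =>
      have hv : (e i : ExtAlg k n) * ExteriorAlgebra.ι k v = -(ExteriorAlgebra.ι k v * e i) :=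
        eq_neg_of_add_eq_zero_left (ExteriorAlgebra.ι_add_mul_swap _ _)
      rw [List.map_cons, List.prod_cons, ← mul_assoc, hv, neg_mul, mul_assoc, ih,
        List.length_cons, pow_succ, mul_smul_comm, mul_assoc]
      simp
  obtain ⟨v, hv⟩ := extBasis_eq_prod k J
  rw [hv, key, List.length_ofFn]

theorem leftMul_eq (i : Fin (n + 1)) {a : A} {j : ℤ} {f : Module.Dual k (ExtAlg k n)}
    (hf : f ∈ omegaPiece k w (a, j)) :
    leftMul k i f = (-1 : k) ^ j • omegaAct k n (MulOpposite.op (e i)) f := by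
  refine (extBasis k n).ext fun J => ?_
  simp only [leftMul_apply, LinearMap.smul_apply, omegaAct_apply, MulOpposite.unop_op]
  by_cases h : wt w J + (-w i, -1) = -(a, j)
  · have hj : j = J.card + 1 := by
      have := congrArg Prod.snd h
      simp [wt] at this
      omega
    rw [e_mul_extBasis, map_smul, hj, smul_smul, zpow_add₀ (by simp), zpow_natCast, zpow_one,
      mul_right_comm, ← mul_pow]
    simp
  · have h1 := hf _ h _ (ext_mul_mem k w (extBasis_mem k w J) (e_mem k w i))
    rw [e_mul_extBasis, map_smul, h1]
    simp

end Exterior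

/-! ### Graded `E`-modules and differential `E`-modules -/

section DM

universe t t'

variable (k : Type*) [Field k] {n : ℕ} {A : Type*} [AddCommGroup A] (w : Fin (n + 1) → A)

/-- An `A ⊕ ℤ`-graded right `E`-module. -/
structure GrEMod where
  carrier : Type t
  [addCommGroup : AddCommGroup carrier]
  [moduleBase : Module k carrier]
  [moduleE : Module (ExtAlg k n)ᵐᵒᵖ carrier]
  [tower : IsScalarTower k (ExtAlg k n)ᵐᵒᵖ carrier]
  piece : A × ℤ → Submodule k carrier
  isGrading : IsGrading piece
  smul_mem : ∀ {c d : A × ℤ} {x : carrier} {y : ExtAlg k n}, x ∈ piece c → y ∈ extPiece k w d →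
    MulOpposite.op y • x ∈ piece (c + d)

attribute [instance] GrEMod.addCommGroup GrEMod.moduleBase GrEMod.moduleE GrEMod.tower

/-- A differential `E`-module: a graded right `E`-module with a square-zero endomorphism of degree
`(0; -1)`. -/
structure DM extends GrEMod.{t} k w where
  d : carrier →ₗ[(ExtAlg k n)ᵐᵒᵖ] carrier
  d_mem : ∀ {a : A} {j : ℤ} {x : carrier}, x ∈ piece (a, j) → d x ∈ piece (a, j - 1)
  d_sq : ∀ x, d (d x) = 0

variable {k w}

/-- The degree `d` part of the internal Hom `Hom_E(D, D')`: the `E`-linear maps of degree `d`. -/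
def internalHom (D : GrEMod.{t} k w) (D' : GrEMod.{t'} k w) (d : A × ℤ) :
    Submodule k (D.carrier →ₗ[(ExtAlg k n)ᵐᵒᵖ] D'.carrier) where
  carrier := {f | ∀ c, ∀ x ∈ D.piece c, f x ∈ D'.piece (c + d)}
  add_mem' hf hg c x hx := add_mem (hf c x hx) (hg c x hx)
  zero_mem' _ _ _ := zero_mem _
  smul_mem' a _ hf c x hx := Submodule.smul_mem _ a (hf c x hx)

/-- A morphism of differential `E`-modules: an `E`-linear map of degree `0` commuting with the
differentials. -/
structure DM.Hom (D : DM.{t} k w) (D' : DM.{t'} k w) where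
  toFun : D.carrier →ₗ[(ExtAlg k n)ᵐᵒᵖ] D'.carrier
  degree : toFun ∈ internalHom D.toGrEMod D'.toGrEMod 0
  comm : ∀ x, toFun (D.d x) = D'.d (toFun x)

/-- `f` and `g` are homotopic: `f - g = h ∂ + ∂' h` for an `E`-linear `h` of degree `(0; 1)`. -/
def DM.Homotopic {D : DM.{t} k w} {D' : DM.{t'} k w}
    (f g : D.carrier →ₗ[(ExtAlg k n)ᵐᵒᵖ] D'.carrier) : Prop :=
  ∃ h ∈ internalHom D.toGrEMod D'.toGrEMod (0, 1), ∀ x, f x - g x = h (D.d x) + D'.d (h x)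

/-- A morphism of differential modules is a homotopy equivalence. -/
def DM.Hom.IsHomotopyEquiv {D : DM.{t} k w} {D' : DM.{t'} k w} (f : D.Hom D') : Prop :=
  ∃ g : D'.Hom D,
    DM.Homotopic (D := D) (D' := D) (g.toFun.comp f.toFun) LinearMap.id ∧
    DM.Homotopic (D := D') (D' := D') (f.toFun.comp g.toFun) LinearMap.id

/-- The underlying graded module is free: it has a basis of homogeneous elements. -/
def DM.IsFree (D : DM.{t} k w) : Prop :=
  ∃ (I : Type t) (b : Module.Basis I (ExtAlg k n)ᵐᵒᵖ D.carrier), ∀ i, ∃ c, b i ∈ D.piece c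

/-- The submodule `D · ⟨e_i : i ∈ I⟩`. -/
def DM.mulVars (D : DM.{t} k w) (I : Set (Fin (n + 1))) :
    Submodule (ExtAlg k n)ᵐᵒᵖ D.carrier :=
  Submodule.span _ {x | ∃ i ∈ I, ∃ y, x = MulOpposite.op (e i : ExtAlg k n) • y}

/-- Minimality: `∂(D) ⊆ D · ⟨e_0, …, e_n⟩`. -/
def DM.IsMinimal (D : DM.{t} k w) : Prop := ∀ x, D.d x ∈ D.mulVars Set.univ

/-- Exactness: every cycle is a boundary. -/
def DM.IsExact (D : DM.{t} k w) : Prop := Function.Exact D.d D.d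

/-- The module `D ⊗_E E_I = D / D · ⟨e_i : i ∉ I⟩`, where `E_I = E / ⟨e_i : i ∉ I⟩`. -/
abbrev DM.Restrict (D : DM.{t} k w) (I : Set (Fin (n + 1))) : Type t :=
  D.carrier ⧸ D.mulVars Iᶜ

/-- The differential `∂ ⊗ 1` of `D ⊗_E E_I`. -/
def DM.restrictD (D : DM.{t} k w) (I : Set (Fin (n + 1))) :
    D.Restrict I →ₗ[(ExtAlg k n)ᵐᵒᵖ] D.Restrict I :=
  (D.mulVars Iᶜ).mapQ (D.mulVars Iᶜ) D.d <| by
    rw [DM.mulVars, Submodule.span_le]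
    rintro _ ⟨i, hi, y, rfl⟩
    refine Submodule.subset_span ⟨i, hi, D.d y, ?_⟩
    rw [map_smul]

variable (k w)

/-- The one-dimensional space `k`, concentrated in degree `0`. -/
def residuePiece (d : A × ℤ) : Submodule k k where
  carrier := {r | d ≠ 0 → r = 0}
  add_mem' hr hs h := by rw [hr h, hs h, add_zero]
  zero_mem' _ := rfl
  smul_mem' a r hr h := by rw [hr h, smul_zero]

theorem isGrading_residuePiece : IsGrading (residuePiece k (A := A)) := by
  refine IsGrading.of_coaction (Finsupp.lsingle 0) ?_ ?_
  · intro d x hx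
    by_cases h : d = 0
    · rw [h]; rfl
    · rw [hx h]; simp
  · rw [eq_top_iff]
    exact le_iSup_of_le 0 fun x _ h => absurd rfl h

/-- The residue field `k = E / ⟨e_0, …, e_n⟩`, a graded `E`-module concentrated in degree `0`; here
`E` acts through the augmentation. -/
def residue : GrEMod k w :=
  letI : Module (ExtAlg k n)ᵐᵒᵖ k := Module.compHom k
    ((ExteriorAlgebra.algebraMapInv (R := k) (M := Fin (n + 1) → k)).toRingHom.fromOpposite
      fun _ _ => mul_comm _ _)
  have hs : ∀ (y : (ExtAlg k n)ᵐᵒᵖ) (c : k), y • c = augm k n y.unop * c := fun _ _ => rfl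
  { carrier := k
    tower := ⟨fun a y c => by
      rw [hs, hs, MulOpposite.unop_smul, map_smul, smul_eq_mul, smul_eq_mul, mul_assoc]⟩
    piece := residuePiece k
    isGrading := isGrading_residuePiece k
    smul_mem := by
      intro c d x y hx hy h
      rw [hs, MulOpposite.unop_op]
      by_cases hc : c = 0
      · rw [augm_mem k w d (by rw [neg_zero]; rintro rfl; exact h (by rw [hc, add_zero])) y hy,
          zero_mul]
      · rw [hx hc, mul_zero] }

/-- The element `1` of the residue field. -/
def residueOne : (residue k w).carrier := (1 : k)

theorem residueOne_mem : residueOne k w ∈ (residue k w).piece 0 := fun h => absurd rfl h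

variable {k w}

/-- Postcomposition with a degree `0` map acts on the graded pieces of `Hom_E(k, -)`. -/
def DM.Hom.push {D : DM.{t} k w} {D' : DM.{t'} k w} (g : D.Hom D') {d : A × ℤ}
    (f : internalHom (residue k w) D.toGrEMod d) :
    internalHom (residue k w) D'.toGrEMod d :=
  ⟨g.toFun.comp f.1, fun c x hx => by
    have := g.degree _ _ (f.2 c x hx)
    rwa [add_zero] at this⟩

end DM

/-! ### Graded `S`-modules, complexes and the functor `R` -/

section BGG

universe t

variable (k : Type*) [Field k] {n : ℕ} {A : Type*} [AddCommGroup A] (w : Fin (n + 1) → A)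

/-- An `A`-graded `S`-module, where `deg x_i = w i`. -/
structure GrSMod where
  carrier : Type t
  [addCommGroup : AddCommGroup carrier]
  [moduleBase : Module k carrier]
  [moduleS : Module (Poly k n) carrier]
  [tower : IsScalarTower k (Poly k n) carrier]
  piece : A → Submodule k carrier
  isGrading : IsGrading piece
  smul_mem : ∀ {a b : A} {p : Poly k n} {x : carrier},
    p ∈ MvPolynomial.weightedHomogeneousSubmodule k w b → x ∈ piece a → p • x ∈ piece (a + b)

attribute [instance] GrSMod.addCommGroup GrSMod.moduleBase GrSMod.moduleS GrSMod.tower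

/-- A complex `C` of `A`-graded `S`-modules, given as the direct sum of its terms: `piece (a, j)` is
the degree `a` part of the term `C_j` in homological degree `j`. -/
structure SComplex where
  carrier : Type t
  [addCommGroup : AddCommGroup carrier]
  [moduleBase : Module k carrier]
  [moduleS : Module (Poly k n) carrier]
  [tower : IsScalarTower k (Poly k n) carrier]
  piece : A × ℤ → Submodule k carrier
  isGrading : IsGrading piece
  smul_mem : ∀ {a b : A} {j : ℤ} {p : Poly k n} {x : carrier},
    p ∈ MvPolynomial.weightedHomogeneousSubmodule k w b → x ∈ piece (a, j) →
      p • x ∈ piece (a + b, j)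
  d : carrier →ₗ[Poly k n] carrier
  d_mem : ∀ {a : A} {j : ℤ} {x : carrier}, x ∈ piece (a, j) → d x ∈ piece (a, j - 1)
  d_sq : ∀ x, d (d x) = 0

attribute [instance] SComplex.addCommGroup SComplex.moduleBase SComplex.moduleS SComplex.tower

variable {k w}

/-- The cycles of degree `a` in `C_j`. -/
def SComplex.cycles (C : SComplex.{t} k w) (a : A) (j : ℤ) : Submodule k C.carrier :=
  C.piece (a, j) ⊓ LinearMap.ker (C.d.restrictScalars k)

/-- The boundaries of degree `a` in `C_j`. -/
def SComplex.boundaries (C : SComplex.{t} k w) (a : A) (j : ℤ) : Submodule k C.carrier :=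
  (C.piece (a, j + 1)).map (C.d.restrictScalars k)

/-- The homology `H_j(C)_a`. -/
abbrev SComplex.Homology (C : SComplex.{t} k w) (a : A) (j : ℤ) : Type t :=
  C.cycles a j ⧸ (C.boundaries a j).submoduleOf (C.cycles a j)

/-- A graded `S`-module as a complex concentrated in homological degree `0`. -/
def GrSMod.toComplex (M : GrSMod.{t} k w) : SComplex.{t} k w where
  carrier := M.carrier
  piece d :=
    { carrier := {x | x ∈ M.piece d.1 ∧ (d.2 ≠ 0 → x = 0)}
      add_mem' := fun hx hy => ⟨add_mem hx.1 hy.1, fun h => by rw [hx.2 h, hy.2 h, add_zero]⟩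
      zero_mem' := ⟨zero_mem _, fun _ => rfl⟩
      smul_mem' := fun a x hx =>
        ⟨Submodule.smul_mem _ a hx.1, fun h => by rw [hx.2 h, smul_zero]⟩ }
  isGrading := by
    refine IsGrading.of_coaction
      ((Finsupp.lmapDomain _ k fun a : A => (a, (0 : ℤ))).comp M.isGrading.coaction) ?_ ?_
    · rintro ⟨a, j⟩ x ⟨hx, hx'⟩
      by_cases h : j = 0
      · subst h
        simp [M.isGrading.coaction_of_mem hx]
      · rw [hx' h]; simp
    · rw [eq_top_iff, ← M.isGrading.span]
      exact iSup_le fun a => le_iSup_of_le (a, 0) fun x hx => ⟨hx, fun h => absurd rfl h⟩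
  smul_mem hp hx := ⟨M.smul_mem hp hx.1, fun h => by rw [hx.2 h, smul_zero]⟩
  d := 0
  d_mem _ := zero_mem _
  d_sq _ := rfl

/-- An element of `M_a`, in homological degree `0`. -/
def GrSMod.inPiece (M : GrSMod.{t} k w) {a : A} (m : M.piece a) : M.toComplex.piece (a, -0) :=
  ⟨(m : M.carrier), m.2, fun h => absurd rfl h⟩

/-- Multiplication by `x_i`, as a `k`-linear map. -/
def SComplex.mulX (C : SComplex.{t} k w) (i : Fin (n + 1)) : Module.End k C.carrier :=
  (LinearMap.lsmul (Poly k n) C.carrier (MvPolynomial.X i)).restrictScalars k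

/-- The sign `(-1)^j` on `C_j`. -/
def SComplex.sgn (C : SComplex.{t} k w) : Module.End k C.carrier :=
  C.isGrading.scale fun d => (-1 : k) ^ d.2

theorem SComplex.mulX_mem (C : SComplex.{t} k w) (i : Fin (n + 1)) {a : A} {j : ℤ}
    {x : C.carrier} (hx : x ∈ C.piece (a, j)) : C.mulX i x ∈ C.piece (a + w i, j) :=
  C.smul_mem (MvPolynomial.isWeightedHomogeneous_X k w i) hx

theorem SComplex.sgn_of_mem (C : SComplex.{t} k w) {a : A} {j : ℤ}
    {x : C.carrier} (hx : x ∈ C.piece (a, j)) : C.sgn x = (-1 : k) ^ j • x :=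
  C.isGrading.scale_of_mem _ hx

theorem SComplex.mulX_comm (C : SComplex.{t} k w) (i j : Fin (n + 1)) (x : C.carrier) :
    C.mulX i (C.mulX j x) = C.mulX j (C.mulX i x) :=
  smul_comm (MvPolynomial.X i : Poly k n) (MvPolynomial.X j : Poly k n) x

theorem SComplex.sgn_sgn (C : SComplex.{t} k w) (x : C.carrier) : C.sgn (C.sgn x) = x := by
  have : C.sgn.comp C.sgn = LinearMap.id := C.isGrading.hom_ext fun d x hx => by
    rw [LinearMap.comp_apply, C.sgn_of_mem hx, map_smul, C.sgn_of_mem hx, smul_smul, ← mul_zpow]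
    simp
  exact LinearMap.congr_fun this x

theorem SComplex.sgn_mulX (C : SComplex.{t} k w) (i : Fin (n + 1)) (x : C.carrier) :
    C.sgn (C.mulX i x) = C.mulX i (C.sgn x) := by
  have : C.sgn.comp (C.mulX i) = (C.mulX i).comp C.sgn := C.isGrading.hom_ext fun d x hx => by
    rw [LinearMap.comp_apply, LinearMap.comp_apply, C.sgn_of_mem hx,
      C.sgn_of_mem (C.mulX_mem i hx), map_smul]
  exact LinearMap.congr_fun this x

theorem SComplex.sgn_d (C : SComplex.{t} k w) (x : C.carrier) :
    C.sgn (C.d x) = -C.d (C.sgn x) := by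
  have : C.sgn.comp (C.d.restrictScalars k) = -(C.d.restrictScalars k).comp C.sgn :=
    C.isGrading.hom_ext fun d x hx => by
      simp only [LinearMap.comp_apply, LinearMap.neg_apply, LinearMap.restrictScalars_apply]
      rw [C.sgn_of_mem hx, C.sgn_of_mem (C.d_mem hx), zpow_sub₀ (by simp),
        ← LinearMap.restrictScalars_apply k C.d, ← LinearMap.restrictScalars_apply k C.d, map_smul]
      simp [div_neg]
  exact LinearMap.congr_fun this x

theorem SComplex.d_mulX (C : SComplex.{t} k w) (i : Fin (n + 1)) (x : C.carrier) :
    C.d (C.mulX i x) = C.mulX i (C.d x) :=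
  map_smul C.d (MvPolynomial.X i : Poly k n) x

/-- The operator `x_i ⊗ e_i` on `C ⊗ ω_E`, with the sign `(-1)^j` on `C_j ⊗ ω_E`. -/
def SComplex.koszulTerm (C : SComplex.{t} k w) (i : Fin (n + 1)) :
    Module.End k (C.carrier ⊗[k] Module.Dual k (ExtAlg k n)) :=
  TensorProduct.map (C.sgn * C.mulX i) (leftMul k i)

/-- The differential
`c ⊗ f ↦ (-1)^j ∑_i x_i c ⊗ e_i f + ∂_C(c) ⊗ f` on `C ⊗ ω_E`, where `c ∈ C_j`. -/
def SComplex.rD (C : SComplex.{t} k w) :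
    Module.End k (C.carrier ⊗[k] Module.Dual k (ExtAlg k n)) :=
  ∑ i, C.koszulTerm i + TensorProduct.map (C.d.restrictScalars k) LinearMap.id

theorem SComplex.rD_tmul (C : SComplex.{t} k w) (c : C.carrier)
    (f : Module.Dual k (ExtAlg k n)) :
    C.rD (c ⊗ₜ f) = ∑ i, C.sgn (C.mulX i c) ⊗ₜ leftMul k i f + C.d c ⊗ₜ f := by
  simp [SComplex.rD, SComplex.koszulTerm, LinearMap.sum_apply]

theorem leftMul_leftMul_self (i : Fin (n + 1)) (f : Module.Dual k (ExtAlg k n)) :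
    leftMul k i (leftMul k i f) = 0 := by
  refine LinearMap.ext fun x => ?_
  simp [mul_assoc, e]

theorem leftMul_leftMul_swap (i j : Fin (n + 1)) (f : Module.Dual k (ExtAlg k n)) :
    leftMul k i (leftMul k j f) = -leftMul k j (leftMul k i f) := by
  refine LinearMap.ext fun x => ?_
  have h : (e i : ExtAlg k n) * e j = -(e j * e i) :=
    eq_neg_of_add_eq_zero_left (ExteriorAlgebra.ι_add_mul_swap _ _)
  simp [mul_assoc, h]

/-- A sum over pairs vanishes if the diagonal terms vanish and the other ones cancel in pairs. -/
theorem sum_sum_eq_zero_of_swap {ι V : Type*} [AddCommGroup V] (s : Finset ι) (g : ι → ι → V)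
    (hd : ∀ i ∈ s, g i i = 0) (hs : ∀ i ∈ s, ∀ j ∈ s, i ≠ j → g i j + g j i = 0) :
    ∑ i ∈ s, ∑ j ∈ s, g i j = 0 := by
  classical
  rw [← Finset.sum_product']
  refine Finset.sum_involution (fun p _ => (p.2, p.1)) ?_ ?_ ?_ ?_
  · rintro ⟨i, j⟩ hp
    simp only [Finset.mem_product] at hp
    by_cases h : i = j
    · subst h; simp [hd i hp.1]
    · exact hs i hp.1 j hp.2 h
  · rintro ⟨i, j⟩ hp hne heq
    simp only [Finset.mem_product, Prod.mk.injEq] at hp heq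
    exact hne (by rw [heq.1]; exact hd i hp.1)
  · rintro ⟨i, j⟩ hp
    simp only [Finset.mem_product] at hp ⊢
    exact ⟨hp.2, hp.1⟩
  · rintro ⟨i, j⟩ _; rfl

theorem SComplex.rD_rD (C : SComplex.{t} k w)
    (x : C.carrier ⊗[k] Module.Dual k (ExtAlg k n)) : C.rD (C.rD x) = 0 := by
  induction x using TensorProduct.induction_on with
  | zero => simp
  | add x y hx hy => rw [map_add, map_add, hx, hy, add_zero]
  | tmul c f =>
    rw [C.rD_tmul, map_add, map_sum, C.rD_tmul]
    simp only [C.rD_tmul, C.d_sq, TensorProduct.zero_tmul, add_zero, Finset.sum_add_distrib]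
    have h1 : ∑ i, ∑ j, C.sgn (C.mulX j (C.sgn (C.mulX i c))) ⊗ₜ[k]
        leftMul k j (leftMul k i f) = 0 := by
      refine sum_sum_eq_zero_of_swap _ _ (fun i _ => ?_) (fun i _ j _ _ => ?_)
      · rw [leftMul_leftMul_self, TensorProduct.tmul_zero]
      · rw [leftMul_leftMul_swap j i, TensorProduct.tmul_neg, C.sgn_mulX j, C.sgn_sgn,
          C.sgn_mulX i, C.sgn_sgn, C.mulX_comm j i, neg_add_cancel]
    rw [h1, zero_add, ← Finset.sum_add_distrib]
    refine Finset.sum_eq_zero fun i _ => ?_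
    rw [← C.d_mulX, C.sgn_d, TensorProduct.neg_tmul, add_neg_cancel]

/-- The functor `R`: the differential `E`-module `R(C)` with underlying graded module
`⨁_j ⨁_a (C_j)_a ⊗ ω_E(-a; -j)`, that is `C ⊗ ω_E` with its total grading. -/
def SComplex.R (C : SComplex.{t} k w) : DM k w := by
  letI : Module (ExtAlg k n)ᵐᵒᵖ (C.carrier ⊗[k] Module.Dual k (ExtAlg k n)) :=
    Module.compHom _ ((Module.End.lTensorAlgHom k _ C.carrier).comp (omegaAct k n)).toRingHom
  have hs : ∀ (y : (ExtAlg k n)ᵐᵒᵖ) (x : C.carrier ⊗[k] Module.Dual k (ExtAlg k n)),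
      y • x = (omegaAct k n y).lTensor C.carrier x := fun _ _ => rfl
  haveI : IsScalarTower k (ExtAlg k n)ᵐᵒᵖ (C.carrier ⊗[k] Module.Dual k (ExtAlg k n)) :=
    ⟨fun a y x => by rw [hs, hs, map_smul, LinearMap.lTensor_smul]; rfl⟩
  exact
  { carrier := C.carrier ⊗[k] Module.Dual k (ExtAlg k n)
    piece := tensorPiece C.piece (omegaPiece k w)
    isGrading := C.isGrading.tensor (isGrading_omega k w)
    smul_mem := by
      intro c d x y hx hy
      rw [hs]
      induction hx using Submodule.span_induction with
      | mem x hx =>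
        obtain ⟨b, b', rfl, v, hv, f, hf, rfl⟩ := hx
        rw [LinearMap.lTensor_tmul]
        exact tmul_mem_tensorPiece (by abel) hv (omegaAct_mem k w hf hy)
      | zero => simp
      | add x y _ _ hx hy => rw [map_add]; exact add_mem hx hy
      | smul a x _ hx => rw [map_smul]; exact Submodule.smul_mem _ _ hx
    d :=
      { toFun := C.rD
        map_add' := map_add _
        map_smul' := by
          intro y x
          rw [RingHom.id_apply, hs, hs]
          induction x using TensorProduct.induction_on with
          | zero => simp
          | add x y hx hy => simp only [map_add, hx, hy]
          | tmul c f =>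
            rw [LinearMap.lTensor_tmul, C.rD_tmul, C.rD_tmul, map_add, map_sum]
            simp only [LinearMap.lTensor_tmul]
            congr 1
            refine Finset.sum_congr rfl fun i _ => ?_
            congr 1
            refine LinearMap.ext fun z => ?_
            simp [mul_assoc] }
    d_mem := by
      intro a j x hx
      change C.rD x ∈ _
      induction hx using Submodule.span_induction with
      | mem x hx =>
        obtain ⟨⟨b, i⟩, ⟨b', i'⟩, h, v, hv, f, hf, rfl⟩ := hx
        rw [Prod.mk_add_mk, Prod.mk.injEq] at h
        obtain ⟨rfl, rfl⟩ := h
        rw [C.rD_tmul]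
        refine add_mem (sum_mem fun l _ => ?_) ?_
        · rw [C.sgn_of_mem (C.mulX_mem l hv)]
          refine tmul_mem_tensorPiece ?_ (Submodule.smul_mem _ _ (C.mulX_mem l hv))
            (leftMul_mem k w l hf)
          simp only [Prod.mk_add_mk, Prod.mk.injEq]
          constructor
          · abel
          · ring
        · refine tmul_mem_tensorPiece ?_ (C.d_mem hv) hf
          simp only [Prod.mk_add_mk, Prod.mk.injEq, true_and]
          ring
      | zero => simp
      | add x y _ _ hx hy => rw [map_add]; exact add_mem hx hy
      | smul a x _ hx => rw [map_smul]; exact Submodule.smul_mem _ _ hx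
    d_sq := C.rD_rD }

/-- The element `c ⊗ ε` of `R(C)`. -/
def SComplex.soc (C : SComplex.{t} k w) (c : C.carrier) : C.R.carrier :=
  (c ⊗ₜ[k] augm k n : C.carrier ⊗[k] Module.Dual k (ExtAlg k n))

/-- For `c ∈ (C_j)_a`, the homomorphism `k → R(C)`, `1 ↦ c ⊗ ε`, of degree `(a; j)`. -/
def SComplex.socHom (C : SComplex.{t} k w) {a : A} {j : ℤ} (c : C.piece (a, j)) :
    internalHom (residue k w) C.R.toGrEMod (a, j) :=
  ⟨{ toFun := fun r => (show k from r) • C.soc c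
     map_add' := fun r s => add_smul (show k from r) (show k from s) (C.soc c)
     map_smul' := by
       intro y (r : k)
       change ((augm k n y.unop * r) • ((c : C.carrier) ⊗ₜ[k] augm k n) :
           C.carrier ⊗[k] Module.Dual k (ExtAlg k n)) =
         (omegaAct k n y).lTensor C.carrier (r • ((c : C.carrier) ⊗ₜ[k] augm k n))
       have : omegaAct k n y (augm k n) = augm k n y.unop • augm k n := by
         refine LinearMap.ext fun z => ?_
         exact map_mul ExteriorAlgebra.algebraMapInv _ _
       rw [map_smul, LinearMap.lTensor_tmul, this, TensorProduct.tmul_smul, smul_smul, mul_comm] },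
   by
     intro d (r : k) (hr : d ≠ 0 → r = 0)
     change r • ((c : C.carrier) ⊗ₜ[k] augm k n) ∈ tensorPiece C.piece (omegaPiece k w) _
     by_cases h : d = 0
     · subst h
       exact Submodule.smul_mem _ r (tmul_mem_tensorPiece (by simp) c.2 (augm_mem k w))
     · rw [hr h, zero_smul]; exact zero_mem _⟩

end BGG

/-! ### Fans, Cox rings and coherent sheaves on toric stacks -/

section Fan

universe t t'

/-- A rational fan in `N ⊗ ℚ` together with a numbering `ρ_0, …, ρ_n` of its rays, given by their
primitive generators `u_0, …, u_n ∈ N`. -/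
structure Fan (N : Type*) [AddCommGroup N] (n : ℕ) where
  cones : Finset (PointedCone ℚ (ℚ ⊗[ℤ] N))
  fg : ∀ σ ∈ cones, σ.FG
  salient : ∀ σ ∈ cones, (σ : ConvexCone ℚ (ℚ ⊗[ℤ] N)).Salient
  face_mem : ∀ σ ∈ cones, ∀ τ : PointedCone ℚ (ℚ ⊗[ℤ] N), τ.IsFaceOf σ → τ ∈ cones
  inter_face : ∀ σ ∈ cones, ∀ τ ∈ cones, (σ ⊓ τ).IsFaceOf σ
  u : Fin (n + 1) → N
  u_injective : Function.Injective u
  u_primitive : ∀ (i : Fin (n + 1)) (c : ℤ) (v : N), u i = c • v → IsUnit c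
  ray_mem : ∀ i, PointedCone.hull ℚ {(1 : ℚ) ⊗ₜ[ℤ] u i} ∈ cones
  ray_eq : ∀ σ ∈ cones, Module.finrank ℚ (Submodule.span ℚ (σ : Set (ℚ ⊗[ℤ] N))) = 1 →
    ∃ i, σ = PointedCone.hull ℚ {(1 : ℚ) ⊗ₜ[ℤ] u i}

variable {N : Type*} [AddCommGroup N] {n : ℕ} (Δ : Fan N n)

/-- The toric variety of the fan is projective: the fan is complete and carries a strictly convex
support function, i.e. a function `φ` such that each maximal cone `σ` has a linear form `m_σ`
with `φ ≤ m_σ`, equality holding exactly on `σ`. -/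
def Fan.IsProjective : Prop :=
  (∀ v, ∃ σ ∈ Δ.cones, v ∈ σ) ∧
  ∃ φ : ℚ ⊗[ℤ] N → ℚ, ∀ σ, Maximal (· ∈ Δ.cones) σ →
    ∃ m : Module.Dual ℚ (ℚ ⊗[ℤ] N), ∀ v, φ v ≤ m v ∧ (φ v = m v ↔ v ∈ σ)

/-- The map `Hom(N, ℤ) → ℤ^{n+1}`, `m ↦ (m(u_0), …, m(u_n))`. -/
def Fan.divMap : Module.Dual ℤ N →ₗ[ℤ] (Fin (n + 1) → ℤ) :=
  LinearMap.pi fun i => Module.Dual.eval ℤ N (Δ.u i)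

/-- The divisor class group `Cl(X)`: torus-invariant divisors modulo divisors of characters. -/
abbrev Fan.Cl : Type := (Fin (n + 1) → ℤ) ⧸ LinearMap.range Δ.divMap

/-- The degree of `x_i`: the class of the `i`-th torus-invariant prime divisor. -/
def Fan.deg (i : Fin (n + 1)) : Δ.Cl := Submodule.Quotient.mk (Pi.single i 1)

/-- The cones of the fan, as a type. -/
abbrev Fan.Cone : Type _ := {σ : PointedCone ℚ (ℚ ⊗[ℤ] N) // σ ∈ Δ.cones}

/-- The maximal cones of the fan. -/
structure Fan.MaxCone where
  cone : PointedCone ℚ (ℚ ⊗[ℤ] N)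
  maximal : Maximal (· ∈ Δ.cones) cone

instance : Finite Δ.MaxCone :=
  Finite.of_injective (fun σ => (⟨σ.cone, σ.maximal.1⟩ : Δ.Cone)) fun ⟨_, _⟩ ⟨_, _⟩ h => by
    simpa [Subtype.ext_iff] using h

theorem Fan.inf_mem {σ τ : PointedCone ℚ (ℚ ⊗[ℤ] N)} (hσ : σ ∈ Δ.cones) (hτ : τ ∈ Δ.cones) :
    σ ⊓ τ ∈ Δ.cones :=
  Δ.face_mem σ hσ _ (Δ.inter_face σ hσ τ hτ)

/-- The nonempty sets of maximal cones. They index the intersections of the members of the open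
cover `(U_σ)`, `σ` a maximal cone. -/
abbrev Fan.CechIndex : Type _ := {s : Finset Δ.MaxCone // s.Nonempty}

variable {Δ} in
/-- The intersection of the cones in a nonempty set of maximal cones. -/
def Fan.CechIndex.cap (s : Δ.CechIndex) : Δ.Cone :=
  ⟨s.1.inf' s.2 fun σ => σ.cone,
    Finset.inf'_induction s.2 (fun σ : Δ.MaxCone => σ.cone) (p := (· ∈ Δ.cones))
      (fun _ h₁ _ h₂ => Δ.inf_mem h₁ h₂) fun σ _ => σ.maximal.1⟩

variable {Δ} in
theorem Fan.CechIndex.cap_mono {s t : Δ.CechIndex} (h : t.1 ⊆ s.1) : s.cap.1 ≤ t.cap.1 :=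
  Finset.inf'_mono _ h t.2

variable (k : Type*) [Field k]

open Classical in
/-- The monomial `x^σ̂ = ∏_{ρ_i ⊄ σ} x_i`. -/
def Fan.xhat (σ : PointedCone ℚ (ℚ ⊗[ℤ] N)) : Poly k n :=
  ∏ i with (1 : ℚ) ⊗ₜ[ℤ] Δ.u i ∉ σ, MvPolynomial.X i

/-- The irrelevant ideal `B`. -/
def Fan.irrelevantIdeal : Ideal (Poly k n) := Ideal.span {p | ∃ σ ∈ Δ.cones, p = Δ.xhat k σ}

/-- `I` is irrelevant: the ideal `P_I = ⟨x_i : i ∈ I⟩` contains `B`. -/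
def Fan.IsIrrelevant (I : Set (Fin (n + 1))) : Prop :=
  Δ.irrelevantIdeal k ≤ Ideal.span (MvPolynomial.X '' I)

/-- A coherent sheaf on the toric stack `[Z/G]`, `Z = Spec S ∖ V(B)`, `G = Spec k[Cl(X)]`, i.e. a
`G`-equivariant coherent sheaf on `Z`. The scheme `Z` is covered by the `G`-invariant affine opens
`U_σ = Spec S[1/x^σ̂]`, `σ` a cone of the fan, which satisfy `U_σ ∩ U_τ = U_{σ ∩ τ}`, and a
`G`-equivariant structure is a `Cl(X)`-grading. So the sheaf consists of finitely generated
`Cl(X)`-graded `S[1/x^σ̂]`-modules `sec σ` (the sections over `U_σ`) and of functorial, graded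
restriction maps `res` from `sec σ` to `sec τ` for `τ ⊆ σ` that exhibit `sec τ` as the localization
of `sec σ` at `x^τ̂`. The case `τ = σ` says that `x^σ̂` acts invertibly on `sec σ`, so that `sec σ`
is indeed a module over `S[1/x^σ̂]`. -/
structure CoherentSheaf where
  sec : Δ.Cone → GrSMod.{t} k Δ.deg
  res : ∀ {τ σ : Δ.Cone}, τ.1 ≤ σ.1 → ((sec σ).carrier →ₗ[Poly k n] (sec τ).carrier)
  res_mem : ∀ {τ σ : Δ.Cone} (h : τ.1 ≤ σ.1) {a : Δ.Cl} {x : (sec σ).carrier},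
    x ∈ (sec σ).piece a → res h x ∈ (sec τ).piece a
  res_self : ∀ {σ : Δ.Cone} (x : (sec σ).carrier), res (le_refl σ.1) x = x
  res_res : ∀ {υ τ σ : Δ.Cone} (h : υ.1 ≤ τ.1) (h' : τ.1 ≤ σ.1) (x : (sec σ).carrier),
    res h (res h' x) = res (h.trans h') x
  isLocalized : ∀ {τ σ : Δ.Cone} (h : τ.1 ≤ σ.1),
    IsLocalizedModule (Submonoid.powers (Δ.xhat k τ.1)) (res h)
  finite : ∀ σ : Δ.Cone, ∃ g : Finset (sec σ).carrier, ∀ x : (sec σ).carrier,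
    ∃ m : ℕ, Δ.xhat k σ.1 ^ m • x ∈ Submodule.span (Poly k n) (g : Set (sec σ).carrier)

variable {Δ k} (F : CoherentSheaf.{t} Δ k)

/-- The restriction of the value at `t` of a Čech cochain `c` to the intersection indexed by
`s ⊇ t`; it is `0` if `t` is empty. -/
def CoherentSheaf.pull (s : Δ.CechIndex) (t : Finset Δ.MaxCone) (h : t ⊆ s.1) :
    (∀ s : Δ.CechIndex, (F.sec s.cap).carrier) →ₗ[Poly k n] (F.sec s.cap).carrier := by
  classical
  exact if ht : t.Nonempty then
    (F.res (Fan.CechIndex.cap_mono (s := s) (t := ⟨t, ht⟩) h)).comp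
      (LinearMap.proj (R := Poly k n) (φ := fun s : Δ.CechIndex => (F.sec s.cap).carrier) ⟨t, ht⟩)
  else 0

theorem CoherentSheaf.res_pull {s t : Δ.CechIndex} (h : t.1 ⊆ s.1) (v : Finset Δ.MaxCone)
    (hv : v ⊆ t.1) (c : ∀ s : Δ.CechIndex, (F.sec s.cap).carrier) :
    F.res (Fan.CechIndex.cap_mono h) (F.pull t v hv c) = F.pull s v (hv.trans h) c := by
  unfold CoherentSheaf.pull
  split_ifs with hne
  · simp [F.res_res]
  · simp

theorem CoherentSheaf.pull_mem (s : Δ.CechIndex) (v : Finset Δ.MaxCone) (hv : v ⊆ s.1)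
    {a : Δ.Cl} {c : ∀ s : Δ.CechIndex, (F.sec s.cap).carrier}
    (hc : ∀ s, c s ∈ (F.sec s.cap).piece a) : F.pull s v hv c ∈ (F.sec s.cap).piece a := by
  unfold CoherentSheaf.pull
  split_ifs with hne
  · exact F.res_mem _ (hc _)
  · exact zero_mem _

/-- An identification of the sheaf associated with the graded `S`-module `M` with `F`: compatible graded
maps `M → F(U_σ)` that exhibit `F(U_σ)` as the localization `M[1/x^σ̂]`. -/
structure SheafIso (M : GrSMod.{t'} k Δ.deg) (F : CoherentSheaf.{t} Δ k) where
  toSec : ∀ σ : Δ.Cone, M.carrier →ₗ[Poly k n] (F.sec σ).carrier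
  toSec_mem : ∀ (σ : Δ.Cone) {a : Δ.Cl} {x : M.carrier}, x ∈ M.piece a →
    toSec σ x ∈ (F.sec σ).piece a
  res_toSec : ∀ {τ σ : Δ.Cone} (h : τ.1 ≤ σ.1) (x : M.carrier),
    F.res h (toSec σ x) = toSec τ x
  isLocalized : ∀ σ : Δ.Cone,
    IsLocalizedModule (Submonoid.powers (Δ.xhat k σ.1)) (toSec σ)

variable (Δ) in
/-- `H^0_B(M)`: the elements killed by a power of `B`. -/
def H0B (M : GrSMod.{t'} k Δ.deg) : Submodule (Poly k n) M.carrier :=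
  ⨆ m : ℕ, Submodule.torsionBySet (Poly k n) M.carrier ↑(Δ.irrelevantIdeal k ^ m)

open Classical in
/-- The Čech `0`-cochain of the sections `m|_{U_σ}`. -/
def SheafIso.cochain {M : GrSMod.{t'} k Δ.deg} (θ : SheafIso M F) (m : M.carrier)
    (s : Δ.CechIndex) : (F.sec s.cap).carrier :=
  if s.1.card = 1 then θ.toSec s.cap m else 0

variable [LinearOrder Δ.MaxCone]

/-- The sign `(-1)^{#{τ ∈ s : τ < σ}}`. -/
def cechSign {ι : Type*} [LinearOrder ι] (s : Finset ι) (i : ι) : ℤ :=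
  (-1) ^ (s.filter (· < i)).card

/-- The Čech differential `(dc)(s) = ∑_{σ ∈ s} (-1)^{#{τ ∈ s : τ < σ}} c(s ∖ {σ})`. -/
def CoherentSheaf.cechD :
    (∀ s : Δ.CechIndex, (F.sec s.cap).carrier) →ₗ[Poly k n]
      (∀ s : Δ.CechIndex, (F.sec s.cap).carrier) :=
  LinearMap.pi fun s => ∑ σ ∈ s.1, cechSign s.1 σ • F.pull s (s.1.erase σ) (s.1.erase_subset σ)

theorem cechSign_swap {ι : Type*} [LinearOrder ι] (s : Finset ι) {i j : ι} (hi : i ∈ s)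
    (hj : j ∈ s) (hij : i ≠ j) :
    cechSign s i * cechSign (s.erase i) j + cechSign s j * cechSign (s.erase j) i = 0 := by
  wlog h : i < j generalizing i j
  · rw [add_comm]
    exact this hj hi hij.symm (lt_of_le_of_ne (not_lt.mp h) hij.symm)
  have h1 : (s.erase j).filter (· < i) = s.filter (· < i) := by
    ext l
    simp only [Finset.mem_filter, Finset.mem_erase]
    constructor
    · rintro ⟨⟨_, h1⟩, h2⟩; exact ⟨h1, h2⟩
    · rintro ⟨h1, h2⟩; exact ⟨⟨(h2.trans h).ne, h1⟩, h2⟩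
  have h2 : (s.erase i).filter (· < j) = (s.filter (· < j)).erase i := by
    ext l
    simp only [Finset.mem_filter, Finset.mem_erase]
    tauto
  have h3 : i ∈ s.filter (· < j) := by simp [hi, h]
  have h4 := Finset.card_erase_add_one h3
  unfold cechSign
  rw [h1, h2, ← h4, pow_succ]
  ring

theorem CoherentSheaf.cechD_apply (c : ∀ s : Δ.CechIndex, (F.sec s.cap).carrier)
    (s : Δ.CechIndex) :
    F.cechD c s = ∑ σ ∈ s.1, cechSign s.1 σ • F.pull s (s.1.erase σ) (s.1.erase_subset σ) c := by
  simp [CoherentSheaf.cechD, LinearMap.sum_apply]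

theorem CoherentSheaf.pull_cechD (s : Δ.CechIndex) (v : Finset Δ.MaxCone) (hv : v ⊆ s.1)
    (c : ∀ s : Δ.CechIndex, (F.sec s.cap).carrier) :
    F.pull s v hv (F.cechD c) =
      ∑ τ ∈ v, cechSign v τ • F.pull s (v.erase τ) ((v.erase_subset τ).trans hv) c := by
  by_cases hne : v.Nonempty
  · have : F.pull s v hv (F.cechD c) =
        F.res (Fan.CechIndex.cap_mono (s := s) (t := ⟨v, hne⟩) hv) (F.cechD c ⟨v, hne⟩) := by
      simp [CoherentSheaf.pull, hne]
    rw [this, F.cechD_apply, map_sum]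
    refine Finset.sum_congr rfl fun τ _ => ?_
    rw [map_zsmul, F.res_pull (s := s) (t := ⟨v, hne⟩) hv]
  · rw [Finset.not_nonempty_iff_eq_empty] at hne
    subst hne
    simp [CoherentSheaf.pull]

theorem CoherentSheaf.cechD_cechD (c : ∀ s : Δ.CechIndex, (F.sec s.cap).carrier) :
    F.cechD (F.cechD c) = 0 := by
  funext s
  rw [F.cechD_apply]
  simp only [F.pull_cechD, Pi.zero_apply]
  let g : Δ.MaxCone → Δ.MaxCone → (F.sec s.cap).carrier := fun σ τ =>
    if σ = τ then 0 else (cechSign s.1 σ * cechSign (s.1.erase σ) τ) •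
      F.pull s ((s.1.erase σ).erase τ)
        (((s.1.erase σ).erase_subset τ).trans (s.1.erase_subset σ)) c
  have hg : ∑ σ ∈ s.1, ∑ τ ∈ s.1, g σ τ = 0 := by
    refine sum_sum_eq_zero_of_swap _ _ (fun σ _ => by simp [g]) fun σ hσ τ hτ hne => ?_
    simp only [g, hne, hne.symm, if_false]
    have : F.pull s ((s.1.erase τ).erase σ)
        (((s.1.erase τ).erase_subset σ).trans (s.1.erase_subset τ)) c =
        F.pull s ((s.1.erase σ).erase τ)
        (((s.1.erase σ).erase_subset τ).trans (s.1.erase_subset σ)) c := by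
      congr 2
      exact Finset.erase_right_comm
    rw [this, ← add_smul, cechSign_swap s.1 hσ hτ hne, zero_smul]
  rw [← hg]
  refine Finset.sum_congr rfl fun σ hσ => ?_
  rw [Finset.smul_sum, ← Finset.add_sum_erase s.1 _ hσ]
  simp only [g, if_true, zero_add]
  refine Finset.sum_congr rfl fun τ hτ => ?_
  rw [if_neg (Finset.ne_of_mem_erase hτ).symm, smul_smul]

/-- The (ordered) Čech complex of `F` with respect to the cover of `Z` by the `U_σ`, `σ` a maximal
cone. Its term in cohomological degree `p`, i.e. in homological degree `-p`, is the product of the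
sections over the intersections of `p + 1` members of the cover. -/
def CoherentSheaf.cech : SComplex k Δ.deg where
  carrier := ∀ s : Δ.CechIndex, (F.sec s.cap).carrier
  piece d :=
    { carrier := {c | ∀ s, c s ∈ (F.sec s.cap).piece d.1 ∧ ((s.1.card : ℤ) ≠ 1 - d.2 → c s = 0)}
      add_mem' := fun hx hy s => ⟨add_mem (hx s).1 (hy s).1, fun h => by
        rw [Pi.add_apply, (hx s).2 h, (hy s).2 h, add_zero]⟩
      zero_mem' := fun s => ⟨zero_mem _, fun _ => rfl⟩
      smul_mem' := fun a x hx s => ⟨Submodule.smul_mem _ a (hx s).1, fun h => by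
        rw [Pi.smul_apply, (hx s).2 h, smul_zero]⟩ }
  isGrading := by
    classical
    have : Fintype Δ.CechIndex := Fintype.ofFinite _
    refine IsGrading.of_coaction
      (∑ s : Δ.CechIndex, ((Finsupp.lmapDomain _ k fun a : Δ.Cl => (a, 1 - (s.1.card : ℤ))).comp
        (Finsupp.mapRange.linearMap
          (LinearMap.single k (fun s : Δ.CechIndex => (F.sec s.cap).carrier) s))).comp
        ((F.sec s.cap).isGrading.coaction.comp (LinearMap.proj s))) ?_ ?_
    · rintro ⟨a, j⟩ c hc
      have hsum : c = ∑ s, Pi.single s (c s) := (Finset.univ_sum_single c).symm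
      conv_rhs => rw [hsum, ← Finsupp.singleAddHom_apply, map_sum]
      rw [LinearMap.sum_apply]
      refine Finset.sum_congr rfl fun s _ => ?_
      obtain ⟨h1, h2⟩ := hc s
      simp only [LinearMap.comp_apply, LinearMap.proj_apply,
        (F.sec s.cap).isGrading.coaction_of_mem h1]
      by_cases h : (s.1.card : ℤ) = 1 - j
      · simp [h]
      · rw [h2 h]; simp
    · rw [eq_top_iff]
      intro c _
      rw [← Finset.univ_sum_single c]
      refine sum_mem fun s _ => ?_
      have hcs : c s ∈ ⨆ a, (F.sec s.cap).piece a := by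
        rw [(F.sec s.cap).isGrading.span]; exact Submodule.mem_top
      refine Submodule.iSup_induction _ (motive := fun x => Pi.single s x ∈ _) hcs ?_ ?_ ?_
      · intro a x hx
        refine Submodule.mem_iSup_of_mem (a, 1 - (s.1.card : ℤ)) fun s' => ?_
        by_cases h : s' = s
        · subst h
          simp [hx]
        · simp [h]
      · rw [Pi.single_zero]; exact zero_mem _
      · intro x y hx hy
        rw [Pi.single_add]; exact add_mem hx hy
  smul_mem hp hx s := ⟨(F.sec s.cap).smul_mem hp (hx s).1, fun h => by
    rw [Pi.smul_apply, (hx s).2 h, smul_zero]⟩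
  d := F.cechD
  d_mem := by
    intro a j c hc s
    rw [F.cechD_apply]
    refine ⟨sum_mem fun σ _ => zsmul_mem (F.pull_mem s _ _ fun s => (hc s).1) _, fun h => ?_⟩
    refine Finset.sum_eq_zero fun σ hσ => ?_
    unfold CoherentSheaf.pull
    split_ifs with hne
    · have : c ⟨s.1.erase σ, hne⟩ = 0 := by
        refine (hc _).2 fun h' => h ?_
        have := Finset.card_erase_add_one hσ
        simp only at h' ⊢
        omega
      simp [this]
    · simp
  d_sq := F.cechD_cechD

/-- The sheaf cohomology `H^j(X, F(a))`: the cohomology of the `G`-invariant part of the Čech complex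
of `F(a)`, that is, of the degree `a` strand of the Čech complex of `F`. -/
abbrev CoherentSheaf.H (j : ℤ) (a : Δ.Cl) : Type _ := F.cech.Homology a (-j)

/-- The noncommutative Fourier–Mukai transform `Rπ_{2*}(π_1^* F ⊗ K)`: the totalization of the
bicomplex with terms `⨁_a Č^p(F(a))^G ⊗ ω_E(-a; 0)`, vertical differential `d_Čech ⊗ 1` and horizontal
differential `(-1)^p ∑ x_i ⊗ e_i`. This is the value of `R` on the Čech complex. -/
abbrev CoherentSheaf.fourierMukai : DM k Δ.deg := F.cech.R

theorem SheafIso.cochain_mem {M : GrSMod.{t'} k Δ.deg} (θ : SheafIso M F) {a : Δ.Cl}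
    {m : M.carrier} (hm : m ∈ M.piece a) : θ.cochain F m ∈ F.cech.cycles a (-0) := by
  classical
  refine ⟨fun s => ⟨?_, fun h => ?_⟩, ?_⟩
  · unfold SheafIso.cochain
    split_ifs
    · exact θ.toSec_mem _ hm
    · exact zero_mem _
  · unfold SheafIso.cochain
    rw [if_neg]
    intro h1
    simp [h1] at h
  · change F.cechD (θ.cochain F m) = 0
    have hpull : ∀ (s : Δ.CechIndex) (v : Finset Δ.MaxCone) (hv : v ⊆ s.1),
        F.pull s v hv (θ.cochain F m) = if v.card = 1 then θ.toSec s.cap m else 0 := by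
      intro s v hv
      unfold CoherentSheaf.pull
      by_cases hne : v.Nonempty
      · simp only [hne, dif_pos, LinearMap.comp_apply, LinearMap.proj_apply, SheafIso.cochain]
        split_ifs
        · rw [θ.res_toSec]
        · rw [map_zero]
      · rw [dif_neg hne, Finset.not_nonempty_iff_eq_empty.mp hne]
        simp
    funext s
    rw [F.cechD_apply]
    simp only [hpull, Pi.zero_apply]
    by_cases hs : s.1.card = 2
    · obtain ⟨σ, τ, hne, hst⟩ := Finset.card_eq_two.mp hs
      have h := cechSign_swap s.1 (i := σ) (j := τ) (by simp [hst]) (by simp [hst]) hne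
      have h1 : ∀ i : Δ.MaxCone, cechSign {i} i = 1 := by intro i; simp [cechSign, Finset.filter_singleton]
      rw [hst, Finset.sum_pair hne, ← hst]
      have e1 : s.1.erase σ = {τ} := by rw [hst]; simp [hne]
      have e2 : s.1.erase τ = {σ} := by
        rw [hst, Finset.pair_comm]; simp [hne.symm]
      rw [e1, e2, h1, h1, mul_one, mul_one] at h
      rw [e1, e2]
      simp only [Finset.card_singleton, if_true]
      rw [← add_smul, h, zero_smul]
    · refine Finset.sum_eq_zero fun σ hσ => ?_
      have := Finset.card_erase_add_one hσ
      rw [if_neg (by omega), smul_zero]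

/-- The natural map `M_a → H^0(X, F(a))`. -/
def SheafIso.toH0 {M : GrSMod.{t'} k Δ.deg} (θ : SheafIso M F) (a : Δ.Cl) (m : M.piece a) :
    F.H 0 a :=
  Submodule.Quotient.mk ⟨θ.cochain F m, θ.cochain_mem F m.2⟩

end Fan

end ToricTate

end

open scoped TensorProduct DirectSum

noncomputable section

namespace ToricTate

/-! ### Homological perturbation -/

section Perturbation

/-! Write `Φ(F) = C ⊗ ω_E`, with `C` the Čech complex, and split its differential as `d + K`: here
`d` is the Čech differential tensored with `1`, and `K` is the Koszul part, every term of which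
multiplies by some `e_i`. Over a field, `C` contracts degree by degree onto a graded space `H` of
representatives of its homology, by a homotopy `h` (`SComplex.exists_homotopy`). Tensoring with
`ω_E` contracts `(C ⊗ ω_E, d)` onto `(H ⊗ ω_E, 0)`, with inclusion `i` and projection `p`.

The homological perturbation lemma now puts `K` back. Since `h K` moves down a finite filtration by
exterior degree (`homotopy_koszul_pow`), `1 + h K` and `1 + K h` have inverses `v` and `v'`. Then `H
⊗ ω_E` with the differential `p v' (d + K) v i` is homotopy equivalent to `Φ(F)`; this is `T(F)`. It
is free because `E` is a Frobenius algebra, so that `ω_E` is free of rank one. It is minimal because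
its differential is `p v'` applied to values of `K` (`PerturbationData.perturbed_differential`). A
homomorphism from `k` hits the socle `H ⊗ k ε`, so these homomorphisms form the homology of `C`; as
`K` kills the socle, `v i` is the plain inclusion there.

If `H^0_B(M) = 0`, then `M` injects into the Čech `0`-cocycles. There are no cochains in negative
cohomological degree, so `h` vanishes on the image of `M`, all correction terms disappear, and `R(M)
→ T(F)` is `(M → H) ⊗ 1`.

Exactness passes through homotopy equivalences, so it is checked on `Φ(F)`. If `I` is irrelevant,
each intersection of the cover has a variable `x_i`, `i ∈ I`, acting invertibly, and `x_i⁻¹ ⊗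
(contraction by i)` contracts the Koszul complex there. The chosen variables need not be compatible
with restriction, but the resulting operator `η` satisfies `∂ η + η ∂ = 1 + ν`, where `ν` raises the
Čech degree and is therefore nilpotent. As `η` commutes with each `e_j`, `j ∉ I`, it descends to the
tensor product with `E_I`. Finally the full index set is irrelevant: on a complete fan a cone
containing all rays would contain a line. -/

/-- A generalized inverse of a differential can be improved to a special contracting homotopy. -/
theorem special_homotopy {R : Type*} [Ring R] {d g : R} (hd : d * d = 0) (hg : d * g * d = d) :
    d * (g * d * g - g * d * g * (g * d * g) * d) * d = d ∧
    (g * d * g - g * d * g * (g * d * g) * d) * d * (g * d * g - g * d * g * (g * d * g) * d) =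
      g * d * g - g * d * g * (g * d * g) * d ∧
    (g * d * g - g * d * g * (g * d * g) * d) * (g * d * g - g * d * g * (g * d * g) * d) = 0 := by
  have hg1 : d * (g * d) = d := by rw [← mul_assoc, hg]
  have hg2 : ∀ x, d * (g * (d * x)) = d * x := fun x => by
    rw [← mul_assoc, ← mul_assoc, hg]
  refine ⟨?_, ?_, ?_⟩ <;>
    simp only [mul_sub, sub_mul, mul_assoc, hd, hg1, hg2, mul_zero, sub_zero, sub_self]

/-- The homotopy for the perturbed differential is `v h`. Besides the relations for the inverses
only `d² = 0` and `(d + K)² = 0` enter, through the consequence `K d + d K + K² = 0`. -/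
theorem perturbed_projection {R : Type*} [Ring R] {d K h v v' : R}
    (hdK : (d + K) * (d + K) = 0) (hd : d * d = 0)
    (hv : v * (1 + h * K) = 1) (hv' : (1 + K * h) * v' = 1) (hvv : v * h = h * v') :
    v * (1 - d * h - h * d) * v' = 1 - (d + K) * (v * h) - v * h * (d + K) := by
  have hK : K * d + d * K + K * K = 0 := by
    have : (d + K) * (d + K) = d * d + (K * d + d * K + K * K) := by noncomm_ring
    rwa [this, hd, zero_add] at hdK
  -- The expansion is arranged so that `v` on the left and `v'` on the right cancel the factors `1 +
  -- h K` and `1 + K h`; the last summand is zero by `hK`.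
  have h1 : 1 - d * h - h * d = (1 + h * K) * (1 + K * h) - (1 + h * K) * ((d + K) * h)
      - h * (d + K) * (1 + K * h) + h * (K * d + d * K + K * K) * h := by noncomm_ring
  rw [h1, hK, mul_zero, zero_mul, add_zero, mul_sub, mul_sub, sub_mul, sub_mul]
  have e1 : v * ((1 + h * K) * (1 + K * h)) * v' = 1 := by
    rw [← mul_assoc, hv, one_mul, hv']
  have e2 : v * ((1 + h * K) * ((d + K) * h)) * v' = (d + K) * (v * h) := by
    rw [← mul_assoc v, hv, one_mul, mul_assoc, hvv]
  have e3 : v * (h * (d + K) * (1 + K * h)) * v' = v * h * (d + K) := by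
    rw [mul_assoc, mul_assoc _ _ v', hv', mul_one, mul_assoc]
  rw [e1, e2, e3]

variable {R V T : Type*} [Ring R] [AddCommGroup V] [Module R V] [AddCommGroup T] [Module R T]

/-- The data of a deformation retraction `p : (V, d) → (T, 0)` with inclusion `i` and homotopy `h`,
together with a perturbation `K` of `d` such that `1 + h K` and `1 + K h` have inverses `v`, `v'`. -/
structure PerturbationData (d K h v v' : Module.End R V) (p : V →ₗ[R] T) (i : T →ₗ[R] V) :
    Prop where
  sq : d * d = 0
  perturbed_sq : (d + K) * (d + K) = 0
  homotopy_sq : h * h = 0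
  d_h_d : d * h * d = d
  h_d_h : h * d * h = h
  i_p : ∀ x, i (p x) = x - d (h x) - h (d x)
  p_i : ∀ x, p (i x) = x
  v_left : v * (1 + h * K) = 1
  v_right : (1 + h * K) * v = 1
  v'_left : v' * (1 + K * h) = 1
  v'_right : (1 + K * h) * v' = 1

/-! ### Consequences of the perturbation data. -/

namespace PerturbationData

variable {d K h v v' : Module.End R V} {p : V →ₗ[R] T} {i : T →ₗ[R] V}
  (P : PerturbationData d K h v v' p i)

include P

theorem v_h : v * h = h * v' := by
  calc v * h = v * (h * ((1 + K * h) * v')) := by rw [P.v'_right, mul_one]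
    _ = v * (1 + h * K) * h * v' := by noncomm_ring
    _ = h * v' := by rw [P.v_left, one_mul]

theorem i_injective : Function.Injective i := fun x y hxy => by
  rw [← P.p_i x, hxy, P.p_i]

theorem p_d (x : V) : p (d x) = 0 := by
  apply P.i_injective
  have h1 : d (d x) = 0 := LinearMap.congr_fun P.sq x
  have h2 : d (h (d x)) = d x := LinearMap.congr_fun P.d_h_d x
  rw [P.i_p, h1, h2, map_zero, map_zero, sub_self, sub_zero]

theorem p_h (x : V) : p (h x) = 0 := by
  apply P.i_injective
  have h1 : h (h x) = 0 := LinearMap.congr_fun P.homotopy_sq x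
  have h2 : h (d (h x)) = h x := LinearMap.congr_fun P.h_d_h x
  rw [P.i_p, h1, h2, map_zero, map_zero, sub_zero, sub_self]

theorem d_i (x : T) : d (i x) = 0 := by
  have h1 : d (d (h (i x))) = 0 := LinearMap.congr_fun P.sq (h (i x))
  have h2 : d (h (d (i x))) = d (i x) := LinearMap.congr_fun P.d_h_d (i x)
  rw [← P.p_i x, P.i_p, map_sub, map_sub, h1, h2, sub_zero, sub_self]

theorem h_i (x : T) : h (i x) = 0 := by
  have h1 : h (h (d (i x))) = 0 := LinearMap.congr_fun P.homotopy_sq (d (i x))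
  have h2 : h (d (h (i x))) = h (i x) := LinearMap.congr_fun P.h_d_h (i x)
  rw [← P.p_i x, P.i_p, map_sub, map_sub, h1, h2, sub_zero, sub_self]

theorem v_eq (x : V) : v x = x - h (K (v x)) := by
  have := LinearMap.congr_fun P.v_right x
  simp only [add_mul, one_mul, LinearMap.add_apply, Module.End.mul_apply,
    Module.End.one_apply] at this
  rw [eq_sub_iff_add_eq, this]

theorem v'_eq (x : V) : v' x = x - v' (K (h x)) := by
  have := LinearMap.congr_fun P.v'_left x
  simp only [mul_add, mul_one, LinearMap.add_apply, Module.End.mul_apply,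
    Module.End.one_apply] at this
  rw [eq_sub_iff_add_eq, this]

theorem v_of_K_eq_zero {x : V} (hx : K x = 0) : v x = x := by
  have := LinearMap.congr_fun P.v_left x
  simpa [mul_add, hx] using this

theorem projection (x : V) :
    v (i (p (v' x))) = x - (d + K) (v (h x)) - v (h ((d + K) x)) := by
  have := LinearMap.congr_fun (perturbed_projection P.perturbed_sq P.sq
    P.v_left P.v'_right P.v_h) x
  rw [P.i_p]
  simpa using this

/-- The side conditions make the retraction strict: `v i` differs from `i` by a value of `h`, `v'`
fixes the values of `h` and of `i` because `h` kills both, and `p h = 0`. -/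
theorem retraction (x : T) : p (v' (v (i x))) = x := by
  have hz : v' (h (K (v (i x)))) = h (K (v (i x))) := by
    rw [P.v'_eq]
    have : h (h (K (v (i x)))) = 0 := LinearMap.congr_fun P.homotopy_sq _
    rw [this, map_zero, map_zero, sub_zero]
  have hz' : v' (i x) = i x := by
    rw [P.v'_eq, P.h_i, map_zero, map_zero, sub_zero]
  rw [P.v_eq, map_sub, hz, hz', map_sub, P.p_i, P.p_h, sub_zero]

theorem perturbed_apply_sq (x : V) : (d + K) ((d + K) x) = 0 :=
  LinearMap.congr_fun P.perturbed_sq x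

/-- By `projection` the composite is `1` minus the anticommutator of `d + K` with `v h`, and such an
anticommutator commutes with the square-zero map `d + K`. -/
theorem perturbed_commute (x : V) :
    (d + K) (v (i (p (v' x)))) = v (i (p (v' ((d + K) x)))) := by
  rw [P.projection, P.projection, map_sub, map_sub, P.perturbed_apply_sq, P.perturbed_apply_sq,
    map_zero, map_zero, sub_zero, sub_zero]

/-- The summand `d` is traded for `K`: since `d i = 0`, only the correction `-h K v i` of `v i`
contributes to `d v i`, and `p d = 0` leaves the part of `v'` that passes through `K`. This is the
source of minimality. -/
theorem perturbed_differential (x : T) :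
    p (v' ((d + K) (v (i x)))) = p (v' (K (h (K (v (i x)))) + K (v (i x)))) := by
  have h1 : p (v' (d (v (i x)))) = p (v' (K (h (K (v (i x)))))) := by
    have e1 : d (v (i x)) = -d (h (K (v (i x)))) := by
      conv_lhs => rw [P.v_eq]
      rw [map_sub, P.d_i, zero_sub]
    have e2 : h (d (h (K (v (i x))))) = h (K (v (i x))) := LinearMap.congr_fun P.h_d_h _
    rw [e1, P.v'_eq, map_neg h, e2]
    simp [P.p_d]
  rw [LinearMap.add_apply, map_add, map_add, h1, map_add, map_add]

end PerturbationData

/-- If `∂ η + η ∂ - 1` is nilpotent at `x`, and `∂ x` vanishes modulo `J`, then `x` is a boundary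
modulo `J`. -/
theorem exists_boundary_of_nilpotent {k V : Type*} [Ring k] [AddCommGroup V] [Module k V]
    {D η : Module.End k V} {J : Submodule k V} (hD : D * D = 0)
    (hDJ : ∀ x ∈ J, D x ∈ J) (hηJ : ∀ x ∈ J, η x ∈ J) (m : ℕ) :
    ∀ x, ((D * η + η * D - 1) ^ m) x = 0 → D x ∈ J → ∃ y, x - D y ∈ J := by
  induction m with
  | zero =>
    intro x hx _
    rw [pow_zero, Module.End.one_apply] at hx
    exact ⟨0, by simp [hx]⟩
  | succ m ih =>
    intro x hx hxJ
    have hDD : ∀ z, D (D z) = 0 := LinearMap.congr_fun hD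
    have hval : (D * η + η * D - 1) x = D (η x) + η (D x) - x := rfl
    -- The error of the approximate primitive `η x` is again a cycle modulo `J` and is killed by a
    -- smaller power; a primitive `y` of it corrects `η x` to `η x - y`.
    obtain ⟨y, hy⟩ := ih ((D * η + η * D - 1) x) (by
      rw [← Module.End.mul_apply, ← pow_succ, hx]) (by
      rw [hval, map_sub, map_add, hDD, zero_add]
      exact sub_mem (hDJ _ (hηJ _ hxJ)) hxJ)
    refine ⟨η x - y, ?_⟩
    rw [hval] at hy
    have : x - D (η x - y) = η (D x) - (D (η x) + η (D x) - x - D y) := by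
      rw [map_sub]; abel
    rw [this]
    exact sub_mem (hηJ _ hxJ) hy

/-- An endomorphism that moves down a finite exhaustive filtration is nilpotent. -/
theorem pow_eq_zero_of_filtration {k V : Type*} [Ring k] [AddCommGroup V] [Module k V]
    (φ : Module.End k V) (W : ℕ → AddSubgroup V) (h0 : W 0 = ⊥)
    (hφ : ∀ j, ∀ x ∈ W (j + 1), φ x ∈ W j) {m : ℕ} (hm : W m = ⊤) : φ ^ m = 0 := by
  have key : ∀ m, ∀ x ∈ W m, (φ ^ m) x = 0 := by
    intro m
    induction m with
    | zero => intro x hx; simpa [h0] using hx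
    | succ m ih =>
      intro x hx
      rw [pow_succ, Module.End.mul_apply]
      exact ih _ (hφ m x hx)
  exact LinearMap.ext fun x => key m x (hm ▸ AddSubgroup.mem_top x)

end Perturbation

/-! ### Homogeneous contracting homotopies -/

section Splitting

/-- A linear map over a field has a generalized inverse. -/
theorem exists_generalized_inverse {k V W : Type*} [Field k] [AddCommGroup V] [Module k V]
    [AddCommGroup W] [Module k W] (f : V →ₗ[k] W) : ∃ g : W →ₗ[k] V, ∀ x, f (g (f x)) = f x := by
  obtain ⟨s, hs⟩ := f.rangeRestrict.exists_rightInverse_of_surjective f.range_rangeRestrict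
  obtain ⟨q, hq⟩ := f.range.subtype.exists_leftInverse_of_injective (Submodule.ker_subtype _)
  refine ⟨s.comp q, fun x => ?_⟩
  have h1 : q (f x) = f.rangeRestrict x := LinearMap.congr_fun hq (f.rangeRestrict x)
  have h2 := LinearMap.congr_fun hs (f.rangeRestrict x)
  rw [LinearMap.comp_apply, h1]
  exact congrArg Subtype.val h2

universe t

variable {k : Type*} [Field k] {n : ℕ} {A : Type*} [AddCommGroup A] {w : Fin (n + 1) → A}

/-- A complex of graded modules over a field has a special homogeneous contraction onto its
homology. -/
theorem SComplex.exists_homotopy (C : SComplex.{t} k w) :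
    ∃ h : Module.End k C.carrier,
      (∀ a j, ∀ x ∈ C.piece (a, j), h x ∈ C.piece (a, j + 1)) ∧
      C.d.restrictScalars k * h * C.d.restrictScalars k = C.d.restrictScalars k ∧
      h * C.d.restrictScalars k * h = h ∧ h * h = 0 := by
  have hex : ∀ c : A × ℤ, ∃ G : Module.End k C.carrier,
      (∀ x, G x ∈ C.piece (c.1, c.2 + 1)) ∧
      ∀ x ∈ C.piece (c.1, c.2 + 1), C.d (G (C.d x)) = C.d x := by
    intro c
    -- Inverting the restriction of `d` to a single piece forces the values of the inverse to be
    -- homogeneous. The inverses are then assembled along the homogeneous components.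
    obtain ⟨g, hg⟩ := exists_generalized_inverse
      ((C.d.restrictScalars k).comp (C.piece (c.1, c.2 + 1)).subtype)
    exact ⟨(C.piece (c.1, c.2 + 1)).subtype.comp g, fun x => (g x).2, fun x hx => hg ⟨x, hx⟩⟩
  choose G hG hdG using hex
  let g : Module.End k C.carrier := (Finsupp.lsum k G).comp C.isGrading.coaction
  have hg : ∀ c, ∀ x ∈ C.piece c, g x = G c x := by
    intro c x hx
    simp [g, C.isGrading.coaction_of_mem hx]
  have hgm : ∀ a j, ∀ x ∈ C.piece (a, j), g x ∈ C.piece (a, j + 1) := by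
    intro a j x hx
    rw [hg _ _ hx]
    exact hG (a, j) x
  have hdm : ∀ a j, ∀ x ∈ C.piece (a, j), C.d.restrictScalars k x ∈ C.piece (a, j - 1) :=
    fun a j x hx => C.d_mem hx
  set d := C.d.restrictScalars k with hd
  have hdg : d * g * d = d := C.isGrading.hom_ext fun c x hx => by
    have h1 : C.d x ∈ C.piece (c.1, c.2 - 1) := C.d_mem hx
    change C.d (g (C.d x)) = C.d x
    rw [hg _ _ h1]
    refine hdG _ _ ?_
    simpa using hx
  have hdd : d * d = 0 := LinearMap.ext fun x => C.d_sq x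
  have hgdg : ∀ a j, ∀ x ∈ C.piece (a, j), (g * d * g) x ∈ C.piece (a, j + 1) := by
    intro a j x hx
    have := hgm _ _ _ (hdm _ _ _ (hgm _ _ _ hx))
    simpa using this
  obtain ⟨h1, h2, h3⟩ := special_homotopy hdd hdg
  refine ⟨_, fun a j x hx => ?_, h1, h2, h3⟩
  refine sub_mem (hgdg _ _ _ hx) ?_
  have := hgdg _ _ _ (hgdg _ _ _ (hdm _ _ _ hx))
  simpa using this

end Splitting

/-! ### Products of monomials in the exterior algebra -/

section ExteriorProducts

variable (k : Type*) [Field k] {n : ℕ}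

theorem extBasis_mul_of_disjoint {s t : Finset (Fin (n + 1))} (h : Disjoint s t) :
    ∃ u : ℤˣ, extBasis k n s * extBasis k n t = u • extBasis k n (s ∪ t) := by
  classical
  let s' : Set.powersetCard (Fin (n + 1)) s.card := Set.powersetCard.ofCard rfl
  let t' : Set.powersetCard (Fin (n + 1)) t.card := Set.powersetCard.ofCard rfl
  have h' : Disjoint s'.val t'.val := h
  have := ExteriorAlgebra.basis_mul_of_disjoint (Pi.basisFun k (Fin (n + 1))) s' t' h'
  have hv : (Set.powersetCard.disjUnion h').val = s ∪ t := by
    ext; simp [Set.powersetCard.disjUnion, s', t']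
  rw [hv] at this
  exact ⟨_, this⟩

theorem extBasis_mul_of_not_disjoint {s t : Finset (Fin (n + 1))} (h : ¬Disjoint s t) :
    extBasis k n s * extBasis k n t = 0 :=
  ExteriorAlgebra.basis_mul_of_not_disjoint (Pi.basisFun k (Fin (n + 1)))
    (Set.powersetCard.ofCard (rfl : s.card = s.card))
    (Set.powersetCard.ofCard (rfl : t.card = t.card)) h

/-- The variables of the exterior algebra are normal elements. -/
theorem exists_e_mul_eq (i : Fin (n + 1)) (y : ExtAlg k n) : ∃ y', e i * y = y' * e i := by
  have hy : y ∈ Submodule.span k (Set.range (extBasis k n)) := by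
    rw [(extBasis k n).span_eq]; exact Submodule.mem_top
  induction hy using Submodule.span_induction with
  | mem y hy =>
    obtain ⟨J, rfl⟩ := hy
    exact ⟨(-1 : k) ^ J.card • extBasis k n J, by rw [e_mul_extBasis, smul_mul_assoc]⟩
  | zero => exact ⟨0, by simp⟩
  | add x y _ _ hx hy =>
    obtain ⟨x', hx⟩ := hx
    obtain ⟨y', hy⟩ := hy
    exact ⟨x' + y', by rw [mul_add, add_mul, hx, hy]⟩
  | smul a x _ hx =>
    obtain ⟨x', hx⟩ := hx
    exact ⟨a • x', by rw [mul_smul_comm, smul_mul_assoc, hx]⟩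

/-- The functional on `E` that reads off the coefficient of `e_0 ⋯ e_n`. -/
def topCoeff (n : ℕ) : Module.Dual k (ExtAlg k n) := (extBasis k n).coord Finset.univ

theorem topCoeff_mem {A : Type*} [AddCommGroup A] (w : Fin (n + 1) → A) :
    topCoeff k n ∈ omegaPiece k w (-wt w Finset.univ) := by
  intro c hc x hx
  induction hx using Submodule.span_induction with
  | mem x hx =>
    obtain ⟨I, rfl, rfl⟩ := hx
    have : I ≠ Finset.univ := by rintro rfl; simp at hc
    simp [topCoeff, Finsupp.single_eq_of_ne this.symm]
  | zero => simp
  | add x y _ _ hx hy => rw [map_add, hx, hy, add_zero]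
  | smul a x _ hx => rw [map_smul, hx, smul_zero]

/-- The pairing `(y, x) ↦ topCoeff (y x)` is nondegenerate: `e_Jᶜ` pairs to zero with every basis
monomial except `e_J`, where the value is a sign. So `E` is a Frobenius algebra. -/
theorem eq_zero_of_topCoeff_mul {y : ExtAlg k n} (hy : ∀ x, topCoeff k n (y * x) = 0) : y = 0 := by
  classical
  refine (extBasis k n).ext_elem fun J => ?_
  have h := hy (extBasis k n Jᶜ)
  conv at h => lhs; rw [← (extBasis k n).sum_repr y, Finset.sum_mul, map_sum]
  rw [Finset.sum_eq_single J] at h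
  · obtain ⟨u, hu⟩ := extBasis_mul_of_disjoint k (disjoint_compl_right (a := J))
    rw [smul_mul_assoc, hu, map_smul, Finset.union_compl] at h
    rcases Int.units_eq_one_or u with rfl | rfl <;> simpa [topCoeff] using h
  · intro I _ hI
    rw [smul_mul_assoc, map_smul]
    by_cases hd : Disjoint I Jᶜ
    · obtain ⟨u, hu⟩ := extBasis_mul_of_disjoint k hd
      have hne : I ∪ Jᶜ ≠ Finset.univ := by
        intro h'
        refine hI (Finset.Subset.antisymm ?_ ?_)
        · intro x hx
          by_contra hxJ
          exact Finset.disjoint_left.mp hd hx (by simpa using hxJ)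
        · intro x hx
          have : x ∈ I ∪ Jᶜ := h' ▸ Finset.mem_univ x
          simpa [hx] using this
      have h0 : topCoeff k n (extBasis k n (I ∪ Jᶜ)) = 0 := by
        simp [topCoeff, Finsupp.single_eq_of_ne hne.symm]
      rw [hu]
      rcases Int.units_eq_one_or u with rfl | rfl <;> simp [h0]
    · rw [extBasis_mul_of_not_disjoint k hd, map_zero, smul_zero]
  · simp

/-- `ω_E` is free of rank one, generated by `topCoeff`. -/
theorem exists_omegaAct_topCoeff (f : Module.Dual k (ExtAlg k n)) :
    ∃ y, omegaAct k n y (topCoeff k n) = f := by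
  have : Module.Finite k (ExtAlg k n) := Module.Finite.of_basis (extBasis k n)
  let g : ExtAlg k n →ₗ[k] Module.Dual k (ExtAlg k n) :=
    (LinearMap.mul k (ExtAlg k n)).compr₂ (topCoeff k n)
  have hinj : Function.Injective g := by
    rw [injective_iff_map_eq_zero]
    exact fun y hy => eq_zero_of_topCoeff_mul k (LinearMap.congr_fun hy)
  -- `E` and its dual have the same finite dimension, so injectivity of `y ↦ topCoeff (y ·)` gives
  -- surjectivity.
  obtain ⟨y, hy⟩ := (LinearMap.injective_iff_surjective_of_finrank_eq_finrank
    (Subspace.dual_finrank_eq (K := k) (V := ExtAlg k n)).symm).mp hinj f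
  exact ⟨MulOpposite.op y, hy⟩

/-- The contraction by the `i`-th coordinate, transposed to `ω_E`. -/
def contraction (i : Fin (n + 1)) : Module.End k (Module.Dual k (ExtAlg k n)) :=
  -LinearMap.lcomp k k (CliffordAlgebra.contractRight.flip (LinearMap.proj i))

theorem contraction_apply (i : Fin (n + 1)) (f : Module.Dual k (ExtAlg k n)) (x : ExtAlg k n) :
    contraction k i f x = -f (CliffordAlgebra.contractRight x (LinearMap.proj i)) := rfl

/-- Contraction is an antiderivation, which is the Clifford relation between contraction and
multiplication. It turns an invertible `x_i` into a contraction of the Koszul differential `∑ x_j ⊗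
e_j`. -/
theorem contraction_leftMul (i j : Fin (n + 1)) (f : Module.Dual k (ExtAlg k n)) :
    contraction k i (leftMul k j f) + leftMul k j (contraction k i f) =
      if i = j then f else 0 := by
  refine LinearMap.ext fun x => ?_
  rw [LinearMap.add_apply, contraction_apply, leftMul_apply, leftMul_apply, contraction_apply,
    e, ExteriorAlgebra.ι, CliffordAlgebra.contractRight_mul_ι, map_sub, map_smul]
  by_cases h : i = j
  · subst h; simp
  · simp [h]

theorem contractRight_e_mul {i j : Fin (n + 1)} (h : i ≠ j) (x : ExtAlg k n) :
    CliffordAlgebra.contractRight (e j * x) (LinearMap.proj i) =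
      e j * CliffordAlgebra.contractRight x (LinearMap.proj i) := by
  induction x using CliffordAlgebra.right_induction with
  | algebraMap r =>
    rw [CliffordAlgebra.contractRight_algebraMap, ← Algebra.commutes, ← Algebra.smul_def,
      map_smul, LinearMap.smul_apply, e, ExteriorAlgebra.ι, CliffordAlgebra.contractRight_ι]
    simp [h]
  | add x y hx hy => simp only [mul_add, map_add, LinearMap.add_apply, hx, hy]
  | mul_ι x m hx =>
    rw [← mul_assoc, CliffordAlgebra.contractRight_mul_ι, CliffordAlgebra.contractRight_mul_ι, hx,
      mul_sub, mul_smul_comm, mul_assoc]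

/-- The contraction enters its argument from the right and the action multiplies from the left, so
no sign appears. The operator is not `E`-linear, but linearity over the `e_j` with `j ≠ i` is enough
to pass to the quotients `D ⊗_E E_I`. -/
theorem contraction_omegaAct {i j : Fin (n + 1)} (h : i ≠ j) (f : Module.Dual k (ExtAlg k n)) :
    contraction k i (omegaAct k n (MulOpposite.op (e j)) f) =
      omegaAct k n (MulOpposite.op (e j)) (contraction k i f) := by
  refine LinearMap.ext fun x => ?_
  simp only [contraction_apply, omegaAct_apply, MulOpposite.unop_op, contractRight_e_mul k h]

/-- The left and right actions of `e_i` agree up to a sign that depends on the degree of `f`, so the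
witness is built from homogeneous components. -/
theorem exists_leftMul_eq {A : Type*} [AddCommGroup A] (w : Fin (n + 1) → A) (i : Fin (n + 1))
    (f : Module.Dual k (ExtAlg k n)) :
    ∃ f', leftMul k i f = omegaAct k n (MulOpposite.op (e i)) f' := by
  have hf : f ∈ ⨆ d, omegaPiece k w d := (isGrading_omega k w).span ▸ Submodule.mem_top
  refine Submodule.iSup_induction _
    (motive := fun f => ∃ f', leftMul k i f = omegaAct k n (MulOpposite.op (e i)) f') hf ?_ ?_ ?_
  · intro d f hf
    exact ⟨(-1 : k) ^ d.2 • f, by rw [leftMul_eq k w i hf, map_smul]⟩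
  · exact ⟨0, by simp⟩
  · rintro x y ⟨x', hx⟩ ⟨y', hy⟩
    exact ⟨x' + y', by rw [map_add, map_add, hx, hy]⟩

theorem leftMul_augm (i : Fin (n + 1)) : leftMul k i (augm k n) = 0 := by
  refine LinearMap.ext fun x => ?_
  have h1 : augm k n (x * e i) = augm k n x * augm k n (e i) :=
    map_mul ExteriorAlgebra.algebraMapInv _ _
  have h2 : augm k n (e i) = 0 := by
    rw [← extBasis_singleton]; exact augm_extBasis k (Finset.singleton_nonempty i)
  simp [h1, h2]

theorem augm_one : augm k n 1 = 1 := map_one ExteriorAlgebra.algebraMapInv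

end ExteriorProducts

/-! ### The graded modules `V ⊗ ω_E` -/

section OmegaTensor

variable {k : Type*} [Field k] {n : ℕ} {A : Type*} [AddCommGroup A]
  {V V' V'' : Type*} [AddCommGroup V] [Module k V] [AddCommGroup V'] [Module k V']
  [AddCommGroup V''] [Module k V'']

/-- The right `E`-module structure of `V ⊗ ω_E`. -/
instance omegaModule : Module (ExtAlg k n)ᵐᵒᵖ (V ⊗[k] Module.Dual k (ExtAlg k n)) :=
  Module.compHom _ ((Module.End.lTensorAlgHom k _ V).comp (omegaAct k n)).toRingHom

theorem omega_smul_def (y : (ExtAlg k n)ᵐᵒᵖ) (x : V ⊗[k] Module.Dual k (ExtAlg k n)) :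
    y • x = (omegaAct k n y).lTensor V x := rfl

theorem omega_smul_tmul (y : (ExtAlg k n)ᵐᵒᵖ) (v : V) (f : Module.Dual k (ExtAlg k n)) :
    y • (v ⊗ₜ[k] f) = v ⊗ₜ[k] omegaAct k n y f := rfl

instance omegaTower : IsScalarTower k (ExtAlg k n)ᵐᵒᵖ (V ⊗[k] Module.Dual k (ExtAlg k n)) :=
  ⟨fun a y x => by
    rw [omega_smul_def, omega_smul_def, map_smul, LinearMap.lTensor_smul]; rfl⟩

/-- The graded `E`-module `V ⊗ ω_E`, for a graded vector space `V`. -/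
def omegaMod (w : Fin (n + 1) → A) {𝒱 : A × ℤ → Submodule k V} (h𝒱 : IsGrading 𝒱) :
    GrEMod k w where
  carrier := V ⊗[k] Module.Dual k (ExtAlg k n)
  piece := tensorPiece 𝒱 (omegaPiece k w)
  isGrading := h𝒱.tensor (isGrading_omega k w)
  smul_mem := by
    intro c d x y hx hy
    rw [omega_smul_def]
    induction hx using Submodule.span_induction with
    | mem x hx =>
      obtain ⟨b, b', rfl, v, hv, f, hf, rfl⟩ := hx
      rw [LinearMap.lTensor_tmul]
      exact tmul_mem_tensorPiece (by abel) hv (omegaAct_mem k w hf hy)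
    | zero => simp
    | add x y _ _ hx hy => rw [map_add]; exact add_mem hx hy
    | smul a x _ hx => rw [map_smul]; exact Submodule.smul_mem _ _ hx

variable (n) in
/-- The `E`-linear map `g ⊗ 1`. -/
def omegaMap (g : V →ₗ[k] V') :
    V ⊗[k] Module.Dual k (ExtAlg k n) →ₗ[(ExtAlg k n)ᵐᵒᵖ] V' ⊗[k] Module.Dual k (ExtAlg k n) where
  toFun := g.rTensor _
  map_add' := map_add _
  map_smul' y x := by
    rw [RingHom.id_apply, omega_smul_def, omega_smul_def, ← LinearMap.comp_apply,
      ← LinearMap.comp_apply, LinearMap.rTensor_comp_lTensor, LinearMap.lTensor_comp_rTensor]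

@[simp] theorem omegaMap_tmul (g : V →ₗ[k] V') (v : V) (f : Module.Dual k (ExtAlg k n)) :
    omegaMap n g (v ⊗ₜ[k] f) = g v ⊗ₜ[k] f := rfl

theorem omegaMap_omegaMap (g : V →ₗ[k] V') (g' : V' →ₗ[k] V'')
    (x : V ⊗[k] Module.Dual k (ExtAlg k n)) :
    omegaMap n g' (omegaMap n g x) = omegaMap n (g'.comp g) x :=
  (LinearMap.rTensor_comp_apply _ g' g x).symm

theorem omegaMap_id (x : V ⊗[k] Module.Dual k (ExtAlg k n)) :
    omegaMap n (LinearMap.id : V →ₗ[k] V) x = x :=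
  LinearMap.rTensor_id_apply _ _ x

theorem omegaMap_mem {w : Fin (n + 1) → A} {𝒱 : A × ℤ → Submodule k V}
    {𝒱' : A × ℤ → Submodule k V'} {g : V →ₗ[k] V'} {d : A × ℤ}
    (hg : ∀ c, ∀ x ∈ 𝒱 c, g x ∈ 𝒱' (c + d)) (c : A × ℤ)
    {x : V ⊗[k] Module.Dual k (ExtAlg k n)} (hx : x ∈ tensorPiece 𝒱 (omegaPiece k w) c) :
    omegaMap n g x ∈ tensorPiece 𝒱' (omegaPiece k w) (c + d) := by
  change g.rTensor _ x ∈ _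
  induction hx using Submodule.span_induction with
  | mem x hx =>
    obtain ⟨b, b', rfl, v, hv, f, hf, rfl⟩ := hx
    exact tmul_mem_tensorPiece (by abel) (hg _ _ hv) hf
  | zero => simp
  | add x y _ _ hx hy => rw [map_add]; exact add_mem hx hy
  | smul a x _ hx => rw [map_smul]; exact Submodule.smul_mem _ _ hx

/-- The evaluation `v ⊗ f ↦ f(y) v`. -/
def evalAt (y : ExtAlg k n) : V ⊗[k] Module.Dual k (ExtAlg k n) →ₗ[k] V :=
  (TensorProduct.rid k V).toLinearMap.comp (LinearMap.lTensor V (Module.Dual.eval k _ y))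

@[simp] theorem evalAt_tmul (y : ExtAlg k n) (v : V) (f : Module.Dual k (ExtAlg k n)) :
    evalAt y (v ⊗ₜ[k] f) = f y • v := by
  simp [evalAt]

theorem evalAt_smul (y z : ExtAlg k n) (x : V ⊗[k] Module.Dual k (ExtAlg k n)) :
    evalAt y (MulOpposite.op z • x) = evalAt (z * y) x := by
  induction x using TensorProduct.induction_on with
  | zero => simp
  | add x x' hx hx' => rw [smul_add, map_add, map_add, hx, hx']
  | tmul v f => simp [omega_smul_tmul]

theorem evalAt_omegaMap (y : ExtAlg k n) (g : V →ₗ[k] V')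
    (x : V ⊗[k] Module.Dual k (ExtAlg k n)) : evalAt y (omegaMap n g x) = g (evalAt y x) := by
  induction x using TensorProduct.induction_on with
  | zero => simp
  | add x x' hx hx' => simp only [map_add, hx, hx']
  | tmul v f => simp

theorem eq_sum_evalAt (x : V ⊗[k] Module.Dual k (ExtAlg k n)) :
    x = ∑ J, evalAt (extBasis k n J) x ⊗ₜ[k] (extBasis k n).coord J := by
  induction x using TensorProduct.induction_on with
  | zero => simp
  | add x x' hx hx' =>
    simp only [map_add, TensorProduct.add_tmul, Finset.sum_add_distrib]
    rw [← hx, ← hx']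
  | tmul v f =>
    simp only [evalAt_tmul, TensorProduct.smul_tmul]
    rw [← TensorProduct.tmul_sum]
    congr 1
    refine (extBasis k n).ext fun I => ?_
    simp

theorem evalAt_ext {x x' : V ⊗[k] Module.Dual k (ExtAlg k n)}
    (h : ∀ J, evalAt (extBasis k n J) x = evalAt (extBasis k n J) x') : x = x' := by
  rw [eq_sum_evalAt x, eq_sum_evalAt x']
  exact Finset.sum_congr rfl fun J _ => by rw [h]

theorem evalAt_one_mem {w : Fin (n + 1) → A} {𝒱 : A × ℤ → Submodule k V} {c : A × ℤ}
    {x : V ⊗[k] Module.Dual k (ExtAlg k n)} (hx : x ∈ tensorPiece 𝒱 (omegaPiece k w) c) :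
    evalAt 1 x ∈ 𝒱 c := by
  induction hx using Submodule.span_induction with
  | mem x hx =>
    obtain ⟨b, b', rfl, v, hv, f, hf, rfl⟩ := hx
    rw [evalAt_tmul]
    by_cases h : b' = 0
    · subst h; rw [add_zero]; exact Submodule.smul_mem _ _ hv
    · rw [hf 0 (fun h' => h (neg_eq_zero.mp h'.symm)) 1 (one_mem_ext k w), zero_smul]
      exact zero_mem _
  | zero => simp
  | add x y _ _ hx hy => rw [map_add]; exact add_mem hx hy
  | smul a x _ hx => rw [map_smul]; exact Submodule.smul_mem _ _ hx

/-- An element on which `E` acts through the augmentation lies in `V ⊗ k ε`. -/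
theorem eq_evalAt_one_tmul_augm {x : V ⊗[k] Module.Dual k (ExtAlg k n)}
    (hx : ∀ y, MulOpposite.op y • x = augm k n y • x) : x = evalAt 1 x ⊗ₜ[k] augm k n := by
  refine evalAt_ext fun J => ?_
  have := evalAt_smul 1 (extBasis k n J) x
  rw [mul_one, hx, map_smul] at this
  rw [← this, evalAt_tmul]

/-- A basis `b` of `V` gives the basis `b ⊗ topCoeff` of `V ⊗ ω_E`. -/
def omegaBasis {I : Type*} (b : Module.Basis I k V) :
    Module.Basis I (ExtAlg k n)ᵐᵒᵖ (V ⊗[k] Module.Dual k (ExtAlg k n)) :=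
  Module.Basis.mk (v := fun i => b i ⊗ₜ[k] topCoeff k n)
    (by
      classical
      rw [linearIndependent_iff]
      intro l hl
      ext1 i
      have h1 := congrArg (TensorProduct.equivFinsuppOfBasisLeft b) hl
      rw [Finsupp.linearCombination_apply, Finsupp.sum, map_sum, map_zero] at h1
      have h2 := DFunLike.congr_fun h1 i
      simp only [omega_smul_tmul, Finsupp.finsetSum_apply,
        TensorProduct.equivFinsuppOfBasisLeft_apply_tmul, Finsupp.mapRange_apply,
        Module.Basis.repr_self, Finsupp.zero_apply] at h2
      by_cases hi : i ∈ l.support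
      · rw [Finset.sum_eq_single_of_mem i hi] at h2
        · simp only [Finsupp.single_eq_same, one_smul] at h2
          rw [Finsupp.zero_apply, ← MulOpposite.unop_eq_zero_iff]
          -- The coordinate of the relation at `b i` is `topCoeff · l_i`, and only `0` annihilates
          -- `topCoeff`.
          exact eq_zero_of_topCoeff_mul k (LinearMap.congr_fun h2)
        · intro j _ hj
          rw [Finsupp.single_eq_of_ne hj.symm, zero_smul]
      · simpa using hi)
    (by
      rintro x -
      induction x using TensorProduct.induction_on with
      | zero => exact zero_mem _
      | add x y hx hy => exact add_mem hx hy
      | tmul v f =>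
        have hv : v ∈ Submodule.span k (Set.range b) := b.span_eq ▸ Submodule.mem_top
        induction hv using Submodule.span_induction with
        | mem v hv =>
          obtain ⟨i, rfl⟩ := hv
          obtain ⟨y, rfl⟩ := exists_omegaAct_topCoeff k f
          rw [← omega_smul_tmul]
          exact Submodule.smul_mem _ y (Submodule.subset_span (Set.mem_range_self i))
        | zero => rw [TensorProduct.zero_tmul]; exact zero_mem _
        | add x y _ _ hx hy => rw [TensorProduct.add_tmul]; exact add_mem hx hy
        | smul a x _ hx =>
          rw [← TensorProduct.smul_tmul']
          exact Submodule.smul_of_tower_mem _ a hx)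

theorem omegaBasis_apply {I : Type*} (b : Module.Basis I k V) (i : I) :
    omegaBasis (n := n) b i = b i ⊗ₜ[k] topCoeff k n := by
  simp [omegaBasis]

end OmegaTensor

/-! ### Restriction to the exterior subalgebras -/

section MulVars

universe t t'

variable {k : Type*} [Field k] {n : ℕ} {A : Type*} [AddCommGroup A] {w : Fin (n + 1) → A}

/-- The variables are normal elements of `E`, so the additive group generated by the elements `y
e_i` is already a submodule. -/
theorem DM.mem_closure_of_mem_mulVars (D : DM.{t} k w) {I : Set (Fin (n + 1))} {x : D.carrier}
    (hx : x ∈ D.mulVars I) :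
    x ∈ AddSubgroup.closure {x | ∃ i ∈ I, ∃ y, x = MulOpposite.op (e i : ExtAlg k n) • y} := by
  let P : Submodule (ExtAlg k n)ᵐᵒᵖ D.carrier :=
    { AddSubgroup.closure {x | ∃ i ∈ I, ∃ y, x = MulOpposite.op (e i : ExtAlg k n) • y} with
      smul_mem' := by
        intro c x hx
        change c • x ∈ AddSubgroup.closure _
        induction hx using AddSubgroup.closure_induction with
        | mem x hx =>
          obtain ⟨i, hi, y, rfl⟩ := hx
          obtain ⟨c', hc'⟩ := exists_e_mul_eq k i c.unop
          refine AddSubgroup.subset_closure ⟨i, hi, MulOpposite.op c' • y, ?_⟩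
          rw [smul_smul, smul_smul, ← MulOpposite.op_mul, ← hc', MulOpposite.op_mul,
            MulOpposite.op_unop]
        | zero => rw [smul_zero]; exact zero_mem _
        | add x y _ _ hx hy => rw [smul_add]; exact add_mem hx hy
        | neg x _ hx => rw [smul_neg]; exact neg_mem hx }
  have : D.mulVars I ≤ P := Submodule.span_le.mpr AddSubgroup.subset_closure
  exact this hx

/-- Only additivity is required of `η`, in order to cover the homotopy `koszulHomotopy`, which is
not `E`-linear. -/
theorem DM.map_mem_mulVars {D : DM.{t} k w} {D' : DM.{t'} k w} {I : Set (Fin (n + 1))}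
    (η : D.carrier →+ D'.carrier)
    (hη : ∀ i ∈ I, ∀ y, η (MulOpposite.op (e i : ExtAlg k n) • y) ∈ D'.mulVars I)
    {x : D.carrier} (hx : x ∈ D.mulVars I) : η x ∈ D'.mulVars I := by
  have hx' := D.mem_closure_of_mem_mulVars hx
  clear hx
  induction hx' using AddSubgroup.closure_induction with
  | mem x hx =>
    obtain ⟨i, hi, y, rfl⟩ := hx
    exact hη i hi y
  | zero => rw [map_zero]; exact zero_mem _
  | add x y _ _ hx hy => rw [map_add]; exact add_mem hx hy
  | neg x _ hx => rw [map_neg]; exact neg_mem hx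

theorem DM.linearMap_mem_mulVars {D : DM.{t} k w} {D' : DM.{t'} k w} {I : Set (Fin (n + 1))}
    (η : D.carrier →ₗ[(ExtAlg k n)ᵐᵒᵖ] D'.carrier)
    {x : D.carrier} (hx : x ∈ D.mulVars I) : η x ∈ D'.mulVars I :=
  DM.map_mem_mulVars η.toAddMonoidHom
    (fun i hi y => Submodule.subset_span ⟨i, hi, η y, map_smul η _ _⟩) hx

/-- Exactness of `D ⊗_E E_I`, in terms of `D`. -/
theorem DM.restrictD_exact_iff (D : DM.{t} k w) (I : Set (Fin (n + 1))) :
    Function.Exact (D.restrictD I) (D.restrictD I) ↔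
      ∀ x, D.d x ∈ D.mulVars Iᶜ → ∃ y, x - D.d y ∈ D.mulVars Iᶜ := by
  have hmk : ∀ x, D.restrictD I (Submodule.Quotient.mk x) = Submodule.Quotient.mk (D.d x) :=
    fun _ => rfl
  constructor
  · intro h x hx
    obtain ⟨y, hy⟩ := (h (Submodule.Quotient.mk x)).mp (by
      rw [hmk]; exact (Submodule.Quotient.mk_eq_zero _).mpr hx)
    obtain ⟨y, rfl⟩ := Submodule.Quotient.mk_surjective _ y
    rw [hmk] at hy
    exact ⟨y, (Submodule.Quotient.eq _).mp hy.symm⟩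
  · intro h x
    obtain ⟨x, rfl⟩ := Submodule.Quotient.mk_surjective _ x
    constructor
    · intro hx
      rw [hmk] at hx
      obtain ⟨y, hy⟩ := h x ((Submodule.Quotient.mk_eq_zero _).mp hx)
      exact ⟨Submodule.Quotient.mk y, by
        rw [hmk]; exact ((Submodule.Quotient.eq _).mpr hy).symm⟩
    · rintro ⟨y, hy⟩
      obtain ⟨y, rfl⟩ := Submodule.Quotient.mk_surjective _ y
      rw [← hy, hmk, hmk, D.d_sq]
      rfl

/-- Exactness of the restriction is invariant under homotopy equivalence. -/
theorem DM.Hom.IsHomotopyEquiv.restrictD_exact {D : DM.{t} k w} {D' : DM.{t'} k w} {f : D.Hom D'}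
    (hf : f.IsHomotopyEquiv) {I : Set (Fin (n + 1))}
    (h : Function.Exact (D'.restrictD I) (D'.restrictD I)) :
    Function.Exact (D.restrictD I) (D.restrictD I) := by
  rw [DM.restrictD_exact_iff] at h ⊢
  obtain ⟨g, ⟨s, _, hs⟩, _⟩ := hf
  intro x hx
  obtain ⟨y, hy⟩ := h (f.toFun x) (by rw [← f.comm]; exact DM.linearMap_mem_mulVars _ hx)
  -- Modulo the submodule, `f x = ∂ y`, hence `g f x = ∂ (g y)`; also `g f x - x = s ∂ x + ∂ s x`,
  -- where `s ∂ x` lies in the submodule because `∂ x` does.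
  refine ⟨g.toFun y - s x, ?_⟩
  have h1 := DM.linearMap_mem_mulVars (D' := D) g.toFun hy
  have h2 := DM.linearMap_mem_mulVars (D' := D) s hx
  have h3 := hs x
  simp only [LinearMap.comp_apply, LinearMap.id_apply] at h3
  rw [map_sub, g.comm] at h1
  have : x - D.d (g.toFun y - s x) =
      g.toFun (f.toFun x) - D.d (g.toFun y) - s (D.d x) := by
    rw [map_sub, sub_eq_iff_eq_add.mp h3]; abel
  rw [this]
  exact sub_mem h1 h2

theorem DM.isExact_of_restrictD_univ {D : DM.{t} k w}
    (h : Function.Exact (D.restrictD Set.univ) (D.restrictD Set.univ)) : D.IsExact := by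
  rw [DM.restrictD_exact_iff] at h
  have h0 : D.mulVars (Set.univ)ᶜ = ⊥ := by
    rw [DM.mulVars, Submodule.span_eq_bot]
    rintro x ⟨i, hi, _⟩
    exact absurd (Set.mem_univ i) hi
  simp only [h0, Submodule.mem_bot] at h
  intro x
  constructor
  · intro hx
    obtain ⟨y, hy⟩ := h x hx
    exact ⟨y, (sub_eq_zero.mp hy).symm⟩
  · rintro ⟨y, rfl⟩
    exact D.d_sq y

end MulVars

/-! ### The minimal model of `R(C)` -/

section MinimalModel

universe t t' t''

variable {k : Type*} [Field k] {n : ℕ} {A : Type*} [AddCommGroup A] {w : Fin (n + 1) → A}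

theorem internalHom_comp {D : GrEMod.{t} k w} {D' : GrEMod.{t'} k w} {D'' : GrEMod.{t''} k w}
    {c d : A × ℤ} {f : D.carrier →ₗ[(ExtAlg k n)ᵐᵒᵖ] D'.carrier}
    {g : D'.carrier →ₗ[(ExtAlg k n)ᵐᵒᵖ] D''.carrier} (hf : f ∈ internalHom D D' c)
    (hg : g ∈ internalHom D' D'' d) : g.comp f ∈ internalHom D D'' (c + d) := fun b x hx => by
  have := hg _ _ (hf b x hx)
  rwa [add_assoc] at this

theorem internalHom_pow {D : GrEMod.{t} k w} {f : Module.End (ExtAlg k n)ᵐᵒᵖ D.carrier}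
    (hf : f ∈ internalHom D D 0) (m : ℕ) : f ^ m ∈ internalHom D D 0 := by
  induction m with
  | zero => intro c x hx; simpa using hx
  | succ m ih =>
    have := internalHom_comp hf ih
    rwa [add_zero] at this

theorem evalAt_neg {V : Type*} [AddCommGroup V] [Module k V] (y : ExtAlg k n)
    (x : V ⊗[k] Module.Dual k (ExtAlg k n)) : evalAt (-y) x = -evalAt y x := by
  simp [evalAt, LinearMap.lTensor_neg]

theorem evalAt_zero {V : Type*} [AddCommGroup V] [Module k V]
    (x : V ⊗[k] Module.Dual k (ExtAlg k n)) : evalAt 0 x = 0 := by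
  simp [evalAt]

/-! ### The Koszul part of the differential and its nilpotence. -/

namespace SComplex

variable (C : SComplex.{t} k w)

/-- The differential of `R(C)`, as an endomorphism of `C ⊗ ω_E`. -/
def totalD : Module.End (ExtAlg k n)ᵐᵒᵖ (C.carrier ⊗[k] Module.Dual k (ExtAlg k n)) :=
  C.R.d

theorem totalD_apply (x : C.carrier ⊗[k] Module.Dual k (ExtAlg k n)) : C.totalD x = C.rD x := rfl

/-- The Koszul part `c ⊗ f ↦ (-1)^j ∑ x_i c ⊗ e_i f` of the differential of `R(C)`. -/
def koszul : Module.End (ExtAlg k n)ᵐᵒᵖ (C.carrier ⊗[k] Module.Dual k (ExtAlg k n)) :=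
  C.totalD - omegaMap n (C.d.restrictScalars k)

theorem koszul_tmul (c : C.carrier) (f : Module.Dual k (ExtAlg k n)) :
    C.koszul (c ⊗ₜ[k] f) = ∑ i, C.sgn (C.mulX i c) ⊗ₜ leftMul k i f := by
  rw [koszul, LinearMap.sub_apply, totalD_apply, C.rD_tmul, omegaMap_tmul,
    LinearMap.restrictScalars_apply, add_sub_cancel_right]

theorem add_koszul : omegaMap n (C.d.restrictScalars k) + C.koszul = C.totalD :=
  add_sub_cancel _ _

theorem koszul_soc (c : C.carrier) : C.koszul (c ⊗ₜ[k] augm k n) = 0 := by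
  rw [koszul_tmul]
  exact Finset.sum_eq_zero fun i _ => by rw [leftMul_augm, TensorProduct.tmul_zero]

theorem omegaMap_d_mem : omegaMap n (C.d.restrictScalars k) ∈
    internalHom (omegaMod w C.isGrading) (omegaMod w C.isGrading) (0, -1) := by
  intro c x hx
  refine omegaMap_mem (d := (0, -1)) ?_ c hx
  rintro ⟨a, j⟩ x hx
  simpa [sub_eq_add_neg] using C.d_mem hx

theorem totalD_mem :
    C.totalD ∈ internalHom (omegaMod w C.isGrading) (omegaMod w C.isGrading) (0, -1) := by
  rintro ⟨a, j⟩ x hx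
  have := C.R.d_mem hx
  rw [Prod.mk_add_mk, add_zero, ← sub_eq_add_neg]
  exact this

theorem koszul_mem : C.koszul ∈
    internalHom (omegaMod w C.isGrading) (omegaMod w C.isGrading) (0, -1) :=
  sub_mem C.totalD_mem C.omegaMap_d_mem

/-- In terms of coefficients, `K` shifts exterior degree: the coefficient of `K x` at `e_J` is
computed from the coefficients of `x` at the products `e_J e_i`. -/
theorem evalAt_koszul (y : ExtAlg k n) (x : C.carrier ⊗[k] Module.Dual k (ExtAlg k n)) :
    evalAt y (C.koszul x) = -∑ i, C.sgn (C.mulX i (evalAt (y * e i) x)) := by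
  induction x using TensorProduct.induction_on with
  | zero => simp
  | add x x' hx hx' => simp only [map_add, hx, hx', Finset.sum_add_distrib, neg_add]
  | tmul c f =>
    rw [koszul_tmul, map_sum, ← Finset.sum_neg_distrib]
    exact Finset.sum_congr rfl fun i _ => by simp

theorem koszul_mem_mulVars (x : C.carrier ⊗[k] Module.Dual k (ExtAlg k n)) :
    C.koszul x ∈ C.R.mulVars Set.univ := by
  induction x using TensorProduct.induction_on with
  | zero => rw [map_zero]; exact zero_mem (C.R.mulVars Set.univ)
  | add x x' hx hx' => rw [map_add]; exact (C.R.mulVars Set.univ).add_mem hx hx'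
  | tmul c f =>
    rw [koszul_tmul]
    refine (C.R.mulVars Set.univ).sum_mem fun i _ => Submodule.subset_span ?_
    obtain ⟨f', hf'⟩ := exists_leftMul_eq k w i f
    exact ⟨i, Set.mem_univ i, (C.sgn (C.mulX i c) ⊗ₜ[k] f' : C.carrier ⊗[k] _), by rw [hf']; rfl⟩

/-- Filter by the vanishing of all coefficients at `e_J` with `|J| ≥ m`. By `evalAt_koszul`, `K`
lowers `m` by one, while `h` acts on each coefficient separately and preserves the filtration. -/
theorem homotopy_koszul_pow (h : Module.End k C.carrier) :
    (-(omegaMap n h * C.koszul)) ^ (n + 2) = 0 := by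
  refine pow_eq_zero_of_filtration _ (fun m => ⨅ J : {J : Finset (Fin (n + 1)) // m ≤ J.card},
    (evalAt (extBasis k n J.1)).toAddMonoidHom.ker) ?_ ?_ ?_
  · refine (AddSubgroup.eq_bot_iff_forall _).mpr fun x hx => ?_
    rw [AddSubgroup.mem_iInf] at hx
    exact evalAt_ext fun J => by rw [map_zero]; exact hx ⟨J, Nat.zero_le _⟩
  · intro m x hx
    rw [AddSubgroup.mem_iInf] at hx ⊢
    rintro ⟨J, hJ⟩
    change evalAt (extBasis k n J) (-(omegaMap n h (C.koszul x))) = 0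
    rw [map_neg, evalAt_omegaMap, evalAt_koszul, Finset.sum_eq_zero, neg_zero, map_zero, neg_zero]
    intro i _
    have h0 : evalAt (extBasis k n J * e i) x = 0 := by
      rw [← extBasis_singleton]
      by_cases hd : Disjoint J {i}
      · obtain ⟨u, hu⟩ := extBasis_mul_of_disjoint k hd
        have hx' : evalAt (extBasis k n (J ∪ {i})) x = 0 :=
          hx ⟨J ∪ {i}, by rw [Finset.card_union_of_disjoint hd, Finset.card_singleton]; omega⟩
        rw [hu]
        rcases Int.units_eq_one_or u with rfl | rfl
        · rw [one_smul, hx']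
        · rw [Units.neg_smul, one_smul, evalAt_neg, hx', neg_zero]
      · rw [extBasis_mul_of_not_disjoint k hd, evalAt_zero]
    rw [h0, map_zero, map_zero]
  · refine (AddSubgroup.eq_top_iff' _).mpr fun x => ?_
    rw [AddSubgroup.mem_iInf]
    rintro ⟨J, hJ⟩
    -- A set `J` has at most `n + 1` elements, so at level `n + 2` the condition is empty; this
    -- explains the exponent.
    have := J.card_le_univ
    rw [Fintype.card_fin] at this
    omega

end SComplex


/-- A special homogeneous contraction of the complex `C` of vector spaces onto its homology. -/
structure SComplex.Contraction (C : SComplex.{t} k w) where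
  h : Module.End k C.carrier
  h_mem : ∀ {a : A} {j : ℤ} {x : C.carrier}, x ∈ C.piece (a, j) → h x ∈ C.piece (a, j + 1)
  d_h_d : C.d.restrictScalars k * h * C.d.restrictScalars k = C.d.restrictScalars k
  h_d_h : h * C.d.restrictScalars k * h = h
  h_h : h * h = 0

theorem SComplex.nonempty_contraction (C : SComplex.{t} k w) : Nonempty C.Contraction := by
  obtain ⟨h, h1, h2, h3, h4⟩ := C.exists_homotopy
  exact ⟨⟨h, fun hx => h1 _ _ _ hx, h2, h3, h4⟩⟩

/-! ### Harmonic representatives and the transferred differential. -/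

namespace SComplex.Contraction

variable {C : SComplex.{t} k w} (s : C.Contraction)

/-- The projection onto the chosen space of representatives of the homology classes. -/
def proj : Module.End k C.carrier :=
  1 - C.d.restrictScalars k * s.h - s.h * C.d.restrictScalars k

theorem proj_apply (x : C.carrier) : s.proj x = x - C.d (s.h x) - s.h (C.d x) := rfl

theorem d_h_d_apply (x : C.carrier) : C.d (s.h (C.d x)) = C.d x :=
  LinearMap.congr_fun s.d_h_d x

theorem h_d_h_apply (x : C.carrier) : s.h (C.d (s.h x)) = s.h x :=
  LinearMap.congr_fun s.h_d_h x

theorem h_h_apply (x : C.carrier) : s.h (s.h x) = 0 :=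
  LinearMap.congr_fun s.h_h x

theorem proj_d (x : C.carrier) : s.proj (C.d x) = 0 := by
  rw [proj_apply, d_h_d_apply, C.d_sq, map_zero, sub_self, sub_zero]

theorem d_proj (x : C.carrier) : C.d (s.proj x) = 0 := by
  rw [proj_apply, map_sub, map_sub, d_h_d_apply, C.d_sq, sub_zero, sub_self]

theorem h_proj (x : C.carrier) : s.h (s.proj x) = 0 := by
  rw [proj_apply, map_sub, map_sub, h_d_h_apply, h_h_apply, sub_zero, sub_self]

theorem proj_proj (x : C.carrier) : s.proj (s.proj x) = s.proj x := by
  rw [proj_apply, h_proj, d_proj, map_zero, map_zero, sub_zero, sub_zero]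

theorem proj_mem {c : A × ℤ} {x : C.carrier} (hx : x ∈ C.piece c) : s.proj x ∈ C.piece c := by
  obtain ⟨a, j⟩ := c
  have h1 := C.d_mem (s.h_mem hx)
  have h2 := s.h_mem (C.d_mem hx)
  rw [add_sub_cancel_right] at h1
  rw [sub_add_cancel] at h2
  exact sub_mem (sub_mem hx h1) h2

/-- The space of representatives of the homology classes. -/
def harmonic : Submodule k C.carrier := LinearMap.range s.proj

theorem proj_of_mem {x : C.carrier} (hx : x ∈ s.harmonic) : s.proj x = x := by
  obtain ⟨y, rfl⟩ := hx
  exact s.proj_proj y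

theorem d_of_mem {x : C.carrier} (hx : x ∈ s.harmonic) : C.d x = 0 := by
  rw [← s.proj_of_mem hx, d_proj]

/-- The projection `C → H`. -/
def toHarmonic : C.carrier →ₗ[k] s.harmonic := s.proj.rangeRestrict

theorem coe_toHarmonic (x : C.carrier) : (s.toHarmonic x : C.carrier) = s.proj x := rfl

theorem toHarmonic_coe (x : s.harmonic) : s.toHarmonic x = x :=
  Subtype.ext (s.proj_of_mem x.2)

/-- The grading of the space of representatives. -/
def harmonicPiece (c : A × ℤ) : Submodule k s.harmonic :=
  (C.piece c).comap s.harmonic.subtype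

theorem toHarmonic_mem {c : A × ℤ} {x : C.carrier} (hx : x ∈ C.piece c) :
    s.toHarmonic x ∈ s.harmonicPiece c :=
  s.proj_mem hx

theorem isGrading_harmonic : IsGrading s.harmonicPiece := by
  refine IsGrading.of_coaction ((Finsupp.mapRange.linearMap s.toHarmonic).comp
    (C.isGrading.coaction.comp s.harmonic.subtype)) ?_ ?_
  · intro c x hx
    have hx' : (x : C.carrier) ∈ C.piece c := hx
    simp [C.isGrading.coaction_of_mem hx', s.toHarmonic_coe]
  · rw [eq_top_iff]
    intro x _
    rw [← s.toHarmonic_coe x]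
    have hx : (x : C.carrier) ∈ ⨆ c, C.piece c := C.isGrading.span ▸ Submodule.mem_top
    refine Submodule.iSup_induction _ (motive := fun y => s.toHarmonic y ∈ _) hx ?_ ?_ ?_
    · intro c y hy
      exact Submodule.mem_iSup_of_mem c (s.toHarmonic_mem hy)
    · rw [map_zero]; exact zero_mem _
    · intro y z hy hz
      rw [map_add]; exact add_mem hy hz

/-- The inverse of `1 + h K`. -/
def inv : Module.End (ExtAlg k n)ᵐᵒᵖ (C.carrier ⊗[k] Module.Dual k (ExtAlg k n)) :=
  ∑ m ∈ Finset.range (n + 2), (-(omegaMap n s.h * C.koszul)) ^ m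

/-- The inverse of `1 + K h`. -/
def inv' : Module.End (ExtAlg k n)ᵐᵒᵖ (C.carrier ⊗[k] Module.Dual k (ExtAlg k n)) :=
  -- The identity `(1 + K h)⁻¹ = 1 - K (1 + h K)⁻¹ h` spares a second nilpotence argument.
  1 - C.koszul * s.inv * omegaMap n s.h

theorem inv_mul : s.inv * (1 + omegaMap n s.h * C.koszul) = 1 := by
  have := geom_sum_mul_neg (-(omegaMap n s.h * C.koszul)) (n + 2)
  rwa [C.homotopy_koszul_pow, sub_zero, sub_neg_eq_add] at this

theorem mul_inv : (1 + omegaMap n s.h * C.koszul) * s.inv = 1 := by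
  have := mul_neg_geom_sum (-(omegaMap n s.h * C.koszul)) (n + 2)
  rwa [C.homotopy_koszul_pow, sub_zero, sub_neg_eq_add] at this

theorem inv'_mul : s.inv' * (1 + C.koszul * omegaMap n s.h) = 1 := by
  have : s.inv' * (1 + C.koszul * omegaMap n s.h) = 1 + C.koszul * omegaMap n s.h -
      C.koszul * (s.inv * (1 + omegaMap n s.h * C.koszul)) * omegaMap n s.h := by
    simp only [inv', sub_mul, mul_add, add_mul, one_mul, mul_one, mul_assoc]
    abel
  rw [this, s.inv_mul, mul_one, add_sub_cancel_right]

theorem mul_inv' : (1 + C.koszul * omegaMap n s.h) * s.inv' = 1 := by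
  have : (1 + C.koszul * omegaMap n s.h) * s.inv' = 1 + C.koszul * omegaMap n s.h -
      C.koszul * ((1 + omegaMap n s.h * C.koszul) * s.inv) * omegaMap n s.h := by
    simp only [inv', mul_sub, mul_add, add_mul, one_mul, mul_one, mul_assoc]
  rw [this, s.mul_inv, mul_one, add_sub_cancel_right]

/-- The contraction of `C` onto its harmonic part, tensored with `ω_E`, is a contraction onto a
module with zero differential, and the Koszul part is the perturbation. -/
theorem perturbationData : PerturbationData (omegaMap n (C.d.restrictScalars k)) C.koszul
    (omegaMap n s.h) s.inv s.inv' (omegaMap n s.toHarmonic) (omegaMap n s.harmonic.subtype) where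
  sq := LinearMap.ext fun x => by
    have : (C.d.restrictScalars k).comp (C.d.restrictScalars k) = 0 :=
      LinearMap.ext fun x => C.d_sq x
    rw [Module.End.mul_apply, omegaMap_omegaMap, this]
    exact LinearMap.congr_fun (LinearMap.rTensor_zero _) x
  perturbed_sq := by
    rw [C.add_koszul]
    exact LinearMap.ext fun x => C.R.d_sq x
  homotopy_sq := LinearMap.ext fun x => by
    have : s.h.comp s.h = 0 := s.h_h
    rw [Module.End.mul_apply, omegaMap_omegaMap, this]
    exact LinearMap.congr_fun (LinearMap.rTensor_zero _) x
  d_h_d := LinearMap.ext fun x => by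
    rw [Module.End.mul_apply, Module.End.mul_apply, omegaMap_omegaMap, omegaMap_omegaMap]
    exact congrArg (fun g => omegaMap n g x) s.d_h_d
  h_d_h := LinearMap.ext fun x => by
    rw [Module.End.mul_apply, Module.End.mul_apply, omegaMap_omegaMap, omegaMap_omegaMap]
    exact congrArg (fun g => omegaMap n g x) s.h_d_h
  i_p x := by
    induction x using TensorProduct.induction_on with
    | zero => simp
    | add x y hx hy => simp only [map_add, hx, hy]; abel
    | tmul c f =>
      simp only [omegaMap_tmul, Submodule.subtype_apply, coe_toHarmonic, proj_apply,
        TensorProduct.sub_tmul, LinearMap.restrictScalars_apply]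
  p_i x := by
    have : s.toHarmonic.comp s.harmonic.subtype = LinearMap.id :=
      LinearMap.ext fun x => s.toHarmonic_coe x
    rw [omegaMap_omegaMap, this, omegaMap_id]
  v_left := s.inv_mul
  v_right := s.mul_inv
  v'_left := s.inv'_mul
  v'_right := s.mul_inv'

theorem omegaMap_h_mem : omegaMap n s.h ∈
    internalHom (omegaMod w C.isGrading) (omegaMod w C.isGrading) (0, 1) := by
  intro c x hx
  refine omegaMap_mem (d := (0, 1)) ?_ c hx
  rintro ⟨a, j⟩ x hx
  simpa using s.h_mem hx

theorem inv_mem : s.inv ∈ internalHom (omegaMod w C.isGrading) (omegaMod w C.isGrading) 0 := by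
  refine sum_mem fun m _ => internalHom_pow (neg_mem ?_) m
  have := internalHom_comp C.koszul_mem s.omegaMap_h_mem
  rwa [Prod.mk_add_mk, add_zero, neg_add_cancel] at this

theorem inv'_mem : s.inv' ∈ internalHom (omegaMod w C.isGrading) (omegaMod w C.isGrading) 0 := by
  refine sub_mem (fun c x hx => by rw [add_zero]; exact hx) ?_
  have := internalHom_comp s.omegaMap_h_mem (internalHom_comp s.inv_mem C.koszul_mem)
  rwa [zero_add, Prod.mk_add_mk, add_zero, add_neg_cancel] at this

/-- The inclusion of the minimal model. -/
def incl : s.harmonic ⊗[k] Module.Dual k (ExtAlg k n) →ₗ[(ExtAlg k n)ᵐᵒᵖ]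
    C.carrier ⊗[k] Module.Dual k (ExtAlg k n) :=
  s.inv.comp (omegaMap n s.harmonic.subtype)

/-- The projection to the minimal model. -/
def retr : C.carrier ⊗[k] Module.Dual k (ExtAlg k n) →ₗ[(ExtAlg k n)ᵐᵒᵖ]
    s.harmonic ⊗[k] Module.Dual k (ExtAlg k n) :=
  (omegaMap n s.toHarmonic).comp s.inv'

theorem incl_mem :
    s.incl ∈ internalHom (omegaMod w s.isGrading_harmonic) (omegaMod w C.isGrading) 0 := by
  have h1 : omegaMap n s.harmonic.subtype ∈
      internalHom (omegaMod w s.isGrading_harmonic) (omegaMod w C.isGrading) 0 :=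
    fun c x hx => omegaMap_mem (d := 0) (fun c x hx => by rw [add_zero]; exact hx) c hx
  have := internalHom_comp h1 s.inv_mem
  rwa [add_zero] at this

theorem retr_mem :
    s.retr ∈ internalHom (omegaMod w C.isGrading) (omegaMod w s.isGrading_harmonic) 0 := by
  have h1 : omegaMap n s.toHarmonic ∈
      internalHom (omegaMod w C.isGrading) (omegaMod w s.isGrading_harmonic) 0 :=
    fun c x hx => omegaMap_mem (d := 0)
      (fun c x hx => by rw [add_zero]; exact s.toHarmonic_mem hx) c hx
  have := internalHom_comp s.inv'_mem h1
  rwa [add_zero] at this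

theorem retr_incl (x : s.harmonic ⊗[k] Module.Dual k (ExtAlg k n)) : s.retr (s.incl x) = x :=
  s.perturbationData.retraction x

theorem incl_retr (x : C.carrier ⊗[k] Module.Dual k (ExtAlg k n)) :
    s.incl (s.retr x) = x - C.totalD (s.inv (omegaMap n s.h x)) -
      s.inv (omegaMap n s.h (C.totalD x)) := by
  have := s.perturbationData.projection x
  rwa [C.add_koszul] at this

theorem incl_retr_sub (x : C.carrier ⊗[k] Module.Dual k (ExtAlg k n)) :
    s.incl (s.retr x) - x = (-(s.inv.comp (omegaMap n s.h))) (C.totalD x) +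
      C.totalD ((-(s.inv.comp (omegaMap n s.h))) x) := by
  rw [s.incl_retr, LinearMap.neg_apply, LinearMap.neg_apply, LinearMap.comp_apply,
    LinearMap.comp_apply, map_neg]
  abel

theorem incl_retr_totalD (x : C.carrier ⊗[k] Module.Dual k (ExtAlg k n)) :
    s.incl (s.retr (C.totalD x)) = C.totalD (s.incl (s.retr x)) := by
  have := s.perturbationData.perturbed_commute x
  rw [C.add_koszul] at this
  exact this.symm

theorem incl_retr_totalD_incl (x : s.harmonic ⊗[k] Module.Dual k (ExtAlg k n)) :
    s.incl (s.retr (C.totalD (s.incl x))) = C.totalD (s.incl x) := by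
  rw [s.incl_retr_totalD, s.retr_incl]

theorem retr_totalD_incl_retr (x : C.carrier ⊗[k] Module.Dual k (ExtAlg k n)) :
    s.retr (C.totalD (s.incl (s.retr x))) = s.retr (C.totalD x) := by
  rw [← s.incl_retr_totalD, s.retr_incl]

theorem retr_totalD_incl_sq (x : s.harmonic ⊗[k] Module.Dual k (ExtAlg k n)) :
    s.retr (C.totalD (s.incl (s.retr (C.totalD (s.incl x))))) = 0 := by
  have : C.totalD (C.totalD (s.incl x)) = 0 := C.R.d_sq _
  rw [s.incl_retr_totalD_incl, this, map_zero]

/-- The minimal model of `R(C)`. -/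
def model : DM k w where
  toGrEMod := omegaMod w s.isGrading_harmonic
  d := s.retr.comp (C.totalD.comp s.incl)
  d_mem := by
    intro a j x hx
    have := internalHom_comp (internalHom_comp s.incl_mem C.totalD_mem) s.retr_mem _ _ hx
    rw [zero_add, add_zero, Prod.mk_add_mk, add_zero, ← sub_eq_add_neg] at this
    exact this
  d_sq := s.retr_totalD_incl_sq

/-- The homotopy equivalence from the minimal model to `R(C)`. -/
def inclHom : s.model.Hom C.R where
  toFun := s.incl
  degree := s.incl_mem
  comm := s.incl_retr_totalD_incl

/-- The homotopy inverse of `inclHom`. -/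
def retrHom : C.R.Hom s.model where
  toFun := s.retr
  degree := s.retr_mem
  comm x := (s.retr_totalD_incl_retr x).symm

theorem inclHom_isHomotopyEquiv : s.inclHom.IsHomotopyEquiv := by
  refine ⟨s.retrHom, ⟨0, zero_mem _, fun x => ?_⟩, ⟨-(s.inv.comp (omegaMap n s.h)), ?_, fun x => ?_⟩⟩
  · have : s.retrHom.toFun (s.inclHom.toFun x) = x := s.retr_incl x
    rw [LinearMap.comp_apply, this, LinearMap.zero_apply, LinearMap.zero_apply, map_zero, add_zero]
    exact sub_self x
  · have := internalHom_comp s.omegaMap_h_mem s.inv_mem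
    rw [add_zero] at this
    exact neg_mem this
  · exact s.incl_retr_sub x

/-- The differential is the `E`-linear map `retr` applied to values of `K`, which lie in the
submodule generated by the multiples of the `e_i`; `E`-linear maps preserve it. -/
theorem model_isMinimal : s.model.IsMinimal := by
  intro x
  have h1 := s.perturbationData.perturbed_differential x
  rw [C.add_koszul] at h1
  have h2 : s.model.d x = s.retrHom.toFun (C.koszul (omegaMap n s.h (C.koszul (s.incl x))) +
      C.koszul (s.incl x)) := h1
  rw [h2]
  refine DM.linearMap_mem_mulVars (D := C.R) _ ?_
  exact (C.R.mulVars Set.univ).add_mem (C.koszul_mem_mulVars _) (C.koszul_mem_mulVars _)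

theorem model_isFree : s.model.IsFree := by
  classical
  have hint : DirectSum.IsInternal s.harmonicPiece := s.isGrading_harmonic.bijective
  let b := hint.collectedBasis fun c => Module.Basis.ofVectorSpace k (s.harmonicPiece c)
  -- Indexing the basis by its own elements puts the index set into the universe of the module.
  -- Below, the degree of `b i ⊗ topCoeff` is shifted by that of `topCoeff`.
  refine ⟨_, (omegaBasis b).reindexRange, ?_⟩
  rintro ⟨_, i, rfl⟩
  refine ⟨i.1 + -wt w Finset.univ, ?_⟩
  have hb : (omegaBasis (n := n) b).reindexRange ⟨omegaBasis b i, i, rfl⟩ =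
      b i ⊗ₜ[k] topCoeff k n :=
    (Module.Basis.reindexRange_apply _ _).trans (omegaBasis_apply b i)
  refine (congrArg (· ∈ s.model.piece (i.1 + -wt w Finset.univ)) hb).mpr ?_
  exact tmul_mem_tensorPiece rfl (hint.collectedBasis_mem _ i) (topCoeff_mem k w)

/-- The Koszul part kills the socle because `e_i ε = 0`, so the inclusion has no correction there.
Hence the isomorphism with cohomology is induced by the homotopy equivalence itself. -/
theorem incl_soc (c : s.harmonic) : s.incl (c ⊗ₜ[k] augm k n) = (c : C.carrier) ⊗ₜ[k] augm k n :=
  s.perturbationData.v_of_K_eq_zero (C.koszul_soc _)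

/-- Every correction term of `v'` begins by applying `h`. The case of interest is the image of
`R(M)`. -/
theorem retr_of_h_eq_zero {x : C.carrier ⊗[k] Module.Dual k (ExtAlg k n)}
    (hx : omegaMap n s.h x = 0) : s.retr x = omegaMap n s.toHarmonic x := by
  rw [retr, LinearMap.comp_apply, inv', LinearMap.sub_apply, Module.End.mul_apply, hx, map_zero,
    sub_zero, Module.End.one_apply]

/-- The value at `1` of a homomorphism `k → H ⊗ ω_E` lies in `H ⊗ k ε`. -/
theorem hom_residueOne {c : A × ℤ} (h : internalHom (residue k w) s.model.toGrEMod c) :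
    (h.1 (residueOne k w) : s.harmonic ⊗[k] Module.Dual k (ExtAlg k n)) =
      evalAt (V := s.harmonic) 1 (h.1 (residueOne k w)) ⊗ₜ[k] augm k n := by
  refine eq_evalAt_one_tmul_augm fun y => ?_
  have h1 : MulOpposite.op y • residueOne k w = augm k n y • residueOne k w := rfl
  have h2 := map_smul h.1 (MulOpposite.op y) (residueOne k w)
  have h3 := LinearMap.map_smul_of_tower h.1 (augm k n y) (residueOne k w)
  rw [h1, h3] at h2
  exact h2.symm

/-- The cycle representing the image of `1`. -/
def homToCycles (a : A) (j : ℤ) :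
    internalHom (residue k w) s.model.toGrEMod (a, j) →ₗ[k] C.cycles a j where
  toFun h := ⟨(evalAt (V := s.harmonic) 1 (h.1 (residueOne k w)) : s.harmonic), by
    constructor
    · have h1 := h.2 0 _ (residueOne_mem k w)
      rw [zero_add] at h1
      have h2 : evalAt (V := s.harmonic) 1 (h.1 (residueOne k w)) ∈ s.harmonicPiece (a, j) :=
        evalAt_one_mem (w := w) h1
      exact h2
    · exact s.d_of_mem (Subtype.mem _)⟩
  map_add' h h' := Subtype.ext (by
    change ((evalAt (V := s.harmonic) 1 (h.1 (residueOne k w) + h'.1 (residueOne k w)) :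
      s.harmonic) : C.carrier) = _
    exact congrArg Subtype.val (map_add (evalAt (V := s.harmonic) 1) _ _))
  map_smul' r h := Subtype.ext (by
    change ((evalAt (V := s.harmonic) 1 (r • h.1 (residueOne k w)) : s.harmonic) : C.carrier) = _
    exact congrArg Subtype.val (map_smul (evalAt (V := s.harmonic) 1) r _))

theorem coe_homToCycles {a : A} {j : ℤ}
    (h : internalHom (residue k w) s.model.toGrEMod (a, j)) :
    (s.homToCycles a j h : C.carrier) =
      (evalAt (V := s.harmonic) 1 (h.1 (residueOne k w)) : s.harmonic) := rfl

/-- The map `Hom_E(k, H ⊗ ω_E) → H(C)`. -/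
def homToHomology (a : A) (j : ℤ) :
    internalHom (residue k w) s.model.toGrEMod (a, j) →ₗ[k] C.Homology a j :=
  (Submodule.mkQ _).comp (s.homToCycles a j)

theorem inclHom_residueOne {a : A} {j : ℤ}
    (h : internalHom (residue k w) s.model.toGrEMod (a, j)) :
    s.inclHom.toFun (h.1 (residueOne k w)) = C.soc (s.homToCycles a j h) := by
  have := congrArg s.incl (s.hom_residueOne h)
  rw [s.incl_soc] at this
  exact this

/-- A harmonic boundary is zero, since `proj` fixes harmonic elements and kills boundaries. The
homomorphism is then zero because `1` generates the residue field. -/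
theorem homToHomology_injective (a : A) (j : ℤ) : Function.Injective (s.homToHomology a j) := by
  rw [injective_iff_map_eq_zero]
  intro h hh
  have hb := (Submodule.Quotient.mk_eq_zero _).mp hh
  obtain ⟨y, _, hy⟩ := hb
  have hy' : C.d y = (evalAt (V := s.harmonic) 1 (h.1 (residueOne k w)) : s.harmonic) := hy
  have h0 : evalAt (V := s.harmonic) 1 (h.1 (residueOne k w)) = 0 := by
    rw [← s.toHarmonic_coe (evalAt (V := s.harmonic) 1 (h.1 (residueOne k w))), ← hy']
    exact Subtype.ext (s.proj_d y)
  have h1 : h.1 (residueOne k w) = 0 := by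
    have := s.hom_residueOne h
    rw [h0, TensorProduct.zero_tmul] at this
    exact this
  refine Subtype.ext (LinearMap.ext fun r => ?_)
  have h2 : r = (show k from r) • residueOne k w := (mul_one (show k from r)).symm
  rw [h2, LinearMap.map_smul_of_tower, h1, smul_zero]
  rfl

/-- For a homogeneous `c ∈ H`, the homomorphism `k → H ⊗ ω_E`, `1 ↦ c ⊗ ε`. -/
def harmonicHom {a : A} {j : ℤ} (c : s.harmonic) (hc : c ∈ s.harmonicPiece (a, j)) :
    internalHom (residue k w) s.model.toGrEMod (a, j) :=
  ⟨{ toFun := fun r => ((show k from r) • (c ⊗ₜ[k] augm k n) :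
        s.harmonic ⊗[k] Module.Dual k (ExtAlg k n))
     map_add' := fun r r' => add_smul (show k from r) (show k from r') (c ⊗ₜ[k] augm k n)
     map_smul' := by
       intro y (r : k)
       change ((augm k n y.unop * r) • (c ⊗ₜ[k] augm k n) :
           s.harmonic ⊗[k] Module.Dual k (ExtAlg k n)) =
         (omegaAct k n y).lTensor s.harmonic (r • (c ⊗ₜ[k] augm k n))
       have : omegaAct k n y (augm k n) = augm k n y.unop • augm k n := by
         refine LinearMap.ext fun z => ?_
         exact map_mul ExteriorAlgebra.algebraMapInv _ _
       rw [map_smul, LinearMap.lTensor_tmul, this, TensorProduct.tmul_smul, smul_smul, mul_comm] },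
   by
     intro d (r : k) (hr : d ≠ 0 → r = 0)
     change r • (c ⊗ₜ[k] augm k n) ∈ tensorPiece s.harmonicPiece (omegaPiece k w) _
     by_cases h : d = 0
     · subst h
       exact Submodule.smul_mem _ r (tmul_mem_tensorPiece (by simp) hc (augm_mem k w))
     · rw [hr h, zero_smul]; exact zero_mem _⟩

theorem coe_homToCycles_harmonicHom {a : A} {j : ℤ} (c : s.harmonic)
    (hc : c ∈ s.harmonicPiece (a, j)) :
    (s.homToCycles a j (s.harmonicHom c hc) : C.carrier) = c := by
  have h1 : evalAt (V := s.harmonic) 1 ((1 : k) • (c ⊗ₜ[k] augm k n)) = c := by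
    rw [one_smul, evalAt_tmul, augm_one, one_smul]
  exact congrArg Subtype.val h1

/-- On a cycle `z`, the projection is `z - d (h z)`; equal projections therefore exhibit the
difference of the cycles as `d (h (z - z'))`. -/
theorem homology_mk_eq {a : A} {j : ℤ} {z z' : C.cycles a j}
    (h : s.proj z = s.proj z') :
    (Submodule.Quotient.mk z : C.Homology a j) = Submodule.Quotient.mk z' := by
  rw [Submodule.Quotient.eq]
  refine ⟨s.h (z - z'), s.h_mem (sub_mem z.2.1 z'.2.1), ?_⟩
  have hz : C.d (z : C.carrier) = 0 := z.2.2
  have hz' : C.d (z' : C.carrier) = 0 := z'.2.2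
  rw [proj_apply, proj_apply, hz, hz', map_zero, sub_zero, sub_zero] at h
  change C.d (s.h (z - z')) = (z : C.carrier) - z'
  rw [map_sub, map_sub]
  have h' : (z : C.carrier) - z' = C.d (s.h z) - C.d (s.h z') := by
    rw [sub_eq_sub_iff_add_eq_add] at h ⊢
    rw [h, add_comm]
  exact h'.symm

theorem homToHomology_surjective (a : A) (j : ℤ) :
    Function.Surjective (s.homToHomology a j) := by
  intro z
  obtain ⟨z, rfl⟩ := Submodule.Quotient.mk_surjective _ z
  refine ⟨s.harmonicHom (s.toHarmonic z) (s.toHarmonic_mem z.2.1), s.homology_mk_eq ?_⟩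
  rw [coe_homToCycles_harmonicHom, coe_toHarmonic, proj_proj]

/-- The isomorphism `Hom_E(k, H ⊗ ω_E) ≅ H(C)`. -/
def homEquiv (a : A) (j : ℤ) :
    internalHom (residue k w) s.model.toGrEMod (a, j) ≃ₗ[k] C.Homology a j :=
  LinearEquiv.ofBijective (s.homToHomology a j)
    ⟨s.homToHomology_injective a j, s.homToHomology_surjective a j⟩

theorem homEquiv_apply {a : A} {j : ℤ} (h : internalHom (residue k w) s.model.toGrEMod (a, j)) :
    s.homEquiv a j h = Submodule.Quotient.mk (s.homToCycles a j h) := rfl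

end SComplex.Contraction

end MinimalModel

/-! ### Exactness -/

section Exactness

universe t

variable {N : Type*} [AddCommGroup N] {n : ℕ} {Δ : Fan N n} {k : Type*} [Field k]

/-- If `I` is irrelevant, then every cone misses a ray indexed by `I`. -/
theorem Fan.IsIrrelevant.exists_notMem {I : Set (Fin (n + 1))} (hI : Δ.IsIrrelevant k I)
    {σ : PointedCone ℚ (ℚ ⊗[ℤ] N)} (hσ : σ ∈ Δ.cones) :
    ∃ i ∈ I, (1 : ℚ) ⊗ₜ[ℤ] Δ.u i ∉ σ := by
  classical
  by_contra! h
  -- The point with coordinates `0` on `I` and `1` elsewhere is a zero of `⟨x_i : i ∈ I⟩`, hence of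
  -- `B`. So `x^σ̂` vanishes there, and one of its factors must be indexed by `I`.
  let ev : Poly k n →+* k := MvPolynomial.eval fun i => if i ∈ I then 0 else 1
  have h1 : Ideal.span (MvPolynomial.X '' I) ≤ RingHom.ker ev := by
    rw [Ideal.span_le]
    rintro _ ⟨i, hi, rfl⟩
    simp [ev, hi]
  have h2 : ev (Δ.xhat k σ) = 0 := h1 (hI (Ideal.subset_span ⟨σ, hσ, rfl⟩))
  rw [Fan.xhat, map_prod, Finset.prod_eq_zero_iff] at h2
  obtain ⟨i, hi, hi'⟩ := h2
  rw [Finset.mem_filter] at hi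
  have hiI : i ∉ I := fun hiI => hi.2 (h i hiI)
  simp [ev, hiI] at hi'

/-- A variable acts invertibly on the sections over `U_σ` if its ray is not in `σ`. -/
theorem CoherentSheaf.exists_inverse (F : CoherentSheaf.{t} Δ k) (σ : Δ.Cone) {i : Fin (n + 1)}
    (hi : (1 : ℚ) ⊗ₜ[ℤ] Δ.u i ∉ σ.1) :
    ∃ g : (F.sec σ).carrier →ₗ[Poly k n] (F.sec σ).carrier,
      ∀ x, g ((MvPolynomial.X i : Poly k n) • x) = x := by
  classical
  -- The localization property for `τ = σ` says that the product `x^σ̂` acts invertibly; the factor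
  -- `x_i` commutes with the rest of the product, so it is invertible too.
  have hloc := F.isLocalized (le_refl σ.1)
  have hu := IsLocalizedModule.map_units (S := Submonoid.powers (Δ.xhat k σ.1))
    (F.res (le_refl σ.1)) ⟨Δ.xhat k σ.1, Submonoid.mem_powers _⟩
  have hi' : i ∈ Finset.univ.filter fun i => (1 : ℚ) ⊗ₜ[ℤ] Δ.u i ∉ σ.1 := by simp [hi]
  simp only [Fan.xhat] at hu
  rw [← Finset.mul_prod_erase _ _ hi', map_mul] at hu
  have hc := (Algebra.commute_algebraMap_left (A := Module.End (Poly k n) (F.sec σ).carrier)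
    (MvPolynomial.X i : Poly k n) (algebraMap _ _
      (∏ x ∈ (Finset.univ.filter fun i => (1 : ℚ) ⊗ₜ[ℤ] Δ.u i ∉ σ.1).erase i,
        (MvPolynomial.X x : Poly k n))))
  obtain ⟨⟨u, g, _, hg⟩, rfl : u = _⟩ := (hc.isUnit_mul_iff.mp hu).1
  exact ⟨g, fun x => LinearMap.congr_fun hg x⟩

theorem CoherentSheaf.pull_eq_zero (F : CoherentSheaf.{t} Δ k) {s : Δ.CechIndex} {v : Finset Δ.MaxCone} (hv : v ⊆ s.1)
    {c : ∀ s : Δ.CechIndex, (F.sec s.cap).carrier} (hc : ∀ h : v.Nonempty, c ⟨v, h⟩ = 0) :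
    F.pull s v hv c = 0 := by
  unfold CoherentSheaf.pull
  split_ifs with hne
  · rw [LinearMap.comp_apply, LinearMap.proj_apply, hc hne, map_zero]
  · rfl

/-! ### Operators on Čech cochains and the filtration by Čech degree. -/

variable [LinearOrder Δ.MaxCone] (F : CoherentSheaf.{t} Δ k)

/-- The component of a Čech cochain on one intersection of the cover. -/
def CoherentSheaf.component (s : Δ.CechIndex) :
    F.cech.carrier →ₗ[Poly k n] (F.sec s.cap).carrier :=
  LinearMap.proj (R := Poly k n) (φ := fun s : Δ.CechIndex => (F.sec s.cap).carrier) s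

theorem CoherentSheaf.component_ext {c c' : F.cech.carrier}
    (h : ∀ s, F.component s c = F.component s c') : c = c' :=
  funext h

theorem CoherentSheaf.component_sgn (c : F.cech.carrier) (s : Δ.CechIndex) :
    F.component s (F.cech.sgn c) = (-1 : k) ^ (1 - (s.1.card : ℤ)) • F.component s c := by
  have : ((F.component s).restrictScalars k).comp F.cech.sgn =
      (-1 : k) ^ (1 - (s.1.card : ℤ)) • (F.component s).restrictScalars k := by
    refine F.cech.isGrading.hom_ext ?_
    rintro ⟨a, j⟩ x hx
    rw [LinearMap.comp_apply, F.cech.sgn_of_mem hx, map_smul, LinearMap.smul_apply]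
    by_cases h : (s.1.card : ℤ) = 1 - j
    · rw [h, sub_sub_cancel]
    · have h2 : F.component s x = 0 := (hx s).2 h
      rw [LinearMap.restrictScalars_apply, h2, smul_zero, smul_zero]
  exact LinearMap.congr_fun this c

/-- Restrict a Čech cochain to one intersection and apply an operator `g` there. -/
def CoherentSheaf.localOp (s : Δ.CechIndex)
    (g : (F.sec s.cap).carrier →ₗ[Poly k n] (F.sec s.cap).carrier) :
    F.cech.carrier →ₗ[Poly k n] F.cech.carrier := by
  classical
  exact (LinearMap.single (Poly k n) (fun s : Δ.CechIndex => (F.sec s.cap).carrier) s).comp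
    (g.comp (F.component s))

theorem CoherentSheaf.component_localOp_self (s : Δ.CechIndex)
    (g : (F.sec s.cap).carrier →ₗ[Poly k n] (F.sec s.cap).carrier) (c : F.cech.carrier) :
    F.component s (F.localOp s g c) = g (F.component s c) := by
  classical
  exact Pi.single_eq_same (M := fun s : Δ.CechIndex => (F.sec s.cap).carrier) s _

theorem CoherentSheaf.component_localOp_of_ne {s s' : Δ.CechIndex} (h : s' ≠ s)
    (g : (F.sec s.cap).carrier →ₗ[Poly k n] (F.sec s.cap).carrier) (c : F.cech.carrier) :
    F.component s' (F.localOp s g c) = 0 := by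
  classical
  exact Pi.single_eq_of_ne (M := fun s : Δ.CechIndex => (F.sec s.cap).carrier) h _

theorem CoherentSheaf.localOp_mulX (s : Δ.CechIndex)
    (g : (F.sec s.cap).carrier →ₗ[Poly k n] (F.sec s.cap).carrier) (i : Fin (n + 1))
    (c : F.cech.carrier) : F.localOp s g (F.cech.mulX i c) = F.cech.mulX i (F.localOp s g c) :=
  map_smul (F.localOp s g) (MvPolynomial.X i : Poly k n) c

theorem CoherentSheaf.sgn_localOp (s : Δ.CechIndex)
    (g : (F.sec s.cap).carrier →ₗ[Poly k n] (F.sec s.cap).carrier) (c : F.cech.carrier) :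
    F.cech.sgn (F.localOp s g c) = F.localOp s g (F.cech.sgn c) := by
  refine F.component_ext fun s' => ?_
  rw [F.component_sgn]
  by_cases h : s' = s
  · subst h
    rw [F.component_localOp_self, F.component_localOp_self, F.component_sgn,
      LinearMap.map_smul_of_tower]
  · rw [F.component_localOp_of_ne h, F.component_localOp_of_ne h, smul_zero]

/-- The cochains that vanish on all intersections of at most `card - m` members of the cover. -/
def CoherentSheaf.cechFiltration (m : ℕ) : Submodule k F.cech.carrier where
  carrier := {c | ∀ s : Δ.CechIndex, s.1.card + m ≤ Nat.card Δ.MaxCone → F.component s c = 0}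
  add_mem' hx hy s hs := by rw [map_add, hx s hs, hy s hs, add_zero]
  zero_mem' _ _ := map_zero _
  smul_mem' a x hx s hs := by rw [LinearMap.map_smul_of_tower, hx s hs, smul_zero]

theorem CoherentSheaf.sgn_mem_cechFiltration {m : ℕ} {c : F.cech.carrier}
    (hc : c ∈ F.cechFiltration m) : F.cech.sgn c ∈ F.cechFiltration m := fun s hs => by
  rw [F.component_sgn, hc s hs, smul_zero]

theorem CoherentSheaf.localOp_mem_cechFiltration (s : Δ.CechIndex)
    (g : (F.sec s.cap).carrier →ₗ[Poly k n] (F.sec s.cap).carrier) {m : ℕ} {c : F.cech.carrier}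
    (hc : c ∈ F.cechFiltration m) : F.localOp s g c ∈ F.cechFiltration m := fun s' hs => by
  by_cases h : s' = s
  · subst h
    rw [F.component_localOp_self, hc _ hs, map_zero]
  · rw [F.component_localOp_of_ne h]

/-- The value of `d c` at `s` involves only sets with one element less than `s`; the loss in
cardinality is balanced by the drop from `m + 1` to `m`. -/
theorem CoherentSheaf.d_mem_cechFiltration {m : ℕ} {c : F.cech.carrier}
    (hc : c ∈ F.cechFiltration (m + 1)) : F.cech.d c ∈ F.cechFiltration m := fun s hs => by
  refine (F.cechD_apply c s).trans (Finset.sum_eq_zero fun σ hσ =>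
    smul_eq_zero_of_right _ (F.pull_eq_zero _ fun hne => ?_))
  refine hc ⟨s.1.erase σ, hne⟩ ?_
  have := Finset.card_erase_add_one hσ
  change (s.1.erase σ).card + (m + 1) ≤ _
  omega

/-! ### Contracting the Koszul complexes over the intersections of the cover. -/

section Homotopy

variable [Fintype Δ.CechIndex] (i : Δ.CechIndex → Fin (n + 1))
  (g : ∀ s : Δ.CechIndex, (F.sec s.cap).carrier →ₗ[Poly k n] (F.sec s.cap).carrier)

/-- The homotopy that contracts the Koszul complex over each intersection of the cover. -/
def CoherentSheaf.koszulHomotopy :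
    Module.End k (F.cech.carrier ⊗[k] Module.Dual k (ExtAlg k n)) :=
  ∑ s, TensorProduct.map (F.cech.sgn * (F.localOp s (g s)).restrictScalars k) (contraction k (i s))

theorem CoherentSheaf.koszulHomotopy_tmul (c : F.cech.carrier)
    (f : Module.Dual k (ExtAlg k n)) :
    F.koszulHomotopy i g (c ⊗ₜ[k] f) =
      ∑ s, F.cech.sgn (F.localOp s (g s) c) ⊗ₜ[k] contraction k (i s) f := by
  simp [CoherentSheaf.koszulHomotopy, LinearMap.sum_apply]

theorem CoherentSheaf.sum_localOp
    (hg : ∀ s x, g s ((MvPolynomial.X (i s) : Poly k n) • x) = x) (c : F.cech.carrier) :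
    ∑ s, F.localOp s (g s) (F.cech.mulX (i s) c) = c := by
  refine F.component_ext fun s => ?_
  rw [map_sum, Finset.sum_eq_single s]
  · rw [F.component_localOp_self]
    exact (congrArg (g s) (map_smul (F.component s) _ c)).trans (hg s (F.component s c))
  · intro s' _ h
    exact F.component_localOp_of_ne h.symm _ _
  · simp

/-- The Koszul part of the differential and the homotopy anticommute to the identity, by the
Clifford relation and `g_s x_{i(s)} = 1`. What remains is the Čech part, nonzero in general because
`i(s)` and `g_s` vary with `s`. -/
theorem CoherentSheaf.rD_koszulHomotopy
    (hg : ∀ s x, g s ((MvPolynomial.X (i s) : Poly k n) • x) = x) (c : F.cech.carrier)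
    (f : Module.Dual k (ExtAlg k n)) :
    F.cech.rD (F.koszulHomotopy i g (c ⊗ₜ[k] f)) + F.koszulHomotopy i g (F.cech.rD (c ⊗ₜ[k] f)) -
        c ⊗ₜ[k] f =
      ∑ s, (F.cech.d (F.cech.sgn (F.localOp s (g s) c)) +
        F.cech.sgn (F.localOp s (g s) (F.cech.d c))) ⊗ₜ[k] contraction k (i s) f := by
  rw [F.koszulHomotopy_tmul, map_sum, F.cech.rD_tmul, map_add, map_sum]
  simp only [F.koszulHomotopy_tmul, F.cech.rD_tmul, TensorProduct.add_tmul,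
    Finset.sum_add_distrib]
  have key : ∑ s, ∑ j, F.cech.sgn (F.cech.mulX j (F.cech.sgn (F.localOp s (g s) c))) ⊗ₜ[k]
        leftMul k j (contraction k (i s) f) +
      ∑ j, ∑ s, F.cech.sgn (F.localOp s (g s) (F.cech.sgn (F.cech.mulX j c))) ⊗ₜ[k]
        contraction k (i s) (leftMul k j f) = c ⊗ₜ[k] f := by
    rw [Finset.sum_comm (γ := Fin (n + 1)), ← Finset.sum_add_distrib]
    have hs : ∀ s, (∑ j, F.cech.sgn (F.cech.mulX j (F.cech.sgn (F.localOp s (g s) c))) ⊗ₜ[k]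
          leftMul k j (contraction k (i s) f) +
        ∑ j, F.cech.sgn (F.localOp s (g s) (F.cech.sgn (F.cech.mulX j c))) ⊗ₜ[k]
          contraction k (i s) (leftMul k j f)) =
        F.localOp s (g s) (F.cech.mulX (i s) c) ⊗ₜ[k] f := by
      intro s
      rw [← Finset.sum_add_distrib]
      have hj : ∀ j, F.cech.sgn (F.cech.mulX j (F.cech.sgn (F.localOp s (g s) c))) ⊗ₜ[k]
            leftMul k j (contraction k (i s) f) +
          F.cech.sgn (F.localOp s (g s) (F.cech.sgn (F.cech.mulX j c))) ⊗ₜ[k]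
            contraction k (i s) (leftMul k j f) =
          F.localOp s (g s) (F.cech.mulX j c) ⊗ₜ[k] (if i s = j then f else 0) := by
        intro j
        -- The two signs in each term cancel, and the coefficients agree because `g_s` is linear
        -- over `S`; the anticommutator of `e_j` with the contraction is left.
        rw [← F.cech.sgn_mulX, F.cech.sgn_sgn, ← F.sgn_localOp, F.cech.sgn_sgn, F.localOp_mulX,
          ← TensorProduct.tmul_add, add_comm (leftMul k j _), contraction_leftMul]
      rw [Finset.sum_congr rfl fun j _ => hj j, Finset.sum_eq_single (i s)]
      · rw [if_pos rfl]
      · intro j _ h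
        rw [if_neg h.symm, TensorProduct.tmul_zero]
      · simp
    rw [Finset.sum_congr rfl fun s _ => hs s, ← TensorProduct.sum_tmul, F.sum_localOp i g hg]
  rw [← key]
  abel

/-- The error term raises the Čech degree by one, and a set of maximal cones has at most `Nat.card
Δ.MaxCone` elements. -/
theorem CoherentSheaf.koszulHomotopy_pow
    (hg : ∀ s x, g s ((MvPolynomial.X (i s) : Poly k n) • x) = x) :
    (F.cech.rD * F.koszulHomotopy i g + F.koszulHomotopy i g * F.cech.rD - 1) ^
      Nat.card Δ.MaxCone = 0 := by
  refine pow_eq_zero_of_filtration _ (fun m => AddSubgroup.closure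
    {x | ∃ c ∈ F.cechFiltration m, ∃ f : Module.Dual k (ExtAlg k n), x = c ⊗ₜ[k] f}) ?_ ?_ ?_
  · rw [AddSubgroup.closure_eq_bot_iff]
    rintro _ ⟨c, hc, f, rfl⟩
    have : c = 0 := by
      refine F.component_ext fun s => (hc s ?_).trans (map_zero _).symm
      have : Fintype Δ.MaxCone := Fintype.ofFinite _
      rw [add_zero, Nat.card_eq_fintype_card]
      exact s.1.card_le_univ
    rw [this, TensorProduct.zero_tmul]
    rfl
  · intro m x hx
    induction hx using AddSubgroup.closure_induction with
    | mem x hx =>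
      obtain ⟨c, hc, f, rfl⟩ := hx
      have h := F.rD_koszulHomotopy i g hg c f
      refine (congrArg (· ∈ AddSubgroup.closure _) h).mpr ?_
      refine sum_mem fun s _ => AddSubgroup.subset_closure ⟨_, ?_, _, rfl⟩
      refine add_mem ?_ ?_
      · exact F.d_mem_cechFiltration
          (F.sgn_mem_cechFiltration (F.localOp_mem_cechFiltration s _ hc))
      · exact F.sgn_mem_cechFiltration
          (F.localOp_mem_cechFiltration s _ (F.d_mem_cechFiltration hc))
    | zero => rw [map_zero]; exact zero_mem _
    | add x y _ _ hx hy => rw [map_add]; exact add_mem hx hy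
    | neg x _ hx => rw [map_neg]; exact neg_mem hx
  · refine (AddSubgroup.eq_top_iff' _).mpr fun x => ?_
    induction x using TensorProduct.induction_on with
    | zero => exact zero_mem _
    | add x y hx hy => exact add_mem hx hy
    | tmul c f =>
      refine AddSubgroup.subset_closure ⟨c, fun s hs => ?_, f, rfl⟩
      have := s.2.card_pos
      omega

theorem CoherentSheaf.koszulHomotopy_smul {j : Fin (n + 1)} (hj : ∀ s, i s ≠ j)
    (x : F.cech.carrier ⊗[k] Module.Dual k (ExtAlg k n)) :
    F.koszulHomotopy i g (MulOpposite.op (e j : ExtAlg k n) • x) =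
      MulOpposite.op (e j : ExtAlg k n) • F.koszulHomotopy i g x := by
  induction x using TensorProduct.induction_on with
  | zero => simp
  | add x y hx hy => rw [smul_add, map_add, map_add, smul_add, hx, hy]
  | tmul c f =>
    rw [omega_smul_tmul, F.koszulHomotopy_tmul, F.koszulHomotopy_tmul, Finset.smul_sum]
    refine Finset.sum_congr rfl fun s _ => ?_
    rw [omega_smul_tmul, contraction_omegaAct k (hj s)]

end Homotopy

/-- Irrelevance lets every contraction use a variable from `I`; the homotopy then commutes with
`e_j` for `j ∉ I` and preserves the submodule that is divided out. -/
theorem CoherentSheaf.fourierMukai_restrictD_exact {I : Set (Fin (n + 1))}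
    (hI : Δ.IsIrrelevant k I) :
    Function.Exact (F.fourierMukai.restrictD I) (F.fourierMukai.restrictD I) := by
  have : Fintype Δ.CechIndex := Fintype.ofFinite _
  choose i hiI hi using fun s : Δ.CechIndex => hI.exists_notMem s.cap.2
  choose g hg using fun s : Δ.CechIndex => F.exists_inverse s.cap (hi s)
  rw [DM.restrictD_exact_iff]
  intro x hx
  refine exists_boundary_of_nilpotent (D := F.cech.rD) (η := F.koszulHomotopy i g)
    (J := (F.fourierMukai.mulVars Iᶜ).restrictScalars k) (LinearMap.ext F.cech.rD_rD)
    ?_ ?_ (Nat.card Δ.MaxCone) x ?_ hx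
  · intro y hy
    exact DM.linearMap_mem_mulVars (D := F.fourierMukai) (D' := F.fourierMukai) F.fourierMukai.d hy
  · intro y hy
    refine DM.map_mem_mulVars (D := F.fourierMukai) (D' := F.fourierMukai)
      (F.koszulHomotopy i g).toAddMonoidHom ?_ hy
    intro j hj y
    exact Submodule.subset_span ⟨j, hj, F.koszulHomotopy i g y,
      F.koszulHomotopy_smul i g (fun s (h : i s = j) => hj (by rw [← h]; exact hiI s)) y⟩
  · exact LinearMap.congr_fun (F.koszulHomotopy_pow i g hg) x

end Exactness

/-! ### Cones are generated by their rays -/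

section Cones

/-- A salient finitely generated cone is generated by finitely many vectors that span faces. -/
theorem exists_generators_spanning_faces {V : Type*} [AddCommGroup V] [Module ℚ V]
    {σ : PointedCone ℚ V} (hfg : σ.FG) (hsal : (σ : ConvexCone ℚ V).Salient) :
    ∃ S : Finset V, PointedCone.hull ℚ (S : Set V) = σ ∧
      ∀ s ∈ S, s ≠ 0 ∧ (PointedCone.hull ℚ {s}).IsFaceOf σ := by
  classical
  -- A generating set of least cardinality works: none of its elements lies in the cone generated by
  -- the others.
  have hex : ∃ m : ℕ, ∃ S : Finset V, PointedCone.hull ℚ (S : Set V) = σ ∧ S.card = m := by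
    obtain ⟨S, hS⟩ := hfg
    exact ⟨S.card, S, hS, rfl⟩
  obtain ⟨S, hS, hcard⟩ := Nat.find_spec hex
  have hsmul : ∀ (τ : PointedCone ℚ V) {c : ℚ} {x : V}, 0 ≤ c → x ∈ τ → c • x ∈ τ :=
    fun τ c x hc hx => τ.smul_mem hc hx
  refine ⟨S, hS, fun s hs => ?_⟩
  have hins : insert s ((S.erase s : Finset V) : Set V) = S := by
    rw [← Finset.coe_insert, Finset.insert_erase hs]
  have hnot : s ∉ PointedCone.hull ℚ ((S.erase s : Finset V) : Set V) := by
    intro hmem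
    refine Nat.find_min hex (m := (S.erase s).card) ?_ ⟨S.erase s, ?_, rfl⟩
    · rw [← hcard]; exact Finset.card_erase_lt_of_mem hs
    · rw [← hS, ← hins]; exact (Submodule.span_insert_eq_span hmem).symm
  have hsσ : s ∈ σ := by
    rw [← hS]; exact Submodule.subset_span hs
  have hle : PointedCone.hull ℚ ((S.erase s : Finset V) : Set V) ≤ σ := by
    rw [← hS]; exact Submodule.span_mono (Finset.erase_subset s S)
  have hdec : ∀ x ∈ σ, ∃ α : ℚ, 0 ≤ α ∧
      ∃ x' ∈ PointedCone.hull ℚ ((S.erase s : Finset V) : Set V), x = α • s + x' := by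
    intro x hx
    rw [← hS, ← hins] at hx
    obtain ⟨α, x', hx', rfl⟩ := Submodule.mem_span_insert.mp hx
    exact ⟨α.1, α.2, x', hx', rfl⟩
  refine ⟨fun h => hnot (h ▸ zero_mem _), ?_, ?_⟩
  · exact Submodule.span_le.mpr (Set.singleton_subset_iff.mpr hsσ)
  · intro x y a hx hy ha hxy
    obtain ⟨c, hc⟩ := Submodule.mem_span_singleton.mp hxy
    replace hc : (c : ℚ) • s = a • x + y := hc
    obtain ⟨α, hα, x', hx', rfl⟩ := hdec x hx
    obtain ⟨β, hβ, y', hy', rfl⟩ := hdec y hy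
    -- If the coefficient of `s` is positive, `s` lies in the cone of the other generators. If not,
    -- `-x'` lies in `σ`, which for `x' ≠ 0` contradicts salience. So `x' = 0` and `x` is on the ray
    -- of `s`.
    have hrel : a • x' + y' = ((c : ℚ) - a * α - β) • s := by
      rw [sub_smul, sub_smul, hc, mul_smul, smul_add]; abel
    have hx0 : x' = 0 := by
      by_contra hne
      rcases lt_or_ge 0 ((c : ℚ) - a * α - β) with hr | hr
      · refine hnot ?_
        have : ((c : ℚ) - a * α - β)⁻¹ • (a • x' + y') = s := by
          rw [hrel, smul_smul, inv_mul_cancel₀ hr.ne', one_smul]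
        exact (congrArg (· ∈ PointedCone.hull ℚ ((S.erase s : Finset V) : Set V)) this).mp <|
          hsmul _ (inv_nonneg.mpr hr.le) (add_mem (hsmul _ ha.le hx') hy')
      · refine hsal x' (hle hx') hne ?_
        have : -x' = a⁻¹ • (y' + (-((c : ℚ) - a * α - β)) • s) := by
          rw [neg_smul, ← hrel, neg_add, add_left_comm, add_neg_cancel, add_zero, smul_neg,
            smul_smul, inv_mul_cancel₀ ha.ne', one_smul]
        rw [this]
        exact hsmul σ (inv_nonneg.mpr ha.le)
          (add_mem (hle hy') (hsmul σ (neg_nonneg.mpr hr) hsσ))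
    rw [hx0, add_zero]
    exact hsmul _ hα (Submodule.subset_span rfl)

variable {N : Type*} [AddCommGroup N] {n : ℕ} (Δ : Fan N n)

/-- The cone `τ` is generated by vectors spanning one-dimensional faces; these faces belong to the
fan, so they are among the numbered rays. -/
theorem Fan.le_of_forall_ray_mem {σ τ : PointedCone ℚ (ℚ ⊗[ℤ] N)} (hτ : τ ∈ Δ.cones)
    (h : ∀ i, (1 : ℚ) ⊗ₜ[ℤ] Δ.u i ∈ σ) : τ ≤ σ := by
  obtain ⟨S, hS, hface⟩ := exists_generators_spanning_faces (Δ.fg τ hτ) (Δ.salient τ hτ)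
  rw [← hS]
  refine Submodule.span_le.mpr fun s hs => ?_
  obtain ⟨hs0, hf⟩ := hface s hs
  obtain ⟨i, hi⟩ := Δ.ray_eq _ (Δ.face_mem τ hτ _ hf) (by
    have : Submodule.span ℚ ((PointedCone.hull ℚ {s} : PointedCone ℚ (ℚ ⊗[ℤ] N)) :
        Set (ℚ ⊗[ℤ] N)) = Submodule.span ℚ {s} := Submodule.span_span_of_tower _ _ _
    rw [this]
    exact finrank_span_singleton hs0)
  have hs' : s ∈ PointedCone.hull ℚ {(1 : ℚ) ⊗ₜ[ℤ] Δ.u i} := by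
    rw [← hi]; exact Submodule.subset_span rfl
  exact Submodule.span_le.mpr (Set.singleton_subset_iff.mpr (h i)) hs'

theorem Fan.one_tmul_u_ne_zero [Module.Free ℤ N] (i : Fin (n + 1)) :
    (1 : ℚ) ⊗ₜ[ℤ] Δ.u i ≠ 0 := by
  intro h
  let b := Module.Free.chooseBasis ℤ N
  have hu : Δ.u i = 0 := by
    refine b.ext_elem fun j => ?_
    have h1 := congrArg (fun x => (Algebra.TensorProduct.basis ℚ b).repr x j) h
    simpa using h1
  -- Writing `0 = 0 • 0` contradicts primitivity, as `0` is not a unit of `ℤ`.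
  have := Δ.u_primitive i 0 0 (by rw [hu, smul_zero])
  exact not_isUnit_zero this

/-- On a complete fan with at least one ray, no cone contains all the rays. -/
theorem Fan.exists_ray_notMem [Module.Free ℤ N] (hΔ : ∀ v, ∃ σ ∈ Δ.cones, v ∈ σ)
    {σ : PointedCone ℚ (ℚ ⊗[ℤ] N)} (hσ : σ ∈ Δ.cones) : ∃ i, (1 : ℚ) ⊗ₜ[ℤ] Δ.u i ∉ σ := by
  by_contra! h
  -- By completeness `-u_0` lies in some cone `τ`. If `σ` contained all rays it would contain `τ`,
  -- hence both `u_0` and `-u_0`.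
  obtain ⟨τ, hτ, hv⟩ := hΔ (-((1 : ℚ) ⊗ₜ[ℤ] Δ.u 0))
  exact Δ.salient σ hσ _ (h 0) (Δ.one_tmul_u_ne_zero 0) (Δ.le_of_forall_ray_mem hτ h hv)

/-- Each generator `x^σ̂` of `B` is divisible by a variable, namely by that of a ray outside `σ`.
This yields the exactness of the whole module from that of its restrictions. -/
theorem Fan.isIrrelevant_univ (k : Type*) [Field k] [Module.Free ℤ N]
    (hΔ : ∀ v, ∃ σ ∈ Δ.cones, v ∈ σ) : Δ.IsIrrelevant k Set.univ := by
  classical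
  refine Ideal.span_le.mpr ?_
  rintro _ ⟨σ, hσ, rfl⟩
  obtain ⟨i, hi⟩ := Δ.exists_ray_notMem hΔ hσ
  have hdvd : (MvPolynomial.X i : Poly k n) ∣ Δ.xhat k σ :=
    Finset.dvd_prod_of_mem (fun i => (MvPolynomial.X i : Poly k n)) (by simp [hi])
  exact Ideal.mem_of_dvd _ hdvd (Ideal.subset_span ⟨i, trivial, rfl⟩)

end Cones

/-! ### The embedding of `R(M)` -/

section Embedding

universe t t' t''

/-! ### Functoriality of `R`. -/

section

variable {k : Type*} [Field k] {n : ℕ} {A : Type*} [AddCommGroup A] {w : Fin (n + 1) → A}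

/-- The composite of two morphisms of differential modules. -/
def DM.Hom.comp {D : DM.{t} k w} {D' : DM.{t'} k w} {D'' : DM.{t''} k w} (g : D'.Hom D'')
    (f : D.Hom D') : D.Hom D'' where
  toFun := g.toFun.comp f.toFun
  degree := by
    have := internalHom_comp f.degree g.degree
    rwa [add_zero] at this
  comm x := by rw [LinearMap.comp_apply, f.comm, g.comm, LinearMap.comp_apply]

namespace SComplex

variable {C : SComplex.{t} k w} {C' : SComplex.{t'} k w}
  (ψ : C.carrier →ₗ[Poly k n] C'.carrier)

theorem map_sgn (hψ : ∀ c, ∀ x ∈ C.piece c, ψ x ∈ C'.piece c) (x : C.carrier) :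
    ψ (C.sgn x) = C'.sgn (ψ x) := by
  have : (ψ.restrictScalars k).comp C.sgn = C'.sgn.comp (ψ.restrictScalars k) := by
    refine C.isGrading.hom_ext ?_
    rintro ⟨a, j⟩ x hx
    rw [LinearMap.comp_apply, LinearMap.comp_apply, C.sgn_of_mem hx, map_smul,
      LinearMap.restrictScalars_apply, C'.sgn_of_mem (hψ _ x hx)]
  exact LinearMap.congr_fun this x

theorem omegaMap_rD (hψ : ∀ c, ∀ x ∈ C.piece c, ψ x ∈ C'.piece c)
    (hd : ∀ x, ψ (C.d x) = C'.d (ψ x)) (x : C.carrier ⊗[k] Module.Dual k (ExtAlg k n)) :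
    omegaMap n (ψ.restrictScalars k) (C.rD x) = C'.rD (omegaMap n (ψ.restrictScalars k) x) := by
  induction x using TensorProduct.induction_on with
  | zero => simp
  | add x y hx hy => simp only [map_add, hx, hy]
  | tmul c f =>
    have hX : ∀ i, ψ (C.mulX i c) = C'.mulX i (ψ c) := fun i =>
      map_smul ψ (MvPolynomial.X i : Poly k n) c
    rw [C.rD_tmul, omegaMap_tmul, C'.rD_tmul, map_add, map_sum]
    simp only [omegaMap_tmul, LinearMap.restrictScalars_apply, map_sgn ψ hψ, hd, hX]

/-- The morphism `R(C) → R(C')` induced by a morphism of complexes. -/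
def mapR (hψ : ∀ c, ∀ x ∈ C.piece c, ψ x ∈ C'.piece c) (hd : ∀ x, ψ (C.d x) = C'.d (ψ x)) :
    C.R.Hom C'.R where
  toFun := omegaMap n (ψ.restrictScalars k)
  degree := fun c x hx =>
    omegaMap_mem (d := 0) (fun c x hx => by rw [add_zero]; exact hψ c x hx) c hx
  comm := omegaMap_rD ψ hψ hd

end SComplex

end

variable {N : Type*} [AddCommGroup N] {n : ℕ} {Δ : Fan N n} {k : Type*} [Field k]

theorem Fan.xhat_dvd {σ τ : PointedCone ℚ (ℚ ⊗[ℤ] N)} (h : τ ≤ σ) :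
    Δ.xhat k σ ∣ Δ.xhat k τ := by
  classical
  refine Finset.prod_dvd_prod_of_subset _ _ _ fun i hi => ?_
  simp only [Finset.mem_filter, Finset.mem_univ, true_and] at hi ⊢
  exact fun h' => hi (h h')

/-- If `H^0_B(M) = 0`, a section of `M` that vanishes on all `U_σ`, `σ` maximal, is zero. -/
theorem SheafIso.eq_zero {M : GrSMod.{t'} k Δ.deg} {F : CoherentSheaf.{t} Δ k} (θ : SheafIso M F)
    (hM : H0B Δ M = ⊥) {m : M.carrier}
    (hm : ∀ σ : Δ.Cone, Maximal (· ∈ Δ.cones) σ.1 → θ.toSec σ m = 0) : m = 0 := by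
  let ann : Ideal (Poly k n) := LinearMap.ker (LinearMap.toSpanSingleton (Poly k n) M.carrier m)
  have hann : ∀ p, p ∈ ann ↔ p • m = 0 := fun p => by
    rw [LinearMap.mem_ker, LinearMap.toSpanSingleton_apply]
  have hB : Δ.irrelevantIdeal k ≤ ann.radical := by
    refine Ideal.span_le.mpr ?_
    rintro _ ⟨τ, hτ, rfl⟩
    -- Enlarging a cone divides its monomial, so it suffices that a power of `x^σ̂` kills `m` for
    -- maximal `σ`, which is what vanishing over `U_σ` means.
    obtain ⟨σ, hle, hσ⟩ := Δ.cones.exists_le_maximal hτ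
    refine Ideal.mem_of_dvd _ (Fan.xhat_dvd hle) ?_
    have hloc := θ.isLocalized ⟨σ, hσ.1⟩
    obtain ⟨⟨_, l, rfl⟩, hl⟩ := (IsLocalizedModule.eq_zero_iff
      (Submonoid.powers (Δ.xhat k σ)) (θ.toSec ⟨σ, hσ.1⟩)).mp (hm ⟨σ, hσ.1⟩ hσ)
    exact ⟨l, (hann _).mpr hl⟩
  -- Finite generation of `B` gives a single power of `B` inside the annihilator of `m`.
  obtain ⟨l, hl⟩ := Ideal.exists_pow_le_of_le_radical_of_fg hB (IsNoetherian.noetherian _)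
  have hmem : m ∈ H0B Δ M := by
    refine Submodule.mem_iSup_of_mem l ?_
    rw [Submodule.mem_torsionBySet_iff]
    rintro ⟨p, hp⟩
    exact (hann p).mp (hl hp)
  rwa [hM, Submodule.mem_bot] at hmem

/-! ### The module `M` inside the Čech complex and the minimal model. -/

variable [LinearOrder Δ.MaxCone] {M : GrSMod.{t'} k Δ.deg} {F : CoherentSheaf.{t} Δ k}
  (θ : SheafIso M F)

open Classical in
/-- The map from `M` to Čech `0`-cochains. -/
def SheafIso.toCech : M.carrier →ₗ[Poly k n] F.cech.carrier :=
  LinearMap.pi (φ := fun s : Δ.CechIndex => (F.sec s.cap).carrier) fun s =>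
    if s.1.card = 1 then θ.toSec s.cap else 0

theorem SheafIso.toCech_apply (m : M.carrier) : θ.toCech m = θ.cochain F m := by
  classical
  funext s
  change (if s.1.card = 1 then θ.toSec s.cap else 0 : _ →ₗ[Poly k n] _) m =
    if s.1.card = 1 then θ.toSec s.cap m else 0
  split_ifs <;> rfl

theorem SheafIso.toCech_mem {a : Δ.Cl} {m : M.carrier} (hm : m ∈ M.piece a) :
    θ.toCech m ∈ F.cech.cycles a (-0) := by
  rw [θ.toCech_apply]
  exact θ.cochain_mem F hm

theorem SheafIso.toCech_degree (c : Δ.Cl × ℤ) (m : M.toComplex.carrier)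
    (hm : m ∈ M.toComplex.piece c) : θ.toCech m ∈ F.cech.piece c := by
  obtain ⟨a, j⟩ := c
  by_cases h : j = 0
  · subst h
    exact (θ.toCech_mem hm.1).1
  · have h0 : m = 0 := hm.2 h
    have : θ.toCech m = 0 := (congrArg θ.toCech h0).trans (map_zero θ.toCech)
    rw [this]; exact zero_mem _

theorem SheafIso.d_toCech (m : M.carrier) : F.cech.d (θ.toCech m) = 0 := by
  have : (F.cech.d.comp θ.toCech).restrictScalars k = 0 :=
    M.isGrading.hom_ext fun a m hm => (θ.toCech_mem hm).2
  exact LinearMap.congr_fun this m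

theorem SheafIso.toCech_injective (hM : H0B Δ M = ⊥) : Function.Injective θ.toCech := by
  classical
  rw [injective_iff_map_eq_zero]
  intro m hm
  refine θ.eq_zero hM fun σ hσ => ?_
  let s : Δ.CechIndex := ⟨{⟨σ.1, hσ⟩}, Finset.singleton_nonempty _⟩
  have hcap : s.cap = σ := Subtype.ext (Finset.inf'_singleton _)
  have hs : θ.toSec s.cap m = 0 := by
    rw [θ.toCech_apply] at hm
    have h1 : θ.cochain F m s = 0 := congrFun hm s
    rwa [SheafIso.cochain, if_pos (Finset.card_singleton _)] at h1
  rwa [hcap] at hs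

/-- Positive homological degree is negative Čech degree. Hence `H^0` has no boundaries to divide
out, and a homotopy of degree `1` vanishes on `0`-cochains. -/
theorem CoherentSheaf.eq_zero_of_mem_piece {F : CoherentSheaf.{t} Δ k} {a : Δ.Cl} {j : ℤ}
    (hj : 0 < j) {c : F.cech.carrier} (hc : c ∈ F.cech.piece (a, j)) : c = 0 := by
  funext s
  refine (hc s).2 ?_
  have := s.2.card_pos
  change (s.1.card : ℤ) ≠ 1 - j
  omega

theorem SheafIso.toH0_injective (hM : H0B Δ M = ⊥) (a : Δ.Cl) :
    Function.Injective (θ.toH0 F a) := by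
  intro m m' h
  obtain ⟨y, hy, hd⟩ := (Submodule.Quotient.eq _).mp h
  have hy0 : y = 0 := CoherentSheaf.eq_zero_of_mem_piece (by norm_num) hy
  have hd' : (0 : F.cech.carrier) = θ.toCech m - θ.toCech m' := by
    rw [θ.toCech_apply, θ.toCech_apply]
    refine Eq.trans ?_ hd
    rw [hy0, map_zero]
  exact Subtype.ext (θ.toCech_injective hM (sub_eq_zero.mp hd'.symm))

theorem SheafIso.h_toCech (s : F.cech.Contraction) (m : M.carrier) : s.h (θ.toCech m) = 0 := by
  have : s.h.comp (θ.toCech.restrictScalars k) = 0 := M.isGrading.hom_ext fun a m hm =>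
    CoherentSheaf.eq_zero_of_mem_piece (by norm_num) (s.h_mem (θ.toCech_mem hm).1)
  exact LinearMap.congr_fun this m

/-- The cocycle of `m` is killed by both `d` and `h`, so it is its own harmonic representative,
whatever contraction was chosen. -/
theorem SheafIso.proj_toCech (s : F.cech.Contraction) (m : M.carrier) :
    s.proj (θ.toCech m) = θ.toCech m := by
  rw [s.proj_apply, θ.h_toCech, θ.d_toCech, map_zero, map_zero, sub_zero, sub_zero]

/-- The map from `M` to the representatives of the cohomology classes. -/
def SheafIso.toHarmonic (s : F.cech.Contraction) : M.carrier →ₗ[k] s.harmonic :=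
  s.toHarmonic.comp (θ.toCech.restrictScalars k)

theorem SheafIso.coe_toHarmonic (s : F.cech.Contraction) (m : M.carrier) :
    (θ.toHarmonic s m : F.cech.carrier) = θ.toCech m :=
  θ.proj_toCech s m

theorem SheafIso.toHarmonic_injective (s : F.cech.Contraction) (hM : H0B Δ M = ⊥) :
    Function.Injective (θ.toHarmonic s) := fun m m' h =>
  θ.toCech_injective hM (by rw [← θ.coe_toHarmonic s, h, θ.coe_toHarmonic])

/-- Since `h` vanishes on the image of `M`, the retraction acts without correction terms, and the
embedding becomes a map of vector spaces tensored with `ω_E`. -/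
theorem SheafIso.retr_omegaMap (s : F.cech.Contraction)
    (x : M.carrier ⊗[k] Module.Dual k (ExtAlg k n)) :
    s.retr (omegaMap n (θ.toCech.restrictScalars k) x) = omegaMap n (θ.toHarmonic s) x := by
  rw [s.retr_of_h_eq_zero, omegaMap_omegaMap]
  · rfl
  · induction x using TensorProduct.induction_on with
    | zero => simp
    | add x y hx hy => simp only [map_add, hx, hy, add_zero]
    | tmul m f =>
      rw [omegaMap_tmul, omegaMap_tmul, LinearMap.restrictScalars_apply, θ.h_toCech,
        TensorProduct.zero_tmul]

/-- The embedding of `R(M)` into the minimal model. -/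
def SheafIso.embedding (s : F.cech.Contraction) : M.toComplex.R.Hom s.model :=
  s.retrHom.comp (SComplex.mapR (C := M.toComplex) θ.toCech θ.toCech_degree
    fun m => (map_zero θ.toCech).trans (θ.d_toCech m).symm)

theorem SheafIso.embedding_apply (s : F.cech.Contraction)
    (x : M.carrier ⊗[k] Module.Dual k (ExtAlg k n)) :
    (θ.embedding s).toFun x = omegaMap n (θ.toHarmonic s) x :=
  θ.retr_omegaMap s x

theorem SheafIso.embedding_injective (s : F.cech.Contraction) (hM : H0B Δ M = ⊥) :
    Function.Injective (θ.embedding s).toFun := by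
  -- Tensoring with `ω_E` over the field `k` is exact.
  have h : Function.Injective (omegaMap n (θ.toHarmonic s)) :=
    Module.Flat.rTensor_preserves_injective_linearMap _ (θ.toHarmonic_injective s hM)
  intro x y hxy
  exact h ((θ.embedding_apply s x).symm.trans (hxy.trans (θ.embedding_apply s y)))

theorem SheafIso.homEquiv_embedding (s : F.cech.Contraction) (a : Δ.Cl) (m : M.piece a) :
    s.homEquiv a (-0) ((θ.embedding s).push (M.toComplex.socHom (M.inPiece m))) =
      θ.toH0 F a m := by
  rw [s.homEquiv_apply]
  refine s.homology_mk_eq (congrArg s.proj ?_)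
  rw [s.coe_homToCycles]
  have h1 : ((θ.embedding s).push (M.toComplex.socHom (M.inPiece m))).1 (residueOne k Δ.deg) =
      omegaMap n (θ.toHarmonic s) ((1 : k) • ((m : M.carrier) ⊗ₜ[k] augm k n)) :=
    θ.embedding_apply s _
  have h2 : evalAt (V := s.harmonic) 1
      (omegaMap n (θ.toHarmonic s) ((1 : k) • ((m : M.carrier) ⊗ₜ[k] augm k n))) =
      θ.toHarmonic s m := by
    rw [one_smul, omegaMap_tmul, evalAt_tmul, augm_one, one_smul]
  refine (congrArg (fun x => ((evalAt (V := s.harmonic) 1 x : s.harmonic) : F.cech.carrier))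
    h1).trans ?_
  rw [h2, θ.coe_toHarmonic, θ.toCech_apply]

end Embedding

end ToricTate

end

universe u v t t'

open ToricTate in
theorem theorem3p2 {k : Type u} [Field k] {N : Type v} [AddCommGroup N]
    [Module.Free ℤ N] [Module.Finite ℤ N] {n : ℕ} (Δ : Fan N n) (hΔ : Δ.IsProjective)
    [LinearOrder Δ.MaxCone] (F : CoherentSheaf.{t} Δ k) :
    ∃ (T : DM.{max u v t} k Δ.deg) (f : T.Hom F.fourierMukai)
      (φ : ∀ (a : Δ.Cl) (j : ℤ),
        internalHom (residue k Δ.deg) T.toGrEMod (a, -j) ≃ₗ[k] F.H j a),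
      -- `T` is the Fourier-Mukai transform of `F`, up to homotopy equivalence
      f.IsHomotopyEquiv ∧
      -- free and minimal
      T.IsFree ∧ T.IsMinimal ∧
      -- sheaf cohomology: the isomorphisms `φ` are induced by the homotopy equivalence
      (∀ (a : Δ.Cl) (j : ℤ) (h : internalHom (residue k Δ.deg) T.toGrEMod (a, -j)),
        ∃ z : F.cech.cycles a (-j),
          f.toFun (h.1 (residueOne k Δ.deg)) = F.cech.soc z ∧
          φ a j h = Submodule.Quotient.mk z) ∧
      -- the embedding of `R(M)` induced by `M → ⨁ H^0(X, F(a))`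
      (∀ (M : GrSMod.{t'} k Δ.deg) (θ : SheafIso M F), H0B Δ M = ⊥ →
        (∀ a, Function.Injective (θ.toH0 F a)) ∧
        ∃ g : M.toComplex.R.Hom T, Function.Injective g.toFun ∧
          ∀ (a : Δ.Cl) (m : M.piece a),
            φ a 0 (g.push (M.toComplex.socHom (M.inPiece m))) = θ.toH0 F a m) ∧
      -- exactness
      (∀ I : Set (Fin (n + 1)), Δ.IsIrrelevant k I →
        Function.Exact (T.restrictD I) (T.restrictD I)) ∧
      T.IsExact := by
  -- The only choice is the contraction of the Čech complex; the model and all the maps are built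
  -- from it, and the embedding works for every `M` at once.
  obtain ⟨s⟩ := F.cech.nonempty_contraction
  have hex : ∀ I : Set (Fin (n + 1)), Δ.IsIrrelevant k I →
      Function.Exact (s.model.restrictD I) (s.model.restrictD I) := fun I hI =>
    s.inclHom_isHomotopyEquiv.restrictD_exact (F.fourierMukai_restrictD_exact hI)
  exact ⟨s.model, s.inclHom, fun a j => s.homEquiv a (-j), s.inclHom_isHomotopyEquiv,
    s.model_isFree, s.model_isMinimal,
    fun a j h => ⟨s.homToCycles a (-j) h, s.inclHom_residueOne h, rfl⟩,
    fun M θ hM => ⟨θ.toH0_injective hM, θ.embedding s, θ.embedding_injective s hM,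
      θ.homEquiv_embedding s⟩,
    hex, DM.isExact_of_restrictD_univ (hex _ (Δ.isIrrelevant_univ k hΔ.1))⟩
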